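/- **Theorem 5.** Let $v:\mathbb R^3\to\mathbb R$ be an even (measurable) potential, $T\ge 0$, and let $\phi(t,x)$ be a complex-valued (measurable) function (in the application, a smooth solution of the Hartree equation $i\phi_t+\Delta\phi-(v*|\phi|^2)\phi=0$; this equation is not needed here). Put $$m(t,x,y)=-v(x-y)\overline{\phi}(t,x)\overline{\phi}(t,y),\qquad g(t,x,y)=-\Delta_x\delta(x-y)+v(x-y)\phi(t,x)\overline{\phi}(t,y)+(v*|\phi|^2)(t,x)\,\delta(x-y),$$ and assume $m\in L^1([0,T];L^2(\mathbb R^3\times\mathbb R^3))$ and $v*|\phi|^2\in L^1([0,T];L^\infty(\mathbb R^3))$, the convolution integral converging absolutely for almost every $(t,x)$. Products of kernels denote composition, $(ab)(x,y)=\int a(x,z)b(z,y)\,dz$, and $g^T(x,y)=g(y,x)$. For each $t\in[0,T]$ let $k(t)\in L^2(\mathbb R^3\times\mathbb R^3)$ be a symmetric kernel, and put $$u=\mathrm{sh}(k)=k+\tfrac1{3!}k\overline kk+\cdots,\qquad 1+p=\mathrm{ch}(k)=1+\tfrac1{2!}k\overline k+\cdots .$$ Suppose that $u$ is a solution on $[0,T]$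 of $$iu_t+ug^T+gu-(1+p)m=\bigl(ip_t+[g,p]+u\overline m\bigr)(1+p)^{-1}u ,$$ in the following sense: $u\in C([0,T];L^2(\mathbb R^3\times\mathbb R^3))$, the distributions $iu_t+gu+ug^T$ and $ip_t+[g,p]$ belong to $L^1([0,T];L^2(\mathbb R^3\times\mathbb R^3))$, and the equation holds for almost every $t\in[0,T]$. Then $$\|u(T)\|_{L^2}\le\Bigl(\int_0^T\|m(t)\|_{L^2}\,dt+\|u(0)\|_{L^2}\Bigr)\exp\Bigl(\int_0^T\|m(t)\|_{L^2}\,dt\Bigr),$$ where all norms are those of $L^2(\mathbb R^3\times\mathbb R^3)$. -/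

import Mathlib

open MeasureTheory Set
open scoped ENNReal ContDiff

noncomputable section

namespace PairExcitation

/-- The physical space `ℝ³`. -/
abbrev E := EuclideanSpace ℝ (Fin 3)

/-- Hilbert-Schmidt kernels: the Hilbert space `L²(ℝ³ × ℝ³; ℂ)`. Complex conjugation is `star`. -/
abbrev L2 := Lp ℂ 2 (volume : Measure (E × E))

/-! ### Composition of kernels -/

/-- Composition of kernels, `(a ∘ b)(x, y) = ∫ a(x, z) b(z, y) dz`. -/
def compFun (a b : E × E → ℂ) : E × E → ℂ :=
  fun q => ∫ z, a (q.1, z) * b (z, q.2)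

theorem enorm_pow_two (a : L2) : ‖a‖ₑ ^ 2 = ∫⁻ q, ‖a q‖ₑ ^ 2 := by
  have h := eLpNorm_nnreal_pow_eq_lintegral (f := (a : E × E → ℂ)) (p := 2)
    (μ := (volume : Measure (E × E))) (by norm_num)
  rw [Lp.enorm_def]
  simpa using h

theorem aux_meas (a b : L2) : Measurable
    (fun s : (E × E) × E => ‖a (s.1.1, s.2)‖ₑ * ‖b (s.2, s.1.2)‖ₑ) := by
  have ha := (Lp.stronglyMeasurable a).measurable
  have hb := (Lp.stronglyMeasurable b).measurable
  fun_prop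

theorem lintegral_comp_le (a b : L2) :
    ∫⁻ q : E × E, (∫⁻ z, ‖a (q.1, z)‖ₑ * ‖b (z, q.2)‖ₑ) ^ 2 ≤ ‖a‖ₑ ^ 2 * ‖b‖ₑ ^ 2 := by
  have ha := (Lp.stronglyMeasurable a).measurable
  have hb := (Lp.stronglyMeasurable b).measurable
  have key : ∀ q : E × E, (∫⁻ z, ‖a (q.1, z)‖ₑ * ‖b (z, q.2)‖ₑ) ^ 2
      ≤ (∫⁻ z, ‖a (q.1, z)‖ₑ ^ 2) * (∫⁻ z, ‖b (z, q.2)‖ₑ ^ 2) := by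
    intro q
    have h := ENNReal.lintegral_mul_le_Lp_mul_Lq (volume : Measure E)
      Real.HolderConjugate.two_two (f := fun z => ‖a (q.1, z)‖ₑ) (g := fun z => ‖b (z, q.2)‖ₑ)
      (by fun_prop) (by fun_prop)
    simp only [Pi.mul_apply, ENNReal.rpow_two] at h
    refine (pow_le_pow_left' h 2).trans (le_of_eq ?_)
    rw [mul_pow, ← ENNReal.rpow_two, ← ENNReal.rpow_two, ← ENNReal.rpow_mul, ← ENNReal.rpow_mul]
    norm_num
  refine (lintegral_mono key).trans (le_of_eq ?_)
  have hA : Measurable fun x : E => ∫⁻ z, ‖a (x, z)‖ₑ ^ 2 := by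
    apply Measurable.lintegral_prod_right'
      (f := fun s : E × E => ‖a (s.1, s.2)‖ₑ ^ 2)
    fun_prop
  have hB : Measurable fun y : E => ∫⁻ z, ‖b (z, y)‖ₑ ^ 2 := by
    apply Measurable.lintegral_prod_right'
      (f := fun s : E × E => ‖b (s.2, s.1)‖ₑ ^ 2)
    fun_prop
  have h1 := lintegral_prod_mul (μ := (volume : Measure E)) (ν := (volume : Measure E))
    hA.aemeasurable hB.aemeasurable
  have h2 := lintegral_prod (μ := (volume : Measure E)) (ν := (volume : Measure E))
    (fun q : E × E => ‖a q‖ₑ ^ 2) (by fun_prop)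
  have h3 := lintegral_prod_symm (μ := (volume : Measure E)) (ν := (volume : Measure E))
    (fun q : E × E => ‖b q‖ₑ ^ 2) (by fun_prop)
  rw [enorm_pow_two, enorm_pow_two]
  exact h1.trans (congrArg₂ (· * ·) h2.symm h3.symm)

theorem enorm_compFun_le (a b : L2) (q : E × E) :
    ‖compFun a b q‖ₑ ≤ ∫⁻ z, ‖a (q.1, z)‖ₑ * ‖b (z, q.2)‖ₑ := by
  refine (enorm_integral_le_lintegral_enorm _).trans (le_of_eq ?_)
  simp only [enorm_mul]

theorem stronglyMeasurable_compFun (a b : L2) : StronglyMeasurable (compFun a b) := by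
  have ha := (Lp.stronglyMeasurable a).measurable
  have hb := (Lp.stronglyMeasurable b).measurable
  have h : StronglyMeasurable (fun s : (E × E) × E => a (s.1.1, s.2) * b (s.2, s.1.2)) :=
    Measurable.stronglyMeasurable (by fun_prop)
  exact h.integral_prod_right'

theorem eLpNorm_compFun_le (a b : L2) : eLpNorm (compFun a b) 2 volume ≤ ‖a‖ₑ * ‖b‖ₑ := by
  have h := eLpNorm_nnreal_pow_eq_lintegral (f := compFun a b) (p := 2)
    (μ := (volume : Measure (E × E))) (by norm_num)
  have h2 : eLpNorm (compFun a b) 2 volume ^ 2 = ∫⁻ q, ‖compFun a b q‖ₑ ^ 2 := by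
    simpa using h
  have h3 : eLpNorm (compFun a b) 2 volume ^ 2 ≤ (‖a‖ₑ * ‖b‖ₑ) ^ 2 := by
    rw [h2, mul_pow]
    exact (lintegral_mono fun q => pow_le_pow_left' (enorm_compFun_le a b q) 2).trans
      (lintegral_comp_le a b)
  exact (ENNReal.pow_le_pow_left_iff (by norm_num)).1 h3

theorem memLp_compFun (a b : L2) : MemLp (compFun a b) 2 volume :=
  ⟨(stronglyMeasurable_compFun a b).aestronglyMeasurable,
    (eLpNorm_compFun_le a b).trans_lt (ENNReal.mul_lt_top enorm_lt_top enorm_lt_top)⟩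

/-- Composition of kernels as an operation on `L²(ℝ³ × ℝ³)`. -/
def comp (a b : L2) : L2 := (memLp_compFun a b).toLp

theorem coeFn_comp (a b : L2) : comp a b =ᵐ[volume] compFun a b := MemLp.coeFn_toLp _

theorem norm_comp_le (a b : L2) : ‖comp a b‖ ≤ ‖a‖ * ‖b‖ := by
  have h : ‖comp a b‖ₑ ≤ ‖a‖ₑ * ‖b‖ₑ := by
    rw [comp, Lp.enorm_toLp]
    exact eLpNorm_compFun_le a b
  have h' := ENNReal.toReal_mono (ENNReal.mul_lt_top enorm_lt_top enorm_lt_top).ne h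
  simpa [ENNReal.toReal_mul] using h'

theorem ae_integrable_comp (a b : L2) :
    ∀ᵐ q : E × E, Integrable fun z => a (q.1, z) * b (z, q.2) := by
  have ha := (Lp.stronglyMeasurable a).measurable
  have hb := (Lp.stronglyMeasurable b).measurable
  have hm : Measurable fun q : E × E => (∫⁻ z, ‖a (q.1, z)‖ₑ * ‖b (z, q.2)‖ₑ) ^ 2 :=
    (Measurable.lintegral_prod_right' (aux_meas a b)).pow_const 2
  have hfin : ∫⁻ q : E × E, (∫⁻ z, ‖a (q.1, z)‖ₑ * ‖b (z, q.2)‖ₑ) ^ 2 ≠ ⊤ :=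
    ((lintegral_comp_le a b).trans_lt (ENNReal.mul_lt_top
      (ENNReal.pow_lt_top enorm_lt_top) (ENNReal.pow_lt_top enorm_lt_top))).ne
  filter_upwards [ae_lt_top hm hfin] with q hq
  refine ⟨(Measurable.aestronglyMeasurable (by fun_prop)), ?_⟩
  have : (∫⁻ z, ‖a (q.1, z)‖ₑ * ‖b (z, q.2)‖ₑ) < ⊤ := by
    by_contra hc
    rw [not_lt, top_le_iff] at hc
    simp [hc] at hq
  simpa [HasFiniteIntegral, enorm_mul] using this

theorem ae_slice {f g : E × E → ℂ} (h : f =ᵐ[volume] g) :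
    ∀ᵐ q : E × E, ∀ᵐ z : E, f (z, q.2) = g (z, q.2) := by
  have h1 : ∀ᵐ s : E × E, f s.swap = g s.swap :=
    (Measure.measurePreserving_swap (μ := (volume : Measure E))
      (ν := (volume : Measure E))).quasiMeasurePreserving.ae h
  have h2 : ∀ᵐ y : E, ∀ᵐ z : E, f (z, y) = g (z, y) := Measure.ae_ae_of_ae_prod h1
  exact (Measure.quasiMeasurePreserving_snd (μ := (volume : Measure E))
    (ν := (volume : Measure E))).ae h2

/-- Left composition with a kernel, as a bounded operator on `L²(ℝ³ × ℝ³)`. -/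
def compLeft (a : L2) : L2 →L[ℂ] L2 :=
  LinearMap.mkContinuous
    { toFun := comp a
      map_add' := by
        intro b c
        apply Lp.ext
        filter_upwards [coeFn_comp a (b + c), coeFn_comp a b, coeFn_comp a c,
          Lp.coeFn_add (comp a b) (comp a c), ae_integrable_comp a b, ae_integrable_comp a c,
          ae_slice (Lp.coeFn_add b c)]
          with q h1 h2 h3 h4 h5 h6 h7
        rw [h1, h4, Pi.add_apply, h2, h3]
        simp only [compFun]
        rw [← integral_add h5 h6]
        refine integral_congr_ae ?_
        filter_upwards [h7] with z hz
        rw [hz, Pi.add_apply, mul_add]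
      map_smul' := by
        intro r b
        apply Lp.ext
        filter_upwards [coeFn_comp a (r • b), coeFn_comp a b, Lp.coeFn_smul r (comp a b),
          ae_slice (Lp.coeFn_smul r b)] with q h1 h2 h3 h4
        rw [RingHom.id_apply, h1, h3, Pi.smul_apply, h2]
        simp only [compFun]
        rw [smul_eq_mul, ← integral_const_mul]
        refine integral_congr_ae ?_
        filter_upwards [h4] with z hz
        rw [hz, Pi.smul_apply, smul_eq_mul]
        ring }
    ‖a‖ (norm_comp_le a)

/-- The transposed kernel `aᵀ(x, y) = a(y, x)`. -/
def transpose (a : L2) : L2 :=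
  Lp.compMeasurePreserving Prod.swap
    (Measure.measurePreserving_swap (μ := (volume : Measure E)) (ν := (volume : Measure E))) a

/-! ### Hyperbolic functions of a kernel -/

/-- `shTerm k n = k (k̄ k)ⁿ = (k k̄)ⁿ k`. -/
def shTerm (k : L2) : ℕ → L2
  | 0 => k
  | n + 1 => comp (comp k (star k)) (shTerm k n)

/-- `chTerm k n = (k k̄)ⁿ⁺¹`. -/
def chTerm (k : L2) : ℕ → L2
  | 0 => comp k (star k)
  | n + 1 => comp (comp k (star k)) (chTerm k n)

/-- `sh(k) = k + (1/3!) k k̄ k + …`, a norm-convergent series in `L²(ℝ³ × ℝ³)`. -/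
def sh (k : L2) : L2 := ∑' n : ℕ, (((2 * n + 1).factorial : ℂ)⁻¹) • shTerm k n

/-- `p = ch(k) - 1 = (1/2!) k k̄ + (1/4!) k k̄ k k̄ + …`, a norm-convergent series in
`L²(ℝ³ × ℝ³)`. -/
def chSubOne (k : L2) : L2 := ∑' n : ℕ, (((2 * n + 2).factorial : ℂ)⁻¹) • chTerm k n

theorem norm_star_L2 (a : L2) : ‖star a‖ = ‖a‖ := by
  refine le_antisymm (Lp.norm_le_norm_of_ae_le ?_) (Lp.norm_le_norm_of_ae_le ?_)
  all_goals filter_upwards [Lp.coeFn_star a] with q hq using by simp [hq]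

theorem norm_shTerm_le (k : L2) (n : ℕ) : ‖shTerm k n‖ ≤ ‖k‖ ^ (2 * n + 1) := by
  induction n with
  | zero => simp [shTerm]
  | succ n ih =>
    calc ‖shTerm k (n + 1)‖ ≤ ‖comp k (star k)‖ * ‖shTerm k n‖ := norm_comp_le _ _
      _ ≤ (‖k‖ * ‖star k‖) * ‖k‖ ^ (2 * n + 1) := by gcongr; exact norm_comp_le _ _
      _ = ‖k‖ ^ (2 * (n + 1) + 1) := by rw [norm_star_L2]; ring

theorem norm_chTerm_le (k : L2) (n : ℕ) : ‖chTerm k n‖ ≤ ‖k‖ ^ (2 * n + 2) := by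
  induction n with
  | zero =>
    calc ‖chTerm k 0‖ ≤ ‖k‖ * ‖star k‖ := norm_comp_le _ _
      _ = ‖k‖ ^ (2 * 0 + 2) := by rw [norm_star_L2]; ring
  | succ n ih =>
    calc ‖chTerm k (n + 1)‖ ≤ ‖comp k (star k)‖ * ‖chTerm k n‖ := norm_comp_le _ _
      _ ≤ (‖k‖ * ‖star k‖) * ‖k‖ ^ (2 * n + 2) := by gcongr; exact norm_comp_le _ _
      _ = ‖k‖ ^ (2 * (n + 1) + 2) := by rw [norm_star_L2]; ring

theorem summable_sh (k : L2) :
    Summable fun n : ℕ => (((2 * n + 1).factorial : ℂ)⁻¹) • shTerm k n := by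
  have h := (Real.summable_pow_div_factorial ‖k‖).comp_injective
    (i := fun n : ℕ => 2 * n + 1) (fun a b h => by simpa using h)
  refine Summable.of_norm_bounded h fun n => ?_
  rw [norm_smul, norm_inv, Complex.norm_natCast, Function.comp_apply, div_eq_inv_mul]
  gcongr
  exact norm_shTerm_le k n

theorem summable_ch (k : L2) :
    Summable fun n : ℕ => (((2 * n + 2).factorial : ℂ)⁻¹) • chTerm k n := by
  have h := (Real.summable_pow_div_factorial ‖k‖).comp_injective
    (i := fun n : ℕ => 2 * n + 2) (fun a b h => by simpa using h)
  refine Summable.of_norm_bounded h fun n => ?_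
  rw [norm_smul, norm_inv, Complex.norm_natCast, Function.comp_apply, div_eq_inv_mul]
  gcongr
  exact norm_chTerm_le k n

/-- The composition `(1 + p)⁻¹ u`: the inverse of the bounded operator `z ↦ z + p z`
of `L²(ℝ³ × ℝ³)`, applied to `u`. -/
def invOneAdd (p u : L2) : L2 := Ring.inverse (1 + compLeft p) u

/-! ### The coefficients of the equation -/

/-- A function on `ℝ³ × ℝ³` as an element of `L²` (and `0` if it is not square-integrable). -/
def toL2 (f : E × E → ℂ) : L2 :=
  open Classical in if h : MemLp f 2 (volume : Measure (E × E)) then h.toLp else 0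

/-- `m(t, x, y) = - v(x - y) φ̄(t, x) φ̄(t, y)`. -/
def mFun (v : E → ℝ) (φ : ℝ → E → ℂ) (t : ℝ) : E × E → ℂ :=
  fun q => -((v (q.1 - q.2) : ℂ) * star (φ t q.1) * star (φ t q.2))

/-- `w(t, x, y) = v(x - y) φ(t, x) φ̄(t, y)`. -/
def wFun (v : E → ℝ) (φ : ℝ → E → ℂ) (t : ℝ) : E × E → ℂ :=
  fun q => (v (q.1 - q.2) : ℂ) * φ t q.1 * star (φ t q.2)

/-- The kernel `m(t)` in `L²(ℝ³ × ℝ³)`. -/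
def mKer (v : E → ℝ) (φ : ℝ → E → ℂ) (t : ℝ) : L2 := toL2 (mFun v φ t)

/-- The kernel `w(t)` in `L²(ℝ³ × ℝ³)`; it has the same modulus as `m(t)`. -/
def wKer (v : E → ℝ) (φ : ℝ → E → ℂ) (t : ℝ) : L2 := toL2 (wFun v φ t)

/-- The mean-field potential `(v * |φ|²)(t, x)`. -/
def meanField (v : E → ℝ) (φ : ℝ → E → ℂ) (t : ℝ) (x : E) : ℝ :=
  ∫ y, v (x - y) * ‖φ t y‖ ^ 2

/-! ### Weak form of the operators `S` and `W`

Here `g = -Δ + w + v * |φ|²`, so that `g a`, `a g` and `a gᵀ` are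
`-Δ_x a + w a + (v * |φ|²)(x) a`, `-Δ_y a + a w + (v * |φ|²)(y) a` and
`-Δ_y a + a wᵀ + (v * |φ|²)(y) a`. -/

/-- Test functions: smooth, compactly supported functions on `ℝ³ × ℝ³`. -/
def IsTest (ψ : E × E → ℂ) : Prop := ContDiff ℝ ∞ ψ ∧ HasCompactSupport ψ

/-- `Δ_x ψ`. -/
def lapX (ψ : E × E → ℂ) : E × E → ℂ := fun q => (Laplacian.laplacian (fun x : E => ψ (x, q.2))) q.1

/-- `Δ_y ψ`. -/
def lapY (ψ : E × E → ℂ) : E × E → ℂ := fun q => (Laplacian.laplacian (fun y : E => ψ (q.1, y))) q.2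

/-- The bilinear pairing `∫∫ a(x, y) ψ(x, y) dx dy`. -/
def pair (a : L2) (ψ : E × E → ℂ) : ℂ := ∫ q, a q * ψ q

/-- `S(u) := i u_t + g u + u gᵀ = G` on `[0, T]`, in the sense of distributions
(tested in space, integrated in time). -/
def IsS (v : E → ℝ) (φ : ℝ → E → ℂ) (T : ℝ) (u G : ℝ → L2) : Prop :=
  ∀ ψ : E × E → ℂ, IsTest ψ → ∀ t ∈ Icc 0 T,
    Complex.I * (pair (u t) ψ - pair (u 0) ψ)
      + ∫ s in (0 : ℝ)..t,
          (pair (u s) (fun q => -lapX ψ q - lapY ψ q)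
            + pair (comp (wKer v φ s) (u s) + comp (u s) (transpose (wKer v φ s))) ψ
            + pair (u s) (fun q => ((meanField v φ s q.1 + meanField v φ s q.2 : ℝ) : ℂ) * ψ q))
      = ∫ s in (0 : ℝ)..t, pair (G s) ψ

/-- `W(p) := i p_t + [g, p] = F` on `[0, T]`, in the sense of distributions
(tested in space, integrated in time). -/
def IsW (v : E → ℝ) (φ : ℝ → E → ℂ) (T : ℝ) (p F : ℝ → L2) : Prop :=
  ∀ ψ : E × E → ℂ, IsTest ψ → ∀ t ∈ Icc 0 T,
    Complex.I * (pair (p t) ψ - pair (p 0) ψ)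
      + ∫ s in (0 : ℝ)..t,
          (pair (p s) (fun q => -lapX ψ q + lapY ψ q)
            + pair (comp (wKer v φ s) (p s) - comp (p s) (wKer v φ s)) ψ
            + pair (p s) (fun q => ((meanField v φ s q.1 - meanField v φ s q.2 : ℝ) : ℂ) * ψ q))
      = ∫ s in (0 : ℝ)..t, pair (F s) ψ

/-- `u = sh(k)`, with `1 + p = ch(k)` and `k(t)` symmetric, is a solution on `[0, T]` of
`i u_t + u gᵀ + g u - (1 + p) m = (i p_t + [g, p] + u m̄) (1 + p)⁻¹ u`:
`u` is continuous in time with values in `L²(ℝ³ × ℝ³)`, the distributions `W(p) = i p_t + [g, p]`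
and `S(u) = i u_t + g u + u gᵀ` are given by functions `F` and `G` in `L¹([0, T]; L²)`, and the
equation holds in `L²(ℝ³ × ℝ³)` for almost every time. -/
structure IsSolution (v : E → ℝ) (φ : ℝ → E → ℂ) (T : ℝ) (k : ℝ → L2) : Prop where
  symm : ∀ t ∈ Icc 0 T, transpose (k t) = k t
  cont : ContinuousOn (fun t => sh (k t)) (Icc 0 T)
  eqn : ∃ F G : ℝ → L2, IntegrableOn F (Icc 0 T) ∧ IntegrableOn G (Icc 0 T) ∧
    IsW v φ T (fun t => chSubOne (k t)) F ∧
    IsS v φ T (fun t => sh (k t)) G ∧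
    ∀ᵐ t ∂(volume.restrict (Icc 0 T)),
      G t - (mKer v φ t + comp (chSubOne (k t)) (mKer v φ t))
        = comp (F t + comp (sh (k t)) (star (mKer v φ t)))
            (invOneAdd (chSubOne (k t)) (sh (k t)))

end PairExcitation

end

open PairExcitation

noncomputable section

namespace PairExcitation

/-! ### Algebra of Hilbert-Schmidt kernels -/

/-! Write `c = 1 + p = ch(k)`, `F = i p_t + [g, p]` and `G = i u_t + g u + u gᵀ`. Since `k` is
symmetric, `k̄ = k*`; hence `c` is self-adjoint, `c ≥ 1`, and `c² = 1 + u u*`. The equation reads `G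
= c m + A u` with `A = (F + u m̄) c⁻¹`. The crux is that `A` is self-adjoint, although it contains a
time derivative. As `g` is self-adjoint, `p = p*` gives `F* = -F`, and applying `i ∂_t + [g, ·]` to
`c² = 1 + u u*` gives `F c + c F = G u* - u G*`. Inserting `F = A c - u m̄` and `G = c m + A u`,
everything cancels except `A* = A` (`star_eq_self_of_commutator`).

The energy identity is `d/dt ‖u‖² = 2 Im ⟨u, G⟩`, where the terms in `g` drop out by symmetry. Since
`⟨u, A u⟩` is real, only `Im ⟨u, c m⟩` is left. From `‖c m‖² = ‖m‖² + ‖u* m‖²` one gets `‖c m‖ ≤ (1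
+ ‖u‖) ‖m‖`, so formally `d/dt ‖u‖ ≤ (1 + ‖u‖) ‖m‖`. With `M = ∫ ‖m‖`, Gronwall gives `1 + ‖u(T)‖ ≤
(1 + ‖u(0)‖) e^M`, and `e^M - 1 ≤ M e^M` finishes.

The analytic work is to justify these manipulations for weak solutions. Everything except the
Laplacians is moved to a source in `L¹([0, T]; L²)`, and the equations are convolved with tensor
products of even mollifiers (`IsSchrodinger`). In a composition `a b` the Laplacians in the
integrated variable cancel exactly when both factors are mollified there by the same function, so
that mollifier can be removed while the outer ones stay fixed (`IsSchrodinger.comp`). A kernel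
determines its source almost everywhere (`IsSchrodinger.ae_eq`), which turns identities between
kernels into identities between sources. Continuity in time of `p` follows from that of `u` by a
monotonicity estimate (`norm_chSubOne_sub_le`). -/

theorem ae_slice_left {f g : E × E → ℂ} (h : f =ᵐ[volume] g) :
    ∀ᵐ q : E × E, ∀ᵐ z : E, f (q.1, z) = g (q.1, z) :=
  (Measure.quasiMeasurePreserving_fst (μ := (volume : Measure E))
    (ν := (volume : Measure E))).ae (Measure.ae_ae_of_ae_prod h)

theorem comp_ae_eq {a b : L2} {f g : E × E → ℂ} (ha : a =ᵐ[volume] f) (hb : b =ᵐ[volume] g) :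
    comp a b =ᵐ[volume] compFun f g := by
  filter_upwards [coeFn_comp a b, ae_slice_left ha, ae_slice hb] with q h h1 h2
  rw [h]
  refine integral_congr_ae ?_
  filter_upwards [h1, h2] with z hz1 hz2
  rw [hz1, hz2]

theorem comp_add_right (a b c : L2) : comp a (b + c) = comp a b + comp a c :=
  (compLeft a).map_add b c

theorem comp_smul_right (r : ℂ) (a b : L2) : comp a (r • b) = r • comp a b :=
  (compLeft a).map_smul r b

theorem compLeft_apply (a b : L2) : compLeft a b = comp a b := rfl

/-- The adjoint kernel `a*(x, y) = conj a(y, x)`. -/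
def adj (a : L2) : L2 := star (transpose a)

theorem coeFn_transpose (a : L2) : transpose a =ᵐ[volume] fun q => a q.swap :=
  Lp.coeFn_compMeasurePreserving _ _

theorem ae_swap {P : E × E → Prop} (h : ∀ᵐ q : E × E, P q) : ∀ᵐ q : E × E, P q.swap :=
  (Measure.measurePreserving_swap (μ := (volume : Measure E))
      (ν := (volume : Measure E))).quasiMeasurePreserving.ae h

theorem coeFn_adj (a : L2) : adj a =ᵐ[volume] fun q => star (a q.swap) := by
  filter_upwards [Lp.coeFn_star (transpose a), coeFn_transpose a] with q h1 h2
  rw [adj, h1, Pi.star_apply, h2]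

theorem star_comp (a b : L2) : star (comp a b) = comp (star a) (star b) := by
  apply Lp.ext
  filter_upwards [Lp.coeFn_star (comp a b), coeFn_comp a b,
    comp_ae_eq (Lp.coeFn_star a) (Lp.coeFn_star b)] with q h1 h2 h3
  rw [h1, h3, Pi.star_apply, h2]
  simp only [compFun, Pi.star_apply]
  rw [Complex.star_def, ← integral_conj]
  simp

theorem transpose_comp (a b : L2) : transpose (comp a b) = comp (transpose b) (transpose a) := by
  apply Lp.ext
  filter_upwards [coeFn_transpose (comp a b), ae_swap (coeFn_comp a b),
    comp_ae_eq (coeFn_transpose b) (coeFn_transpose a)] with q h1 h2 h3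
  rw [h1, h3, h2]
  simp only [compFun, Prod.fst_swap, Prod.snd_swap, Prod.swap_prod_mk]
  simp only [mul_comm]

theorem adj_comp (a b : L2) : adj (comp a b) = comp (adj b) (adj a) := by
  rw [adj, transpose_comp, star_comp]; rfl

theorem transpose_smul (r : ℂ) (a : L2) : transpose (r • a) = r • transpose a :=
  (Lp.compMeasurePreservingₗ ℂ Prod.swap (Measure.measurePreserving_swap
    (μ := (volume : Measure E)) (ν := (volume : Measure E)))).map_smul r a

theorem norm_transpose (a : L2) : ‖transpose a‖ = ‖a‖ := Lp.norm_compMeasurePreserving _ _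

theorem transpose_transpose (a : L2) : transpose (transpose a) = a := by
  apply Lp.ext
  filter_upwards [coeFn_transpose (transpose a), ae_swap (coeFn_transpose a)] with q h1 h2
  rw [h1, h2, Prod.swap_swap]

theorem transpose_star (a : L2) : transpose (star a) = star (transpose a) := by
  apply Lp.ext
  filter_upwards [coeFn_transpose (star a), ae_swap (Lp.coeFn_star a), coeFn_adj a] with q h1 h2 h3
  rw [h1, h2, Pi.star_apply, ← h3]; rfl

theorem adj_adj (a : L2) : adj (adj a) = a := by
  rw [adj, adj, transpose_star, star_star, transpose_transpose]

theorem norm_adj (a : L2) : ‖adj a‖ = ‖a‖ := by rw [adj, norm_star_L2, norm_transpose]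

theorem adj_add (a b : L2) : adj (a + b) = adj a + adj b := by
  apply Lp.ext
  filter_upwards [coeFn_adj (a + b), coeFn_adj a, coeFn_adj b, Lp.coeFn_add (adj a) (adj b),
    ae_swap (Lp.coeFn_add a b)] with q h1 h2 h3 h4 h5
  rw [h1, h4, Pi.add_apply, h2, h3, h5, Pi.add_apply, star_add]

theorem star_smul_L2 (r : ℂ) (a : L2) : star (r • a) = star r • star a := by
  apply Lp.ext
  filter_upwards [Lp.coeFn_star (r • a), Lp.coeFn_smul r a, Lp.coeFn_star a,
    Lp.coeFn_smul (star r) (star a)] with q h1 h2 h3 h4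
  rw [h1, h4, Pi.star_apply, h2, Pi.smul_apply, Pi.smul_apply, h3, Pi.star_apply, star_smul]

theorem adj_smul (r : ℂ) (a : L2) : adj (r • a) = star r • adj a := by
  rw [adj, transpose_smul, star_smul_L2]; rfl

theorem real_smul_L2 (r : ℝ) (a : L2) : r • a = (r : ℂ) • a := by
  apply Lp.ext
  filter_upwards [Lp.coeFn_smul r a, Lp.coeFn_smul (r : ℂ) a] with q h1 h2
  rw [h1, h2, Pi.smul_apply, Pi.smul_apply, Complex.coe_smul]

/-- The adjoint as a real-linear isometry of `L²(ℝ³ × ℝ³)`. -/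
def adjₗᵢ : L2 →ₗᵢ[ℝ] L2 where
  toFun := adj
  map_add' := adj_add
  map_smul' r a := by
    rw [real_smul_L2, adj_smul, RingHom.id_apply, real_smul_L2, Complex.star_def,
      Complex.conj_ofReal]
  norm_map' := norm_adj

theorem adjₗᵢ_apply (a : L2) : adjₗᵢ a = adj a := rfl

theorem adj_sub (a b : L2) : adj (a - b) = adj a - adj b := adjₗᵢ.map_sub a b

theorem continuous_adj : Continuous adj := adjₗᵢ.continuous

theorem comp_add_left (a b c : L2) : comp (a + b) c = comp a c + comp b c := by
  rw [← adj_adj (comp (a + b) c), adj_comp, adj_add, comp_add_right, adj_add, adj_comp, adj_comp,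
    adj_adj, adj_adj, adj_adj]

theorem comp_smul_left (r : ℂ) (a b : L2) : comp (r • a) b = r • comp a b := by
  rw [← adj_adj (comp (r • a) b), adj_comp, adj_smul, comp_smul_right, adj_smul, adj_comp, adj_adj,
    adj_adj, star_star]

/-- Composition of kernels as a bounded bilinear map. -/
def compL : L2 →L[ℂ] L2 →L[ℂ] L2 :=
  LinearMap.mkContinuous
    { toFun := compLeft
      map_add' := fun a b => ContinuousLinearMap.ext fun c => comp_add_left a b c
      map_smul' := fun r a => ContinuousLinearMap.ext fun c => comp_smul_left r a c }
    1 (fun a => ContinuousLinearMap.opNorm_le_bound _ (by positivity)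
      (fun b => by rw [one_mul]; exact norm_comp_le a b))

theorem compL_apply (a b : L2) : compL a b = comp a b := rfl

/-- The kernel `|a(x, y)|`. -/
def absKer (a : L2) : L2 := (show MemLp (fun q => ((‖a q‖ : ℝ) : ℂ)) 2 volume from
  (Lp.memLp a).norm.ofReal).toLp

theorem coeFn_absKer (a : L2) : absKer a =ᵐ[volume] fun q => ((‖a q‖ : ℝ) : ℂ) :=
  MemLp.coeFn_toLp _

theorem coeFn_comp_absKer (a b : L2) :
    comp (absKer a) (absKer b) =ᵐ[volume] fun q => ((∫ z, ‖a (q.1, z)‖ * ‖b (z, q.2)‖ : ℝ) : ℂ) := by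
  filter_upwards [comp_ae_eq (coeFn_absKer a) (coeFn_absKer b)] with q hq
  rw [hq, ← integral_complex_ofReal]
  simp [compFun]

theorem ae_ae_integrable_comp (b c : L2) :
    ∀ᵐ q : E × E, ∀ᵐ w : E, Integrable fun z => b (w, z) * c (z, q.2) := by
  have h : ∀ᵐ y : E, ∀ᵐ w : E, Integrable fun z => b (w, z) * c (z, y) :=
    Measure.ae_ae_of_ae_prod (ae_swap (ae_integrable_comp b c))
  exact (Measure.quasiMeasurePreserving_snd (μ := (volume : Measure E))
    (ν := (volume : Measure E))).ae h

/-- Fubini in the two intermediate variables. Absolute integrability holds because `|a|`, `|b|`,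
`|c|` are again Hilbert-Schmidt kernels, so the integral defining `|a| (|b| |c|)` converges at
almost every point. -/
theorem comp_assoc (a b c : L2) : comp (comp a b) c = comp a (comp b c) := by
  have ha := (Lp.stronglyMeasurable a).measurable
  have hb := (Lp.stronglyMeasurable b).measurable
  have hc := (Lp.stronglyMeasurable c).measurable
  apply Lp.ext
  filter_upwards [comp_ae_eq (coeFn_comp a b) (Filter.EventuallyEq.refl _ c),
    comp_ae_eq (Filter.EventuallyEq.refl _ a) (coeFn_comp b c),
    ae_integrable_comp (absKer a) (comp (absKer b) (absKer c)), ae_slice_left (coeFn_absKer a),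
    ae_slice (coeFn_comp_absKer b c),
    ae_ae_integrable_comp b c] with q h1 h2 h3 h4 h5 h6
  rw [h1, h2]
  simp only [compFun]
  simp_rw [← integral_mul_const, ← integral_const_mul]
  rw [integral_integral_swap]
  · simp only [mul_assoc]
  · have : Integrable (fun s : E × E => a (q.1, s.1) * b (s.1, s.2) * c (s.2, q.2))
        ((volume : Measure E).prod volume) := by
      rw [integrable_prod_iff (Measurable.aestronglyMeasurable (by fun_prop))]
      constructor
      · filter_upwards [h6] with w hw
        simpa [mul_assoc] using hw.const_mul (a (q.1, w))
      · refine (h3.norm).congr ?_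
        filter_upwards [h4, h5] with w h4 h5
        rw [h4, h5]
        simp only [norm_mul, Complex.norm_real, norm_norm, mul_assoc, integral_const_mul]
        rw [Real.norm_of_nonneg (integral_nonneg fun z => by positivity)]
    exact this.swap

/-! ### The Hilbert-Schmidt inner product and adjoints. -/

theorem inner_L2 (a b : L2) : inner ℂ a b = ∫ q, b q * star (a q) := by
  rw [L2.inner_def]; simp [RCLike.inner_apply]

theorem integrable_mul_star (a b : L2) : Integrable fun q => b q * star (a q) := by
  simpa [RCLike.inner_apply] using L2.integrable_inner (𝕜 := ℂ) a b

/-- Both sides are the same triple integral. With it, `compLeft` becomes a `*`-representation of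
kernels by bounded operators on `L2`, where `1 + p` makes sense even though the identity has no
kernel in `L2`. -/
theorem inner_comp_left (a b c : L2) : inner ℂ (comp a b) c = inner ℂ b (comp (adj a) c) := by
  have ha := (Lp.stronglyMeasurable a).measurable
  have hb := (Lp.stronglyMeasurable b).measurable
  have hc := (Lp.stronglyMeasurable c).measurable
  have hint : Integrable (fun s : (E × E) × E =>
      c s.1 * star (a (s.1.1, s.2) * b (s.2, s.1.2))) (volume.prod volume) := by
    rw [integrable_prod_iff (Measurable.aestronglyMeasurable (by fun_prop))]
    constructor
    · filter_upwards [ae_integrable_comp a b] with q hq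
      exact (Complex.conjCLE.toContinuousLinearMap.integrable_comp hq).const_mul (c q)
    · refine (integrable_mul_star (comp (absKer a) (absKer b)) c).norm.congr ?_
      filter_upwards [coeFn_comp_absKer a b] with q hq
      rw [hq]
      simp only [norm_mul, norm_star, Complex.norm_real, integral_const_mul]
      rw [Real.norm_of_nonneg (integral_nonneg fun z => by positivity)]
  have hL : inner ℂ (comp a b) c
      = ∫ q : E × E, ∫ z, c q * star (a (q.1, z) * b (z, q.2)) := by
    rw [inner_L2]
    refine integral_congr_ae ?_
    filter_upwards [coeFn_comp a b] with q hq
    rw [hq, compFun, integral_const_mul]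
    congr 1
    rw [Complex.star_def, ← integral_conj]
  have hR : inner ℂ b (comp (adj a) c)
      = ∫ q : E × E, ∫ x, c (x, q.2) * star (a (x, q.1) * b (q.1, q.2)) := by
    rw [inner_L2]
    refine integral_congr_ae ?_
    filter_upwards [comp_ae_eq (coeFn_adj a) (Filter.EventuallyEq.refl _ c)] with q hq
    rw [hq, compFun, ← integral_mul_const]
    refine integral_congr_ae (Filter.Eventually.of_forall fun x => ?_)
    simp only [Prod.swap_prod_mk, star_mul']
    ring
  rw [hL, hR, ← integral_prod _ hint]
  -- The involution `((x, y), z) ↦ ((z, y), x)` exchanges the row variable with the integrated one.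
  have hmp : MeasurePreserving (fun s : (E × E) × E => ((s.2, s.1.2), s.1.1))
      (((volume : Measure E).prod volume).prod volume)
      (((volume : Measure E).prod volume).prod volume) := by
    have h1 := (MeasurePreserving.id (volume : Measure E)).prod
      (Measure.measurePreserving_swap (μ := (volume : Measure E)) (ν := (volume : Measure E)))
    have h2 := measurePreserving_prodAssoc (volume : Measure E) (volume : Measure E)
      (volume : Measure E)
    have h3 := Measure.measurePreserving_swap (μ := (volume : Measure E))
      (ν := (volume : Measure E).prod (volume : Measure E))
    exact (h3.comp h1).comp h2
  have hme : MeasurableEmbedding (fun s : (E × E) × E => ((s.2, s.1.2), s.1.1)) :=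
    (MeasurableEquiv.mk
      (⟨fun s => ((s.2, s.1.2), s.1.1), fun s => ((s.2, s.1.2), s.1.1), fun _ => rfl, fun _ => rfl⟩ :
        ((E × E) × E) ≃ ((E × E) × E))
      (show Measurable fun s : (E × E) × E => ((s.2, s.1.2), s.1.1) by fun_prop)
      (show Measurable fun s : (E × E) × E => ((s.2, s.1.2), s.1.1) by fun_prop)).measurableEmbedding
  have hint' : Integrable (fun s : (E × E) × E =>
      c (s.2, s.1.2) * star (a (s.2, s.1.1) * b (s.1.1, s.1.2))) (volume.prod volume) :=
    (hmp.integrable_comp_emb hme).2 hint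
  rw [← integral_prod _ hint']
  exact (hmp.integral_comp hme
    (fun s : (E × E) × E => c s.1 * star (a (s.1.1, s.2) * b (s.2, s.1.2)))).symm

theorem inner_adj_adj (a b : L2) : inner ℂ (adj a) (adj b) = inner ℂ b a := by
  rw [inner_L2, inner_L2]
  have h := (Measure.measurePreserving_swap (μ := (volume : Measure E))
      (ν := (volume : Measure E))).integral_comp MeasurableEquiv.prodComm.measurableEmbedding
      (fun q => a q * star (b q))
  refine Eq.trans ?_ h
  refine integral_congr_ae ?_
  filter_upwards [coeFn_adj a, coeFn_adj b] with q h1 h2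
  rw [h1, h2, star_star, mul_comm]

theorem adjoint_compLeft (a : L2) :
    ContinuousLinearMap.adjoint (compLeft a) = compLeft (adj a) := by
  symm
  rw [ContinuousLinearMap.eq_adjoint_iff]
  intro x y
  rw [compLeft_apply, compLeft_apply, inner_comp_left, adj_adj]

theorem compLeft_comp (a b : L2) : compLeft (comp a b) = compLeft a * compLeft b :=
  ContinuousLinearMap.ext fun c => comp_assoc a b c

theorem compLeft_add (a b : L2) : compLeft (a + b) = compLeft a + compLeft b := compL.map_add a b

theorem inner_comp_right (a b c : L2) : inner ℂ (comp a b) c = inner ℂ a (comp c (adj b)) := by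
  rw [← inner_adj_adj c, adj_comp, ← inner_adj_adj (comp c (adj b)), adj_comp, adj_adj,
    ← inner_conj_symm, inner_comp_left, inner_conj_symm, adj_adj]

theorem compL_isBoundedBilinearMap :
    IsBoundedBilinearMap ℝ (fun x : L2 × L2 => comp x.1 x.2) where
  add_left := comp_add_left
  smul_left r a b := by simp only [real_smul_L2, comp_smul_left]
  add_right := comp_add_right
  smul_right r a b := by simp only [real_smul_L2, comp_smul_right]
  bound := ⟨1, one_pos, fun a b => by simpa using norm_comp_le a b⟩

end PairExcitation

end

noncomputable section

namespace PairExcitation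

/-! ### Hyperbolic functions of a symmetric kernel -/

theorem adj_eq_star_of_symm {k : L2} (hk : transpose k = k) : adj k = star k := by rw [adj, hk]

theorem transpose_star_of_symm {k : L2} (hk : transpose k = k) : transpose (star k) = star k := by
  rw [transpose_star, hk]

theorem comp_shTerm_right (k : L2) (n : ℕ) :
    comp (shTerm k n) (comp (star k) k) = comp (comp k (star k)) (shTerm k n) := by
  induction n with
  | zero => simp only [shTerm, comp_assoc]
  | succ n ih => rw [shTerm, comp_assoc, ih]

theorem comp_chTerm_right (k : L2) (n : ℕ) :
    comp (chTerm k n) (comp k (star k)) = comp (comp k (star k)) (chTerm k n) := by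
  induction n with
  | zero => simp only [chTerm]
  | succ n ih => rw [chTerm, comp_assoc, ih]

theorem transpose_shTerm {k : L2} (hk : transpose k = k) (n : ℕ) :
    transpose (shTerm k n) = shTerm k n := by
  induction n with
  | zero => simpa only [shTerm] using hk
  | succ n ih =>
    rw [shTerm, transpose_comp, ih, transpose_comp, transpose_star_of_symm hk, hk,
      comp_shTerm_right]

theorem adj_comp_self_star {k : L2} (hk : transpose k = k) :
    adj (comp k (star k)) = comp k (star k) := by
  rw [adj_comp, adj_eq_star_of_symm hk, ← adj_eq_star_of_symm hk, adj_adj]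

theorem adj_chTerm {k : L2} (hk : transpose k = k) (n : ℕ) :
    adj (chTerm k n) = chTerm k n := by
  induction n with
  | zero => simpa only [chTerm] using adj_comp_self_star hk
  | succ n ih => rw [chTerm, adj_comp, ih, adj_comp_self_star hk, comp_chTerm_right]

/-! ### Products of the hyperbolic series. -/

theorem comp_shTerm_star (k : L2) (i : ℕ) : comp (shTerm k i) (star k) = chTerm k i := by
  induction i with
  | zero => rfl
  | succ i ih => rw [shTerm, comp_assoc, ih, chTerm]

theorem comp_shTerm_star_shTerm (k : L2) (i j : ℕ) :
    comp (shTerm k i) (star (shTerm k j)) = chTerm k (i + j) := by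
  induction j generalizing i with
  | zero => exact comp_shTerm_star k i
  | succ j ih =>
    rw [shTerm, star_comp, star_comp, star_star, ← comp_assoc, comp_shTerm_right]
    rw [show i + (j + 1) = (i + 1) + j by ring, ← ih (i + 1), shTerm]

theorem comp_chTerm_chTerm (k : L2) (i j : ℕ) :
    comp (chTerm k i) (chTerm k j) = chTerm k (i + j + 1) := by
  induction i with
  | zero => rw [zero_add]; rfl
  | succ i ih =>
    rw [chTerm, comp_assoc, ih, show i + 1 + j + 1 = (i + j + 1) + 1 by ring]; rfl

theorem tsum_comp_tsum {S R r : ℕ → L2} {α β : ℕ → ℂ} (hS : Summable fun n => ‖α n • S n‖)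
    (hR : Summable fun n => ‖β n • R n‖) (h : ∀ i j, comp (S i) (R j) = r (i + j)) :
    HasSum (fun n => (∑ x ∈ Finset.HasAntidiagonal.antidiagonal n, α x.1 * β x.2) • r n)
      (comp (∑' n, α n • S n) (∑' n, β n • R n)) := by
  have hterm : ∀ x : ℕ × ℕ, comp (α x.1 • S x.1) (β x.2 • R x.2)
      = (α x.1 * β x.2) • r (x.1 + x.2) := fun x => by
    rw [comp_smul_left, comp_smul_right, h, smul_smul]
  have hsum : Summable fun x : ℕ × ℕ => (α x.1 * β x.2) • r (x.1 + x.2) := by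
    refine Summable.of_norm_bounded
      (hS.mul_of_nonneg hR (fun _ => norm_nonneg _) (fun _ => norm_nonneg _)) fun x => ?_
    rw [← hterm]
    exact norm_comp_le _ _
  have htot : ∑' x : ℕ × ℕ, (α x.1 * β x.2) • r (x.1 + x.2)
      = comp (∑' n, α n • S n) (∑' n, β n • R n) := by
    rw [hsum.tsum_prod]
    have h1 : ∀ i, ∑' j, (α i * β j) • r (i + j) = comp (α i • S i) (∑' n, β n • R n) := fun i => by
      rw [← compLeft_apply, (compLeft _).map_tsum hR.of_norm]
      exact tsum_congr fun j => (hterm (i, j)).symm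
    rw [tsum_congr h1]
    exact ((ContinuousLinearMap.map_tsum (compL.flip (∑' n, β n • R n)) hS.of_norm)).symm
  rw [← htot]
  have h2 : HasSum ((fun x : ℕ × ℕ => (α x.1 * β x.2) • r (x.1 + x.2)) ∘
      Finset.HasAntidiagonal.sigmaAntidiagonalEquivProd) (∑' x : ℕ × ℕ, (α x.1 * β x.2) • r (x.1 + x.2)) :=
    (Finset.HasAntidiagonal.sigmaAntidiagonalEquivProd.hasSum_iff).2 hsum.hasSum
  convert! h2.sigma fun n => hasSum_fintype _ using 2 with n
  rw [Finset.sum_smul, ← Finset.sum_attach]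
  refine Finset.sum_congr rfl fun x _ => ?_
  simp only [Function.comp_apply, Finset.HasAntidiagonal.sigmaAntidiagonalEquivProd_apply]
  rw [Finset.HasAntidiagonal.mem_antidiagonal.1 x.2]

/-- The coefficient of degree `2n + 2` in `cosh² - sinh² = 1`. Multiplied by `(2n + 2)!`, it says
that the binomial coefficients of even and of odd index have the same sum. -/
theorem sum_even_eq_sum_odd_inv_factorial (n : ℕ) :
    ∑ x ∈ Finset.HasAntidiagonal.antidiagonal (n + 1), ((2 * x.1).factorial : ℂ)⁻¹ * ((2 * x.2).factorial : ℂ)⁻¹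
      = ∑ x ∈ Finset.HasAntidiagonal.antidiagonal n,
        ((2 * x.1 + 1).factorial : ℂ)⁻¹ * ((2 * x.2 + 1).factorial : ℂ)⁻¹ := by
  have hsplit : ∀ (f : ℕ → ℂ) (N : ℕ), ∑ m ∈ Finset.range (2 * N + 1), f m
      = ∑ i ∈ Finset.range (N + 1), f (2 * i) + ∑ i ∈ Finset.range N, f (2 * i + 1) := by
    intro f N
    induction N with
    | zero => simp
    | succ N ih =>
      rw [show 2 * (N + 1) + 1 = 2 * N + 1 + 1 + 1 by ring, Finset.sum_range_succ,
        Finset.sum_range_succ, ih, Finset.sum_range_succ _ (N + 1),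
        Finset.sum_range_succ (fun i => f (2 * i + 1)) N,
        show 2 * (N + 1) = 2 * N + 1 + 1 by ring]
      ring
  have halt : ∑ m ∈ Finset.range (2 * (n + 1) + 1), (-1 : ℂ) ^ m * ((2 * (n + 1)).choose m : ℂ)
      = 0 := by
    have h := Int.alternating_sum_range_choose_of_ne (n := 2 * (n + 1)) (by omega)
    exact_mod_cast h
  have hf : ((2 * (n + 1)).factorial : ℂ) ≠ 0 := by exact_mod_cast Nat.factorial_ne_zero _
  rw [hsplit] at halt
  rw [Finset.Nat.sum_antidiagonal_eq_sum_range_succ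
      (fun i j => ((2 * i).factorial : ℂ)⁻¹ * ((2 * j).factorial : ℂ)⁻¹),
    Finset.Nat.sum_antidiagonal_eq_sum_range_succ
      (fun i j => ((2 * i + 1).factorial : ℂ)⁻¹ * ((2 * j + 1).factorial : ℂ)⁻¹)]
  have h1 : ∀ i ∈ Finset.range (n + 1 + 1), ((2 * i).factorial : ℂ)⁻¹ *
      ((2 * (n + 1 - i)).factorial : ℂ)⁻¹ = ((2 * (n + 1)).factorial : ℂ)⁻¹ *
        ((-1 : ℂ) ^ (2 * i) * ((2 * (n + 1)).choose (2 * i) : ℂ)) := by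
    intro i hi
    rw [Finset.mem_range] at hi
    rw [Nat.cast_choose ℂ (show 2 * i ≤ 2 * (n + 1) by omega),
      show 2 * (n + 1) - 2 * i = 2 * (n + 1 - i) by omega]
    simp only [pow_mul, neg_one_sq, one_pow]
    field_simp
  have h2 : ∀ i ∈ Finset.range (n + 1), ((2 * i + 1).factorial : ℂ)⁻¹ *
      ((2 * (n - i) + 1).factorial : ℂ)⁻¹ = -(((2 * (n + 1)).factorial : ℂ)⁻¹ *
        ((-1 : ℂ) ^ (2 * i + 1) * ((2 * (n + 1)).choose (2 * i + 1) : ℂ))) := by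
    intro i hi
    rw [Finset.mem_range] at hi
    rw [Nat.cast_choose ℂ (show 2 * i + 1 ≤ 2 * (n + 1) by omega),
      show 2 * (n + 1) - (2 * i + 1) = 2 * (n - i) + 1 by omega]
    simp only [pow_succ, pow_mul]
    field_simp
    simp
  rw [Finset.sum_congr rfl h1, Finset.sum_congr rfl h2, Finset.sum_neg_distrib, ← Finset.mul_sum,
    ← Finset.mul_sum, eq_neg_iff_add_eq_zero, ← mul_add, halt, mul_zero]

theorem summable_norm_sh (k : L2) :
    Summable fun n : ℕ => ‖(((2 * n + 1).factorial : ℂ)⁻¹) • shTerm k n‖ := by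
  have h := (Real.summable_pow_div_factorial ‖k‖).comp_injective
    (i := fun n : ℕ => 2 * n + 1) (fun a b h => by simpa using h)
  refine Summable.of_nonneg_of_le (fun _ => norm_nonneg _) (fun n => ?_) h
  rw [norm_smul, norm_inv, Complex.norm_natCast, Function.comp_apply, div_eq_inv_mul]
  gcongr
  exact norm_shTerm_le k n

theorem summable_norm_ch (k : L2) :
    Summable fun n : ℕ => ‖(((2 * n + 2).factorial : ℂ)⁻¹) • chTerm k n‖ := by
  have h := (Real.summable_pow_div_factorial ‖k‖).comp_injective
    (i := fun n : ℕ => 2 * n + 2) (fun a b h => by simpa using h)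
  refine Summable.of_nonneg_of_le (fun _ => norm_nonneg _) (fun n => ?_) h
  rw [norm_smul, norm_inv, Complex.norm_natCast, Function.comp_apply, div_eq_inv_mul]
  gcongr
  exact norm_chTerm_le k n

/-- Transposition as a linear isometry. -/
def transposeₗᵢ : L2 →ₗᵢ[ℂ] L2 :=
  Lp.compMeasurePreservingₗᵢ ℂ Prod.swap (Measure.measurePreserving_swap
    (μ := (volume : Measure E)) (ν := (volume : Measure E)))

theorem transposeₗᵢ_apply (a : L2) : transposeₗᵢ a = transpose a := rfl

theorem transpose_sh {k : L2} (hk : transpose k = k) : transpose (sh k) = sh k := by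
  rw [sh, ← transposeₗᵢ_apply]
  have := transposeₗᵢ.toContinuousLinearMap.map_tsum (summable_sh k)
  refine this.trans (tsum_congr fun n => ?_)
  rw [ContinuousLinearMap.map_smul]
  congr 1
  exact transpose_shTerm hk n

theorem adj_sh {k : L2} (hk : transpose k = k) : adj (sh k) = star (sh k) :=
  adj_eq_star_of_symm (transpose_sh hk)

theorem star_sh (k : L2) :
    star (sh k) = ∑' n : ℕ, (((2 * n + 1).factorial : ℂ)⁻¹) • star (shTerm k n) := by
  have h : ∀ a : L2, star a = adjₗᵢ (transpose a) := fun a => by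
    rw [adjₗᵢ_apply, adj, transpose_transpose]
  rw [h, sh, ← transposeₗᵢ_apply]
  have h1 := transposeₗᵢ.toContinuousLinearMap.map_tsum (summable_sh k)
  have h2 := adjₗᵢ.toContinuousLinearMap.map_tsum
    (transposeₗᵢ.toContinuousLinearMap.summable (summable_sh k))
  refine ((congrArg adjₗᵢ h1).trans h2).trans (tsum_congr fun n => ?_)
  rw [ContinuousLinearMap.map_smul]
  refine (adj_smul _ _).trans ?_
  rw [h]
  congr 1
  simp

theorem adj_chSubOne {k : L2} (hk : transpose k = k) : adj (chSubOne k) = chSubOne k := by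
  have h := adjₗᵢ.toContinuousLinearMap.map_tsum (summable_ch k)
  refine h.trans (tsum_congr fun n => ?_)
  refine (adj_smul _ _).trans ?_
  rw [adj_chTerm hk]
  simp

/-- `ch(k)² = 1 + sh(k) sh(k)*`. -/
theorem two_chSubOne_add {k : L2} (hk : transpose k = k) :
    (2 : ℂ) • chSubOne k + comp (chSubOne k) (chSubOne k) = comp (sh k) (adj (sh k)) := by
  have hsh := tsum_comp_tsum (summable_norm_sh k)
    (R := fun n => star (shTerm k n)) (β := fun n => ((2 * n + 1).factorial : ℂ)⁻¹)
    (by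
      have := summable_norm_sh k
      simp only [norm_smul] at this ⊢
      simpa only [norm_star_L2] using this)
    (comp_shTerm_star_shTerm k)
  have hch := tsum_comp_tsum (summable_norm_ch k) (summable_norm_ch k) 
    (r := fun n => chTerm k (n + 1)) (fun i j => comp_chTerm_chTerm k i j)
  rw [adj_sh hk, star_sh]
  refine HasSum.unique ?_ hsh
  have h2 : HasSum (fun n => (2 * ((2 * n + 2).factorial : ℂ)⁻¹) • chTerm k n)
      ((2 : ℂ) • chSubOne k) := by
    have := (summable_ch k).hasSum.const_smul (2 : ℂ)
    simp only [smul_smul] at this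
    exact this
  -- The series of `p p` starts at `(k k̄)²`, that is, at index `1` of `chTerm`; it is padded with a
  -- zero at index `0`.
  have h3 : HasSum (fun n : ℕ => Nat.casesOn (motive := fun _ => L2) n 0 fun n =>
      (∑ x ∈ Finset.HasAntidiagonal.antidiagonal n, ((2 * x.1 + 2).factorial : ℂ)⁻¹ *
        ((2 * x.2 + 2).factorial : ℂ)⁻¹) • chTerm k (n + 1))
      (comp (chSubOne k) (chSubOne k)) := by
    rw [← hasSum_nat_add_iff' 1]
    rw [Finset.range_one, Finset.sum_singleton]
    change HasSum _ (comp (chSubOne k) (chSubOne k) - (0 : L2)) _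
    rw [sub_zero]
    exact hch
  convert! h2.add h3 using 2 with n
  -- The two end terms of the even sum, where one factorial is `0!`, produce `2p`; the interior
  -- terms produce `p p`.
  rw [← sum_even_eq_sum_odd_inv_factorial]
  cases n with
  | zero =>
    simp [Finset.Nat.antidiagonal_succ, ← two_mul]
  | succ n =>
    rw [Finset.Nat.antidiagonal_succ, Finset.sum_cons, Finset.sum_map,
      Finset.Nat.antidiagonal_succ', Finset.sum_cons, Finset.sum_map, ← add_smul]
    congr 1
    simp [mul_add]
    ring

/-! ### Positivity of `ch(k) - 1` and invertibility of `ch(k)`. -/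

/-- For `n = 2i` the term is `T T*` with `T = (k k̄)ⁱ k`; for `n = 2i + 1` it is the square of the
self-adjoint `(k k̄)ⁱ⁺¹`. -/
theorem re_inner_chTerm_nonneg {k : L2} (hk : transpose k = k) (n : ℕ) (b : L2) :
    0 ≤ (inner ℂ b (comp (chTerm k n) b)).re := by
  obtain ⟨i, rfl | rfl⟩ := n.even_or_odd'
  · rw [two_mul, ← comp_shTerm_star_shTerm, comp_assoc, ← adj_eq_star_of_symm (transpose_shTerm hk i),
      ← adj_adj (shTerm k i), ← inner_comp_left, adj_adj]
    exact inner_self_nonneg (𝕜 := ℂ)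
  · rw [two_mul, ← comp_chTerm_chTerm, comp_assoc]
    nth_rw 1 [← adj_chTerm hk]
    rw [← inner_comp_left]
    exact inner_self_nonneg (𝕜 := ℂ)

theorem re_inner_chSubOne_nonneg {k : L2} (hk : transpose k = k) (b : L2) :
    0 ≤ (inner ℂ b (comp (chSubOne k) b)).re := by
  have h := (Complex.reCLM.restrictScalars ℝ).hasSum
    (((innerSL ℂ b).comp (compL.flip b)).hasSum (summable_ch k).hasSum)
  refine h.nonneg fun n => ?_
  have : (inner ℂ b (comp ((((2 * n + 2).factorial : ℂ)⁻¹) • chTerm k n) b)).re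
      = ((2 * n + 2).factorial : ℝ)⁻¹ * (inner ℂ b (comp (chTerm k n) b)).re := by
    rw [comp_smul_left, inner_smul_right,
      show ((2 * n + 2).factorial : ℂ)⁻¹ = (((2 * n + 2).factorial : ℝ)⁻¹ : ℝ) by push_cast; rfl,
      Complex.re_ofReal_mul]
  refine (mul_nonneg (by positivity) (re_inner_chTerm_nonneg hk n b)).trans_eq this.symm

theorem isSelfAdjoint_compLeft {a : L2} (ha : adj a = a) : IsSelfAdjoint (compLeft a) := by
  rw [ContinuousLinearMap.isSelfAdjoint_iff', adjoint_compLeft, ha]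

/-- Positivity of `p` gives `1 + p ≥ 1` in the C*-algebra of bounded operators. This makes
`Ring.inverse` in `invOneAdd` a genuine inverse. -/
theorem isUnit_one_add_compLeft_chSubOne {k : L2} (hk : transpose k = k) :
    IsUnit (1 + compLeft (chSubOne k)) := by
  refine CStarAlgebra.isUnit_of_le 1 ?_
  rw [ContinuousLinearMap.le_def, add_sub_cancel_left]
  refine ⟨?_, fun b => ?_⟩
  · exact (isSelfAdjoint_compLeft (adj_chSubOne hk)).isSymmetric
  · rw [ContinuousLinearMap.reApplyInnerSelf_apply, ← inner_re_symm]
    exact re_inner_chSubOne_nonneg hk b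

end PairExcitation

end

noncomputable section

namespace PairExcitation

/-! ### Translations of kernels -/

instance : (volume : Measure (E × E)).IsAddHaarMeasure :=
  inferInstanceAs ((volume : Measure E).prod (volume : Measure E)).IsAddHaarMeasure

instance : (volume : Measure (E × E)).IsNegInvariant :=
  Measure.IsAddHaarMeasure.isNegInvariant_of_regular _

/-- Translation of kernels, `(tau z a)(q) = a(q - z)`. -/
def tau (z : E × E) : L2 →ₗᵢ[ℂ] L2 :=
  Lp.compMeasurePreservingₗᵢ ℂ (fun q => q - z)
    (measurePreserving_sub_right (volume : Measure (E × E)) z)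

theorem coeFn_tau (z : E × E) (a : L2) : tau z a =ᵐ[volume] fun q => a (q - z) :=
  Lp.coeFn_compMeasurePreserving _ _

theorem ae_sub {P : E × E → Prop} (h : ∀ᵐ q : E × E, P q) (z : E × E) :
    ∀ᵐ q : E × E, P (q - z) :=
  (measurePreserving_sub_right (volume : Measure (E × E)) z).quasiMeasurePreserving.ae h

theorem continuous_tau (a : L2) : Continuous fun z => tau z a := by
  let g : C((E × E) × (E × E), E × E) := ⟨fun p => p.2 - p.1, by fun_prop⟩
  exact Continuous.compMeasurePreservingLp (continuous_const (y := a)) g.curry.continuous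
    (fun z => measurePreserving_sub_right (volume : Measure (E × E)) z) (by norm_num)

theorem tau_tau (z w : E × E) (a : L2) : tau z (tau w a) = tau (z + w) a := by
  apply Lp.ext
  filter_upwards [coeFn_tau z (tau w a), ae_sub (coeFn_tau w a) z, coeFn_tau (z + w) a]
    with q h1 h2 h3
  rw [h1, h2, h3, sub_sub]

theorem tau_zero (a : L2) : tau 0 a = a := by
  apply Lp.ext
  filter_upwards [coeFn_tau 0 a] with q h1
  rw [h1, sub_zero]

theorem adj_tau (z : E × E) (a : L2) : adj (tau z a) = tau z.swap (adj a) := by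
  apply Lp.ext
  filter_upwards [coeFn_adj (tau z a), ae_swap (coeFn_tau z a), coeFn_tau z.swap (adj a),
    ae_sub (coeFn_adj a) z.swap] with q h1 h2 h3 h4
  rw [h1, h2, h3, h4]
  rfl

theorem inner_tau_left (z : E × E) (a b : L2) : inner ℂ (tau z a) b = inner ℂ a (tau (-z) b) := by
  rw [← (tau (-z)).inner_map_map, tau_tau, neg_add_cancel, tau_zero]

theorem comp_tau_left (z : E) (a b : L2) : comp (tau (z, 0) a) b = tau (z, 0) (comp a b) := by
  apply Lp.ext
  filter_upwards [comp_ae_eq (coeFn_tau (z, 0) a) (Filter.EventuallyEq.refl _ b),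
    coeFn_tau (z, 0) (comp a b), ae_sub (coeFn_comp a b) (z, 0)] with q h1 h2 h3
  rw [h1, h2, h3]
  simp [compFun]

theorem comp_tau_right (z : E) (a b : L2) : comp a (tau (0, z) b) = tau (0, z) (comp a b) := by
  rw [← adj_adj (comp a (tau (0, z) b)), adj_comp, adj_tau, Prod.swap_prod_mk, comp_tau_left,
    ← adj_comp, adj_tau, adj_adj, Prod.swap_prod_mk]

/-- Translation invariance of the integral over the intermediate variable. -/
theorem comp_tau_middle (z : E) (a b : L2) :
    comp (tau (0, z) a) b = comp a (tau (-z, 0) b) := by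
  apply Lp.ext
  filter_upwards [comp_ae_eq (coeFn_tau (0, z) a) (Filter.EventuallyEq.refl _ b),
    comp_ae_eq (Filter.EventuallyEq.refl _ a) (coeFn_tau (-z, 0) b)] with q h1 h2
  rw [h1, h2]
  simp only [compFun, Prod.mk_sub_mk, sub_zero, sub_neg_eq_add]
  rw [← integral_add_right_eq_self _ z]
  simp

/-! ### Averages of translations -/

/-- Smooth, compactly supported, even, real-valued functions on `ℝ³`. -/
structure Moll where
  /-- The underlying function. -/
  toFun : E → ℝ
  contDiff : ContDiff ℝ ∞ toFun
  hasCompactSupport : HasCompactSupport toFun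
  even : ∀ x, toFun (-x) = toFun x

instance : CoeFun Moll (fun _ => E → ℝ) := ⟨Moll.toFun⟩

theorem Moll.continuous (f : Moll) : Continuous f := f.contDiff.continuous

theorem Moll.integrable (f : Moll) : Integrable f :=
  f.continuous.integrable_of_hasCompactSupport f.hasCompactSupport

theorem laplacian_eq_sum (f : E → ℝ) : Laplacian.laplacian f = fun x =>
    ∑ i, iteratedFDeriv ℝ 2 f x ![stdOrthonormalBasis ℝ E i, stdOrthonormalBasis ℝ E i] :=
  InnerProductSpace.laplacian_eq_iteratedFDeriv_stdOrthonormalBasis f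

/-- The Laplacian of a mollifier. -/
def Moll.lap (f : Moll) : Moll where
  toFun := Laplacian.laplacian f.toFun
  contDiff := by
    rw [laplacian_eq_sum]
    refine ContDiff.sum fun i _ => ?_
    have h : ContDiff ℝ ∞ (iteratedFDeriv ℝ 2 f.toFun) :=
      f.contDiff.iteratedFDeriv_right (m := ∞) (by norm_cast)
    exact (ContinuousMultilinearMap.apply ℝ (fun _ : Fin 2 => E) ℝ
      ![stdOrthonormalBasis ℝ E i, stdOrthonormalBasis ℝ E i]).contDiff.comp h
  hasCompactSupport := by
    rw [laplacian_eq_sum]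
    refine (f.hasCompactSupport.iteratedFDeriv (𝕜 := ℝ) 2).mono fun x hx => ?_
    contrapose! hx
    rw [Function.notMem_support] at hx ⊢
    simp [hx]
  even x := by
    rw [laplacian_eq_sum]
    refine Finset.sum_congr rfl fun i _ => ?_
    have h : f.toFun ∘ (-ContinuousLinearMap.id ℝ E) = f.toFun := by
      ext x
      simp [f.even]
    have h2 := (-ContinuousLinearMap.id ℝ E).iteratedFDeriv_comp_right f.contDiff x
      (i := 2) ENat.LEInfty.out
    rw [h] at h2
    rw [h2]
    simp only [ContinuousMultilinearMap.compContinuousLinearMap_apply]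
    have h4 := (iteratedFDeriv ℝ 2 f.toFun (-x)).map_smul_univ (fun _ => (-1 : ℝ))
      ![stdOrthonormalBasis ℝ E i, stdOrthonormalBasis ℝ E i]
    simp only [Finset.prod_const, Finset.card_univ, Fintype.card_fin, even_two, Even.neg_pow,
      one_pow, one_smul, neg_smul] at h4
    exact h4.symm

variable (ι κ : E →L[ℝ] E × E)

theorem integrable_smul_tau (f : Moll) (a : L2) :
    Integrable fun z => ((f z : ℝ) : ℂ) • tau (ι z) a := by
  refine Continuous.integrable_of_hasCompactSupport ?_ ?_
  · exact (Complex.continuous_ofReal.comp f.continuous).smul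
      ((continuous_tau a).comp ι.continuous)
  · refine f.hasCompactSupport.mono fun z hz => ?_
    contrapose! hz
    rw [Function.notMem_support] at hz ⊢
    simp [hz]

theorem norm_integral_smul_tau_le (f : Moll) (a : L2) :
    ‖∫ z, ((f z : ℝ) : ℂ) • tau (ι z) a‖ ≤ (∫ z, |f z|) * ‖a‖ := by
  refine (norm_integral_le_integral_norm _).trans_eq ?_
  rw [← integral_mul_const]
  refine integral_congr_ae (Filter.Eventually.of_forall fun z => ?_)
  simp only [norm_smul, Complex.norm_real, Real.norm_eq_abs, LinearIsometry.norm_map]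

/-- The average `∫ f(z) τ_{ι z} a dz` of translates. -/
def avg (f : Moll) : L2 →L[ℂ] L2 :=
  LinearMap.mkContinuous
    { toFun := fun a => ∫ z, ((f z : ℝ) : ℂ) • tau (ι z) a
      map_add' := fun a b => by
        rw [← integral_add (integrable_smul_tau ι f a) (integrable_smul_tau ι f b)]
        simp
      map_smul' := fun r a => by
        rw [RingHom.id_apply, ← integral_smul]
        simp only [map_smul, smul_comm r] }
    (∫ z, |f z|) (norm_integral_smul_tau_le ι f)

theorem avg_apply (f : Moll) (a : L2) : avg ι f a = ∫ z, ((f z : ℝ) : ℂ) • tau (ι z) a := rfl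

theorem norm_avg_le (f : Moll) (a : L2) : ‖avg ι f a‖ ≤ (∫ z, |f z|) * ‖a‖ :=
  norm_integral_smul_tau_le ι f a

theorem map_avg (f : Moll) (a : L2) (A : L2 →L[ℂ] L2) :
    A (avg ι f a) = ∫ z, ((f z : ℝ) : ℂ) • A (tau (ι z) a) := by
  rw [avg_apply, ← A.integral_comp_comm (integrable_smul_tau ι f a)]
  simp only [map_smul]

theorem avg_avg (f g : Moll) (a : L2) : avg ι f (avg κ g a)
    = ∫ z : E × E, ((f z.1 * g z.2 : ℝ) : ℂ) • tau (ι z.1 + κ z.2) a := by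
  have hint : Integrable (fun z : E × E => ((f z.1 * g z.2 : ℝ) : ℂ) • tau (ι z.1 + κ z.2) a)
      ((volume : Measure E).prod volume) := by
    refine Integrable.mono' (f.integrable.norm.mul_prod (g.integrable.norm.mul_const ‖a‖)) ?_ ?_
    · refine Continuous.aestronglyMeasurable (Continuous.fun_smul ?_ ?_)
      · have := f.continuous
        have := g.continuous
        fun_prop
      · exact (continuous_tau a).comp (by fun_prop)
    · refine Filter.Eventually.of_forall fun z => ?_
      simp only [norm_smul, Complex.norm_real, LinearIsometry.norm_map, norm_mul, mul_assoc]
      exact le_rfl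
  refine Eq.trans ?_ (integral_prod _ hint).symm
  rw [avg_apply]
  refine integral_congr_ae (Filter.Eventually.of_forall fun z => ?_)
  simp only
  have h := map_avg κ g a (tau (ι z)).toContinuousLinearMap
  simp only [LinearIsometry.coe_toContinuousLinearMap, tau_tau] at h
  rw [h, ← integral_smul]
  simp only [smul_smul, Complex.ofReal_mul]

theorem avg_comm (f g : Moll) (a : L2) : avg ι f (avg κ g a) = avg κ g (avg ι f a) := by
  rw [avg_avg, avg_avg]
  refine Eq.trans ?_ (integral_prod_swap (μ := (volume : Measure E)) (ν := (volume : Measure E))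
    (fun z : E × E => ((g z.1 * f z.2 : ℝ) : ℂ) • tau (κ z.1 + ι z.2) a))
  simp only [Prod.fst_swap, Prod.snd_swap, mul_comm, add_comm]
  rfl

/-- The adjoint of a translation is the opposite translation, and `f` is real and even. -/
theorem inner_avg_left (f : Moll) (a b : L2) :
    inner ℂ (avg ι f a) b = inner ℂ a (avg ι f b) := by
  have h1 : inner ℂ a (avg ι f b) = ∫ z, ((f z : ℝ) : ℂ) * inner ℂ a (tau (ι z) b) := by
    have := (innerSL ℂ a).integral_comp_comm (integrable_smul_tau ι f b)
    simp only [innerSL_apply_apply, inner_smul_right] at this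
    exact this.symm
  have h2 : inner ℂ b (avg ι f a) = ∫ z, ((f z : ℝ) : ℂ) * inner ℂ b (tau (ι z) a) := by
    have := (innerSL ℂ b).integral_comp_comm (integrable_smul_tau ι f a)
    simp only [innerSL_apply_apply, inner_smul_right] at this
    exact this.symm
  rw [← inner_conj_symm, h2, h1, ← integral_conj, ← integral_neg_eq_self]
  refine integral_congr_ae (Filter.Eventually.of_forall fun z => ?_)
  simp only [map_mul, Complex.conj_ofReal, inner_conj_symm, f.even, map_neg]
  rw [inner_tau_left, neg_neg]

/-- Mollification in the first variable. -/
def avgL (f : Moll) : L2 →L[ℂ] L2 := avg (ContinuousLinearMap.inl ℝ E E) f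

/-- Mollification in the second variable. -/
def avgR (f : Moll) : L2 →L[ℂ] L2 := avg (ContinuousLinearMap.inr ℝ E E) f

theorem comp_avgL_left (f : Moll) (a b : L2) : comp (avgL f a) b = avgL f (comp a b) := by
  have h := map_avg (ContinuousLinearMap.inl ℝ E E) f a (compL.flip b)
  refine h.trans ?_
  simp only [ContinuousLinearMap.flip_apply, compL_apply, ContinuousLinearMap.inl_apply,
    comp_tau_left]
  rfl

theorem comp_avgR_right (f : Moll) (a b : L2) : comp a (avgR f b) = avgR f (comp a b) := by
  have h := map_avg (ContinuousLinearMap.inr ℝ E E) f b (compLeft a)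
  refine h.trans ?_
  simp only [compLeft_apply, ContinuousLinearMap.inr_apply, comp_tau_right]
  rfl

/-- Smoothing in the integrated variable passes from one factor to the other. This is what later
lets derivatives in that variable cancel. -/
theorem comp_avgR_left (f : Moll) (a b : L2) : comp (avgR f a) b = comp a (avgL f b) := by
  have h := map_avg (ContinuousLinearMap.inr ℝ E E) f a (compL.flip b)
  have h' := map_avg (ContinuousLinearMap.inl ℝ E E) f b (compLeft a)
  refine h.trans (Eq.trans ?_ h'.symm)
  -- The shift changes sign when it changes factor; evenness of `f` absorbs this.
  rw [← integral_neg_eq_self]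
  simp only [ContinuousLinearMap.flip_apply, compL_apply, compLeft_apply,
    ContinuousLinearMap.inl_apply, ContinuousLinearMap.inr_apply, comp_tau_middle, neg_neg, f.even]

theorem adj_avgL (f : Moll) (a : L2) : adj (avgL f a) = avgR f (adj a) := by
  have h := adjₗᵢ.toContinuousLinearMap.integral_comp_comm
    (integrable_smul_tau (ContinuousLinearMap.inl ℝ E E) f a)
  refine h.symm.trans ?_
  refine integral_congr_ae (Filter.Eventually.of_forall fun z => ?_)
  refine (adj_smul _ _).trans ?_
  rw [adj_tau]
  simp

theorem adj_avgR (f : Moll) (a : L2) : adj (avgR f a) = avgL f (adj a) := by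
  rw [← adj_adj (avgL f (adj a)), adj_avgL, adj_adj]

/-- A sequence of mollifiers converging to the Dirac mass. -/
def bump (n : ℕ) : ContDiffBump (0 : E) where
  rIn := 1 / (2 * (n + 1))
  rOut := 1 / (n + 1)
  rIn_pos := by positivity
  rIn_lt_rOut := by
    rw [one_div_lt_one_div (by positivity) (by positivity)]
    have : (0 : ℝ) < n + 1 := by positivity
    linarith

/-- A sequence of mollifiers converging to the Dirac mass. -/
def moll (n : ℕ) : Moll where
  toFun := (bump n).normed volume
  contDiff := (bump n).contDiff_normed
  hasCompactSupport := (bump n).hasCompactSupport_normed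
  even := (bump n).normed_neg

theorem norm_avg_moll_le (n : ℕ) (a : L2) : ‖avg ι (moll n) a‖ ≤ ‖a‖ := by
  refine (norm_avg_le ι (moll n) a).trans_eq ?_
  have : ∫ z, |moll n z| = 1 := by
    rw [← (bump n).integral_normed (μ := (volume : Measure E))]
    refine integral_congr_ae (Filter.Eventually.of_forall fun z => ?_)
    exact abs_of_nonneg ((bump n).nonneg_normed z)
  rw [this, one_mul]

open Filter Topology in
theorem tendsto_avg_moll (a : L2) : Tendsto (fun n => avg ι (moll n) a) atTop (𝓝 a) := by
  have hφ : Tendsto (fun n => (bump n).rOut) atTop (𝓝 0) :=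
    tendsto_one_div_add_atTop_nhds_zero_nat
  have hg : Continuous fun z : E => tau (ι (-z)) a := (continuous_tau a).comp (by fun_prop)
  have h := ContDiffBump.convolution_tendsto_right_of_continuous (μ := (volume : Measure E)) hφ hg 0
  simp only [neg_zero, map_zero, tau_zero] at h
  refine h.congr fun n => ?_
  rw [convolution, avg_apply]
  refine integral_congr_ae (Filter.Eventually.of_forall fun z => ?_)
  simp only [zero_sub, neg_neg, ContinuousLinearMap.lsmul_apply]
  rw [real_smul_L2]; rfl

/-- The value at `q` of the mollified kernel is the pairing of `a` with the test function centred at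
`q`. It is read against an arbitrary `χ`, which avoids choosing pointwise representatives of an
`L2`-valued integral. -/
theorem inner_avgL_avgR (f g : Moll) (a χ : L2) :
    Integrable (fun q : E × E =>
      (∫ z : E × E, a z * ((f (z.1 - q.1) * g (z.2 - q.2) : ℝ) : ℂ)) * star (χ q)) ∧
    inner ℂ χ (avgL f (avgR g a))
      = ∫ q : E × E, (∫ z : E × E, a z * ((f (z.1 - q.1) * g (z.2 - q.2) : ℝ) : ℂ)) * star (χ q) := by
  have ha := (Lp.stronglyMeasurable a).measurable
  have hχ := (Lp.stronglyMeasurable χ).measurable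
  have hf := f.continuous.measurable
  have hg := g.continuous.measurable
  have hFint : Integrable (fun z : E × E => f z.1 * g z.2) := f.integrable.mul_prod g.integrable
  have hτ : Integrable (fun z : E × E => ((f z.1 * g z.2 : ℝ) : ℂ) • tau z a) := by
    refine Integrable.mono' (hFint.norm.mul_const ‖a‖) ?_ ?_
    · refine Continuous.aestronglyMeasurable (Continuous.fun_smul ?_ (continuous_tau a))
      have := f.continuous
      have := g.continuous
      fun_prop
    · refine Filter.Eventually.of_forall fun z => ?_
      simp only [norm_smul, Complex.norm_real, LinearIsometry.norm_map]
      exact le_rfl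
  have h1 : inner ℂ χ (avgL f (avgR g a))
      = ∫ z : E × E, ((f z.1 * g z.2 : ℝ) : ℂ) * inner ℂ χ (tau z a) := by
    rw [avgL, avgR, avg_avg]
    have := (innerSL ℂ χ).integral_comp_comm hτ
    simp only [innerSL_apply_apply, inner_smul_right] at this
    rw [this]
    simp only [ContinuousLinearMap.inl_apply, ContinuousLinearMap.inr_apply, Prod.mk_add_mk,
      add_zero, zero_add]
  have h2 : ∀ z : E × E, inner ℂ χ (tau z a) = ∫ q, a (q - z) * star (χ q) := fun z => by
    rw [inner_L2]
    refine integral_congr_ae ?_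
    filter_upwards [coeFn_tau z a] with q hq
    rw [hq]
  have hint : Integrable (fun s : (E × E) × (E × E) =>
      ((f s.1.1 * g s.1.2 : ℝ) : ℂ) * (a (s.2 - s.1) * star (χ s.2))) (volume.prod volume) := by
    rw [integrable_prod_iff (Measurable.aestronglyMeasurable (by fun_prop))]
    constructor
    · refine Filter.Eventually.of_forall fun z => ?_
      have : Integrable fun q => a (q - z) * star (χ q) := by
        refine (integrable_mul_star χ (tau z a)).congr ?_
        filter_upwards [coeFn_tau z a] with q hq
        rw [hq]
      exact this.const_mul ((f z.1 * g z.2 : ℝ) : ℂ)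
    · refine Integrable.mono' (hFint.norm.mul_const (‖a‖ * ‖χ‖)) ?_ ?_
      · refine StronglyMeasurable.aestronglyMeasurable ?_
        refine StronglyMeasurable.integral_prod_right' (f := fun s : (E × E) × (E × E) =>
          ‖((f s.1.1 * g s.1.2 : ℝ) : ℂ) * (a (s.2 - s.1) * star (χ s.2))‖) ?_
        exact Measurable.stronglyMeasurable (by fun_prop)
      · refine Filter.Eventually.of_forall fun z => ?_
        rw [Real.norm_of_nonneg (integral_nonneg fun _ => norm_nonneg _)]
        simp only [norm_mul, norm_star, Complex.norm_real, integral_const_mul]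
        gcongr
        -- Passing to absolute values makes this an inner product, to which Cauchy-Schwarz applies
        -- uniformly in `z`.
        have h3 : ∫ q, ‖a (q - z)‖ * ‖χ q‖ = (inner ℂ (absKer χ) (absKer (tau z a))).re := by
          rw [inner_L2, ← Complex.reCLM_apply, ← Complex.reCLM.integral_comp_comm
            (integrable_mul_star _ _)]
          refine integral_congr_ae ?_
          filter_upwards [coeFn_tau z a, coeFn_absKer χ, coeFn_absKer (tau z a)] with q h1 h2 h3
          rw [h2, h3, h1]
          simp
        rw [h3]
        refine (Complex.re_le_norm _).trans ((norm_inner_le_norm _ _).trans_eq ?_)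
        have h4 : ∀ b : L2, ‖absKer b‖ = ‖b‖ := fun b => by
          rw [absKer, Lp.norm_toLp, Lp.norm_def]
          congr 1
          refine eLpNorm_congr_norm_ae (Filter.Eventually.of_forall fun q => ?_)
          simp
        rw [h4, h4, LinearIsometry.norm_map, mul_comm]
  have h5 : ∀ q : E × E, ∫ z : E × E, ((f z.1 * g z.2 : ℝ) : ℂ) * (a (q - z) * star (χ q))
      = (∫ z : E × E, a z * ((f (z.1 - q.1) * g (z.2 - q.2) : ℝ) : ℂ)) * star (χ q) := fun q => by
    rw [← integral_mul_const, ← integral_sub_left_eq_self _ _ q]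
    refine integral_congr_ae (Filter.Eventually.of_forall fun z => ?_)
    simp only [sub_sub_cancel, Prod.fst_sub, Prod.snd_sub]
    rw [← f.even, ← g.even, neg_sub, neg_sub]
    ring
  refine ⟨hint.integral_prod_right.congr (Filter.Eventually.of_forall h5), ?_⟩
  rw [h1]
  simp_rw [h2, ← integral_const_mul]
  rw [integral_integral_swap hint]
  exact integral_congr_ae (Filter.Eventually.of_forall h5)

end PairExcitation

end

noncomputable section

namespace PairExcitation

/-! ### Mollification of weak equations -/

/-- The test function `f(x - x₀) g(y - y₀)`. -/
def tensorTest (f g : Moll) (q : E × E) : E × E → ℂ :=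
  fun z => ((f (z.1 - q.1) * g (z.2 - q.2) : ℝ) : ℂ)

theorem isTest_tensorTest (f g : Moll) (q : E × E) : IsTest (tensorTest f g q) := by
  constructor
  · have hf := f.contDiff
    have hg := g.contDiff
    refine Complex.ofRealCLM.contDiff.comp (ContDiff.mul ?_ ?_)
    · exact hf.comp (by fun_prop)
    · exact hg.comp (by fun_prop)
  · have hf : HasCompactSupport fun x => f (x - q.1) :=
      f.hasCompactSupport.comp_homeomorph (Homeomorph.subRight q.1)
    have hg : HasCompactSupport fun x => g (x - q.2) :=
      g.hasCompactSupport.comp_homeomorph (Homeomorph.subRight q.2)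
    refine HasCompactSupport.intro (hf.isCompact.prod hg.isCompact) fun z hz => ?_
    rw [Set.mem_prod, not_and_or] at hz
    rcases hz with hz | hz
    · have := image_eq_zero_of_notMem_tsupport hz
      simp [tensorTest, this]
    · have := image_eq_zero_of_notMem_tsupport hz
      simp [tensorTest, this]

theorem laplacian_translate_smul (f : Moll) (c : ℝ) (x₀ x : E) :
    Laplacian.laplacian (fun x : E => ((c * f (x - x₀) : ℝ) : ℂ)) x
      = ((c * f.lap (x - x₀) : ℝ) : ℂ) := by
  let l : ℝ →L[ℝ] ℂ := c • Complex.ofRealCLM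
  have h1 : (fun x : E => ((c * f (x - x₀) : ℝ) : ℂ)) = l ∘ fun x => f (x - x₀) := by
    ext x
    simp [l]
  have h2 : ContDiff ℝ 2 fun x => f (x - x₀) :=
    (f.contDiff.of_le ENat.LEInfty.out).comp (by fun_prop)
  have h3 : Laplacian.laplacian (fun x => f (x - x₀)) x = f.lap (x - x₀) := by
    rw [Moll.lap]
    simp only [laplacian_eq_sum]
    refine Finset.sum_congr rfl fun i _ => ?_
    rw [iteratedFDeriv_comp_sub]
  have h4 := h2.contDiffAt.laplacian_CLM_comp_left (l := l) (x := x)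
  rw [h1]
  refine h4.trans ?_
  rw [Function.comp_apply, h3]
  simp [l]

theorem lapX_tensorTest (f g : Moll) (q : E × E) :
    lapX (tensorTest f g q) = tensorTest f.lap g q := by
  ext z
  have := laplacian_translate_smul f (g (z.2 - q.2)) q.1 z.1
  simp only [lapX, tensorTest]
  rw [mul_comm (f.lap _), ← this]
  simp only [mul_comm]

theorem lapY_tensorTest (f g : Moll) (q : E × E) :
    lapY (tensorTest f g q) = tensorTest f g.lap q := by
  ext z
  exact laplacian_translate_smul g (f (z.1 - q.1)) q.2 z.2

theorem IsTest.memLp {ψ : E × E → ℂ} (h : IsTest ψ) : MemLp ψ 2 volume :=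
  h.1.continuous.memLp_of_hasCompactSupport h.2

theorem integrable_mul_of_memLp (a : L2) {ψ : E × E → ℂ} (h : MemLp ψ 2 volume) :
    Integrable fun q => a q * ψ q :=
  (Lp.memLp a).integrable_mul h

/-- Mollification in both variables. -/
def mollify (f g : Moll) : L2 →L[ℂ] L2 := (avgL f).comp (avgR g)

theorem mollify_apply (f g : Moll) (a : L2) : mollify f g a = avgL f (avgR g a) := rfl

theorem inner_mollify (f g : Moll) (a χ : L2) :
    Integrable (fun q : E × E => pair a (tensorTest f g q) * star (χ q)) ∧
    inner ℂ χ (mollify f g a) = ∫ q : E × E, pair a (tensorTest f g q) * star (χ q) :=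
  inner_avgL_avgR f g a χ

/-- Testing an equation with all translates of `f ⊗ g` is the same as mollifying it: the Laplacians
fall on `f` and `g`, and an identity in `L2` results. -/
theorem mollify_eq_of_weak {D U : L2} {α β : ℂ}
    {f g : Moll} (h : ∀ q, pair D (tensorTest f g q)
      = α * pair U (tensorTest f.lap g q) + β * pair U (tensorTest f g.lap q)) :
    mollify f g D = (α • mollify f.lap g + β • mollify f g.lap) U := by
  refine ext_inner_left ℂ fun χ => ?_
  obtain ⟨hi1, h1⟩ := inner_mollify f.lap g U χ
  obtain ⟨hi2, h2⟩ := inner_mollify f g.lap U χ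
  rw [(inner_mollify f g D χ).2, add_apply, smul_apply,
    smul_apply, inner_add_right, inner_smul_right, inner_smul_right, h1, h2,
    ← integral_const_mul, ← integral_const_mul, ← integral_add (hi1.const_mul _) (hi2.const_mul _)]
  refine integral_congr_ae (Filter.Eventually.of_forall fun q => ?_)
  simp only
  rw [h q, ← mul_assoc, ← mul_assoc, ← add_mul]

theorem avgL_comm (f g : Moll) (a : L2) : avgL f (avgL g a) = avgL g (avgL f a) := avg_comm _ _ _ _ _

theorem avgR_comm (f g : Moll) (a : L2) : avgR f (avgR g a) = avgR g (avgR f a) := avg_comm _ _ _ _ _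

theorem avgL_avgR_comm (f g : Moll) (a : L2) : avgL f (avgR g a) = avgR g (avgL f a) :=
  avg_comm _ _ _ _ _

theorem mollify_comm (f g f' g' : Moll) (a : L2) :
    mollify f g (mollify f' g' a) = mollify f' g' (mollify f g a) := by
  simp only [mollify_apply]
  rw [← avgL_avgR_comm, avgR_comm g g', avgL_comm f f', avgL_avgR_comm f g']

theorem inner_mollify_left (f g : Moll) (a b : L2) :
    inner ℂ (mollify f g a) b = inner ℂ a (mollify f g b) := by
  rw [mollify_apply, mollify_apply, avgL_avgR_comm]
  exact (inner_avg_left _ _ _ _).trans (inner_avg_left _ _ _ _)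

theorem adj_mollify (f g : Moll) (a : L2) : adj (mollify f g a) = mollify g f (adj a) := by
  rw [mollify_apply, mollify_apply, adj_avgL, adj_avgR, avgL_avgR_comm]

/-- The outer mollifiers `f`, `g` come out of the composition; the two inner ones `ρ`, `ρ'` collect
on one factor. -/
theorem comp_mollify (f g ρ ρ' : Moll) (a b : L2) :
    comp (mollify f ρ a) (mollify ρ' g b) = mollify f g (comp a (avgL ρ (avgL ρ' b))) := by
  rw [mollify_apply, mollify_apply, mollify_apply, comp_avgL_left, comp_avgR_left,
    avgL_avgR_comm ρ' g, avgL_avgR_comm ρ g, comp_avgR_right]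

open Filter Topology in
theorem tendsto_mollify (a : L2) :
    Tendsto (fun n => mollify (moll n) (moll n) a) atTop (𝓝 a) := by
  have h1 := tendsto_avg_moll (ContinuousLinearMap.inl ℝ E E) a
  have h2 := tendsto_avg_moll (ContinuousLinearMap.inr ℝ E E) a
  rw [tendsto_iff_norm_sub_tendsto_zero] at h1 h2 ⊢
  refine squeeze_zero (fun _ => norm_nonneg _) (fun n => ?_) (by simpa using h2.add h1)
  have : mollify (moll n) (moll n) a - a
      = avgL (moll n) (avgR (moll n) a - a) + (avgL (moll n) a - a) := by
    rw [map_sub, mollify_apply]; abel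
  rw [this]
  exact (norm_add_le _ _).trans (add_le_add_left (norm_avg_moll_le _ n _) _)

theorem norm_mollify_le (n : ℕ) (a : L2) : ‖mollify (moll n) (moll n) a‖ ≤ ‖a‖ :=
  (norm_avg_moll_le _ n _).trans (norm_avg_moll_le _ n _)

open Filter Topology in
theorem tendsto_avgL_avgL (a : L2) :
    Tendsto (fun n => avgL (moll n) (avgL (moll n) a)) atTop (𝓝 a) := by
  have h1 := tendsto_avg_moll (ContinuousLinearMap.inl ℝ E E) a
  rw [tendsto_iff_norm_sub_tendsto_zero] at h1 ⊢
  refine squeeze_zero (fun _ => norm_nonneg _) (fun n => ?_) (by simpa using h1.add h1)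
  have : avgL (moll n) (avgL (moll n) a) - a
      = avgL (moll n) (avgL (moll n) a - a) + (avgL (moll n) a - a) := by
    rw [map_sub]; abel
  rw [this]
  exact (norm_add_le _ _).trans (add_le_add_left (norm_avg_moll_le _ n _) _)

theorem norm_avgL_avgL_le (n : ℕ) (a : L2) : ‖avgL (moll n) (avgL (moll n) a)‖ ≤ ‖a‖ :=
  (norm_avg_moll_le _ n _).trans (norm_avg_moll_le _ n _)

/-! ### Product rule for indefinite integrals -/

/-- The derivatives are only integrable, so the rule comes from Fubini: the double integral of `L
(x' s) (y' r)` over the square is split along the diagonal. -/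
theorem bilinear_integral_product_rule {X Y Z : Type*} [NormedAddCommGroup X] [NormedSpace ℝ X]
    [NormedAddCommGroup Y] [NormedSpace ℝ Y] [NormedAddCommGroup Z] [NormedSpace ℝ Z]
    [CompleteSpace X] [CompleteSpace Y] [CompleteSpace Z]
    (L : X →L[ℝ] Y →L[ℝ] Z) {x x' : ℝ → X} {y y' : ℝ → Y} {t : ℝ} (ht : 0 ≤ t)
    (hx' : IntegrableOn x' (Icc 0 t)) (hy' : IntegrableOn y' (Icc 0 t))
    (hx : ∀ s ∈ Icc 0 t, x s = x 0 + ∫ r in (0 : ℝ)..s, x' r)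
    (hy : ∀ s ∈ Icc 0 t, y s = y 0 + ∫ r in (0 : ℝ)..s, y' r) :
    L (x t) (y t) - L (x 0) (y 0) = ∫ s in (0 : ℝ)..t, (L (x' s) (y s) + L (x s) (y' s)) := by
  set μ : Measure ℝ := volume.restrict (Ioc 0 t) with hμ
  have hxμ : Integrable x' μ := hx'.mono_set Ioc_subset_Icc_self
  have hyμ : Integrable y' μ := hy'.mono_set Ioc_subset_Icc_self
  have hK : Integrable (fun q : ℝ × ℝ => L (x' q.1) (y' q.2)) (μ.prod μ) := by
    refine Integrable.mono' ((hxμ.norm.const_mul ‖L‖).mul_prod hyμ.norm) ?_ ?_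
    · exact L.aestronglyMeasurable_comp₂ hxμ.1.comp_fst hyμ.1.comp_snd
    · exact Filter.Eventually.of_forall fun q => L.le_opNorm₂ _ _
  have hms : MeasurableSet {q : ℝ × ℝ | q.2 ≤ q.1} := measurableSet_le measurable_snd measurable_fst
  have hK1 := hK.indicator hms
  have hK2 := hK.indicator hms.compl
  have hY : ∀ s ∈ Ioc 0 t, L (x' s) (y s)
      = L (x' s) (y 0) + ∫ r, {q : ℝ × ℝ | q.2 ≤ q.1}.indicator
          (fun q => L (x' q.1) (y' q.2)) (s, r) ∂μ := by
    intro s hs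
    rw [hy s (Ioc_subset_Icc_self hs), map_add]
    congr 1
    rw [intervalIntegral.integral_of_le hs.1.le, ← (L (x' s)).integral_comp_comm
      (hy'.mono_set (fun r hr => ⟨hr.1.le, hr.2.trans hs.2⟩))]
    have : ∀ r, {q : ℝ × ℝ | q.2 ≤ q.1}.indicator (fun q => L (x' q.1) (y' q.2)) (s, r)
        = (Iic s).indicator (fun r => L (x' s) (y' r)) r := fun r => by
      simp [indicator]
    simp_rw [this]
    rw [integral_indicator measurableSet_Iic, hμ, Measure.restrict_restrict measurableSet_Iic]
    congr 2
    ext r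
    simp only [mem_inter_iff, mem_Iic, mem_Ioc]
    exact ⟨fun h => ⟨h.2, h.1, h.2.trans hs.2⟩, fun h => ⟨h.2.1, h.1⟩⟩
  have hX : ∀ r ∈ Ioc 0 t, L (x r) (y' r)
      = L (x 0) (y' r) + ∫ s, {q : ℝ × ℝ | q.2 ≤ q.1}ᶜ.indicator
          (fun q => L (x' q.1) (y' q.2)) (s, r) ∂μ := by
    intro r hr
    rw [hx r (Ioc_subset_Icc_self hr), map_add, add_apply]
    congr 1
    -- The diagonal belongs to the other half of the square, so the inequality is strict here; the
    -- endpoint is negligible.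
    have h1 : L (∫ s in (0 : ℝ)..r, x' s) (y' r) = ∫ s in Ioo 0 r, L (x' s) (y' r) := by
      rw [intervalIntegral.integral_of_le hr.1.le, integral_Ioc_eq_integral_Ioo]
      exact ((L.flip (y' r)).integral_comp_comm
        (hx'.mono_set (fun s hs => ⟨hs.1.le, hs.2.le.trans hr.2⟩))).symm
    rw [h1]
    have : ∀ s, {q : ℝ × ℝ | q.2 ≤ q.1}ᶜ.indicator (fun q => L (x' q.1) (y' q.2)) (s, r)
        = (Iio r).indicator (fun s => L (x' s) (y' r)) s := fun s => by
      simp [indicator]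
    simp_rw [this]
    rw [integral_indicator measurableSet_Iio, hμ, Measure.restrict_restrict measurableSet_Iio]
    congr 2
    ext s
    simp only [mem_inter_iff, mem_Iio, mem_Ioc, mem_Ioo]
    exact ⟨fun h => ⟨h.2, h.1, h.2.le.trans hr.2⟩, fun h => ⟨h.2.1, h.1⟩⟩
  have hi1 : Integrable (fun s => L (x' s) (y 0)) μ := (L.flip (y 0)).integrable_comp hxμ
  have hi2 : Integrable (fun r => L (x 0) (y' r)) μ := (L (x 0)).integrable_comp hyμ
  have hxt := hx t ⟨ht, le_rfl⟩
  have hyt := hy t ⟨ht, le_rfl⟩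
  rw [intervalIntegral.integral_of_le ht] at hxt hyt ⊢
  rw [setIntegral_congr_fun measurableSet_Ioc
    (fun s hs => congrArg₂ (· + ·) (hY s hs) (hX s hs))]
  refine Eq.trans ?_
    (integral_add (hi1.add hK1.integral_prod_left) (hi2.add hK2.integral_prod_right)).symm
  rw [integral_add' hi1 hK1.integral_prod_left, integral_add' hi2 hK2.integral_prod_right,
    ← integral_prod _ hK1, ← integral_prod_symm _ hK2]
  have hsum : ∫ q, {q : ℝ × ℝ | q.2 ≤ q.1}.indicator (fun q => L (x' q.1) (y' q.2)) q ∂(μ.prod μ)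
      + ∫ q, {q : ℝ × ℝ | q.2 ≤ q.1}ᶜ.indicator (fun q => L (x' q.1) (y' q.2)) q ∂(μ.prod μ)
      = L (∫ s, x' s ∂μ) (∫ s, y' s ∂μ) := by
    rw [← integral_add hK1 hK2]
    simp only [indicator_self_add_compl_apply]
    rw [integral_prod _ hK]
    have h1 : ∀ s, ∫ r, L (x' s) (y' r) ∂μ = L (x' s) (∫ r, y' r ∂μ) := fun s =>
      (L (x' s)).integral_comp_comm hyμ
    simp_rw [h1]
    exact (L.flip _).integral_comp_comm hxμ
  have h1 : ∫ s, L (x' s) (y 0) ∂μ = L (∫ s, x' s ∂μ) (y 0) := (L.flip _).integral_comp_comm hxμ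
  have h2 : ∫ s, L (x 0) (y' s) ∂μ = L (x 0) (∫ s, y' s ∂μ) := (L _).integral_comp_comm hyμ
  rw [add_add_add_comm, hsum, h1, h2, hxt, hyt]
  simp only [map_add, add_apply]
  abel

end PairExcitation

end

noncomputable section

namespace PairExcitation

set_option maxHeartbeats 2000000

/-! ### Mollified Schrödinger equations for kernels -/

/-- The operator `α Δ_x + β Δ_y` after mollification. -/
def mollLap (α β : ℝ) (f g : Moll) : L2 →L[ℂ] L2 :=
  (α : ℂ) • mollify f.lap g + (β : ℂ) • mollify f g.lap

theorem mollLap_apply (α β : ℝ) (f g : Moll) (a : L2) :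
    mollLap α β f g a = (α : ℂ) • mollify f.lap g a + (β : ℂ) • mollify f g.lap a := rfl

attribute [local irreducible] mollLap mollify avgL avgR comp adj

theorem mollLap_neg (α β : ℝ) (f g : Moll) (a : L2) :
    mollLap (-α) (-β) f g a = -mollLap α β f g a := by
  rw [mollLap_apply, mollLap_apply, Complex.ofReal_neg, Complex.ofReal_neg, neg_smul, neg_smul,
    neg_add]

theorem adj_mollLap (α β : ℝ) (f g : Moll) (a : L2) :
    adj (mollLap α β f g a) = mollLap β α g f (adj a) := by
  rw [mollLap_apply, adj_add, adj_smul, adj_smul, adj_mollify, adj_mollify, Complex.star_def,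
    Complex.conj_ofReal, Complex.conj_ofReal, mollLap_apply, add_comm]

theorem comp_mollLap_mollify (α β : ℝ) (f g ρ ρ' : Moll) (a b : L2) :
    comp (mollLap α β f ρ a) (mollify ρ' g b)
      = (α : ℂ) • mollify f.lap g (comp a (avgL ρ (avgL ρ' b)))
        + (β : ℂ) • mollify f g (comp a (avgL ρ.lap (avgL ρ' b))) := by
  rw [mollLap_apply, comp_add_left, comp_smul_left, comp_smul_left,
    comp_mollify f.lap g ρ ρ' a b, comp_mollify f g ρ.lap ρ' a b]

theorem comp_mollify_mollLap (α β : ℝ) (f g ρ ρ' : Moll) (a b : L2) :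
    comp (mollify f ρ a) (mollLap α β ρ' g b)
      = (α : ℂ) • mollify f g (comp a (avgL ρ (avgL ρ'.lap b)))
        + (β : ℂ) • mollify f g.lap (comp a (avgL ρ (avgL ρ' b))) := by
  rw [mollLap_apply, comp_add_right, comp_smul_right, comp_smul_right,
    comp_mollify f g ρ ρ'.lap a b, comp_mollify f g.lap ρ ρ' a b]

/-- The first factor carries `β Δ` and the second `-β Δ` in the integrated variable. With the same
`ρ` in both, these are opposite multiples of one term, and only the outer Laplacians survive. -/
theorem comp_deriv_mollify (α β γ : ℝ) (f g ρ : Moll) (a b A B : L2) :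
    comp (-Complex.I • (mollLap α β f ρ a + mollify f ρ A)) (mollify ρ g b)
      + comp (mollify f ρ a) (-Complex.I • (mollLap (-β) γ ρ g b + mollify ρ g B))
    = -Complex.I • (mollLap α γ f g (comp a (avgL ρ (avgL ρ b)))
      + mollify f g (comp A (avgL ρ (avgL ρ b)) + comp a (avgL ρ (avgL ρ B)))) := by
  refine (congrArg₂ (· + ·)
    ((comp_smul_left _ _ _).trans (congrArg (-Complex.I • ·) ((comp_add_left _ _ _).trans
      (congrArg₂ (· + ·) (comp_mollLap_mollify α β f g ρ ρ a b) (comp_mollify f g ρ ρ A b)))))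
    ((comp_smul_right _ _ _).trans (congrArg (-Complex.I • ·) ((comp_add_right _ _ _).trans
      (congrArg₂ (· + ·) (comp_mollify_mollLap (-β) γ f g ρ ρ a b)
        (comp_mollify f g ρ ρ a B)))))).trans ((smul_add _ _ _).symm.trans
    (congrArg (-Complex.I • ·) ?_))
  -- Commuting `ρ.lap` past `ρ` makes the two inner Laplacian terms literally equal, so that they
  -- cancel.
  rw [avgL_comm ρ.lap ρ b, mollLap_apply,
    map_add (mollify f g) (comp A (avgL ρ (avgL ρ b))) (comp a (avgL ρ (avgL ρ B))),
    Complex.ofReal_neg]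
  generalize mollify f.lap g (comp a (avgL ρ (avgL ρ b))) = X₁
  generalize mollify f g (comp a (avgL ρ (avgL ρ.lap b))) = X₂
  generalize mollify f g (comp A (avgL ρ (avgL ρ b))) = X₃
  generalize mollify f g (comp a (avgL ρ (avgL ρ B))) = X₄
  generalize mollify f g.lap (comp a (avgL ρ (avgL ρ b))) = X₅
  rw [neg_smul]
  abel

/-- `i a_t - α Δ_x a - β Δ_y a = A` on `[0, T]`, after mollification in space and integration in
time. -/
structure IsSchrodinger (T α β : ℝ) (a A : ℝ → L2) : Prop where
  cont : ContinuousOn a (Icc 0 T)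
  int : IntegrableOn A (Icc 0 T)
  eqn : ∀ f g : Moll, ∀ t ∈ Icc 0 T, Complex.I • mollify f g (a t - a 0)
    = mollLap α β f g (∫ s in (0 : ℝ)..t, a s) + mollify f g (∫ s in (0 : ℝ)..t, A s)

variable {T α β γ : ℝ} {a b A B : ℝ → L2}

theorem intervalIntegrable_of_integrableOn_Icc {F : Type*} [NormedAddCommGroup F] {f : ℝ → F} {t : ℝ}
    (h : IntegrableOn f (Icc 0 T)) (ht : t ∈ Icc 0 T) : IntervalIntegrable f volume 0 t := by
  rw [intervalIntegrable_iff_integrableOn_Ioc_of_le ht.1]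
  exact h.mono_set fun s hs => ⟨hs.1.le, hs.2.trans ht.2⟩

namespace IsSchrodinger

theorem integrableOn (h : IsSchrodinger T α β a A) : IntegrableOn a (Icc 0 T) :=
  h.cont.integrableOn_Icc

theorem add (ha : IsSchrodinger T α β a A) (hb : IsSchrodinger T α β b B) :
    IsSchrodinger T α β (fun s => a s + b s) (fun s => A s + B s) where
  cont := ha.cont.add hb.cont
  int := ha.int.add hb.int
  eqn f g t ht := by
    rw [intervalIntegral.integral_add (intervalIntegrable_of_integrableOn_Icc ha.integrableOn ht)
        (intervalIntegrable_of_integrableOn_Icc hb.integrableOn ht),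
      intervalIntegral.integral_add (intervalIntegrable_of_integrableOn_Icc ha.int ht)
        (intervalIntegrable_of_integrableOn_Icc hb.int ht), add_sub_add_comm,
      map_add (mollify f g) (a t - a 0) (b t - b 0),
      map_add (mollify f g) (∫ s in (0 : ℝ)..t, A s) (∫ s in (0 : ℝ)..t, B s),
      map_add (mollLap α β f g) (∫ s in (0 : ℝ)..t, a s) (∫ s in (0 : ℝ)..t, b s), smul_add,
      ha.eqn f g t ht, hb.eqn f g t ht]
    exact add_add_add_comm _ _ _ _

/-- Conjugating `i` reverses the signs of both Laplacians and of the source; transposing exchanges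
the variables. -/
theorem adjoint (ha : IsSchrodinger T α β a A) :
    IsSchrodinger T (-β) (-α) (fun s => adj (a s)) (fun s => -adj (A s)) where
  cont := continuous_adj.comp_continuousOn ha.cont
  int := (adjₗᵢ.toContinuousLinearMap.integrable_comp ha.int).neg
  eqn f g t ht := by
    have h := congrArg adj (ha.eqn g f t ht)
    have h1 : ∫ s in (0 : ℝ)..t, adj (a s) = adj (∫ s in (0 : ℝ)..t, a s) :=
      adjₗᵢ.toContinuousLinearMap.intervalIntegral_comp_comm
        (intervalIntegrable_of_integrableOn_Icc ha.integrableOn ht)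
    have h2 : ∫ s in (0 : ℝ)..t, adj (A s) = adj (∫ s in (0 : ℝ)..t, A s) :=
      adjₗᵢ.toContinuousLinearMap.intervalIntegral_comp_comm
        (intervalIntegrable_of_integrableOn_Icc ha.int ht)
    rw [adj_add, adj_mollLap, adj_mollify g f (∫ s in (0 : ℝ)..t, A s), adj_smul Complex.I,
      adj_mollify g f (a t - a 0), adj_sub,
      Complex.star_def, Complex.conj_I, neg_smul, neg_eq_iff_eq_neg, neg_add] at h
    rw [intervalIntegral.integral_neg, h1, h2, mollLap_neg,
      map_neg (mollify f g) (adj (∫ s in (0 : ℝ)..t, A s)), h]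

theorem mollify_eq (ha : IsSchrodinger T α β a A) (f g : Moll) {t : ℝ} (ht : t ∈ Icc 0 T) :
    mollify f g (a t) = mollify f g (a 0)
      + ∫ s in (0 : ℝ)..t, -Complex.I • (mollLap α β f g (a s) + mollify f g (A s)) := by
  have h := ha.eqn f g t ht
  have h1 := intervalIntegrable_of_integrableOn_Icc ha.integrableOn ht
  have h2 := intervalIntegrable_of_integrableOn_Icc ha.int ht
  have h3 : ∫ s in (0 : ℝ)..t, (mollLap α β f g (a s) + mollify f g (A s))
      = mollLap α β f g (∫ s in (0 : ℝ)..t, a s) + mollify f g (∫ s in (0 : ℝ)..t, A s) := by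
    rw [intervalIntegral.integral_add, (mollLap α β f g).intervalIntegral_comp_comm h1,
      (mollify f g).intervalIntegral_comp_comm h2]
    · exact ⟨(mollLap α β f g).integrable_comp h1.1, (mollLap α β f g).integrable_comp h1.2⟩
    · exact ⟨(mollify f g).integrable_comp h2.1, (mollify f g).integrable_comp h2.2⟩
  rw [intervalIntegral.integral_smul, h3, ← h, smul_smul, map_sub]
  simp

theorem integrableOn_deriv (ha : IsSchrodinger T α β a A) (f g : Moll) :
    IntegrableOn (fun s => -Complex.I • (mollLap α β f g (a s) + mollify f g (A s))) (Icc 0 T) :=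
  (((mollLap α β f g).integrable_comp ha.integrableOn).add
    ((mollify f g).integrable_comp ha.int)).smul (-Complex.I)

end IsSchrodinger

theorem aestronglyMeasurable_comp {μ : Measure ℝ} (ha : AEStronglyMeasurable a μ)
    (hb : AEStronglyMeasurable b μ) : AEStronglyMeasurable (fun s => comp (a s) (b s)) μ :=
  compL.aestronglyMeasurable_comp₂ ha hb

theorem integrableOn_norm_mul_norm (hA : IntegrableOn A (Icc 0 T)) (hb : ContinuousOn b (Icc 0 T)) :
    IntegrableOn (fun s => ‖A s‖ * ‖b s‖) (Icc 0 T) :=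
  IntegrableOn.mul_continuousOn hA.norm hb.norm isCompact_Icc

theorem integrableOn_comp_left (hA : IntegrableOn A (Icc 0 T)) (hb : ContinuousOn b (Icc 0 T)) :
    IntegrableOn (fun s => comp (A s) (b s)) (Icc 0 T) := by
  refine Integrable.mono' (integrableOn_norm_mul_norm hA hb)
    (aestronglyMeasurable_comp hA.1 (hb.aestronglyMeasurable measurableSet_Icc)) ?_
  exact Filter.Eventually.of_forall fun s => norm_comp_le _ _

theorem integrableOn_comp_right (ha : ContinuousOn a (Icc 0 T)) (hB : IntegrableOn B (Icc 0 T)) :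
    IntegrableOn (fun s => comp (a s) (B s)) (Icc 0 T) := by
  refine Integrable.mono' (integrableOn_norm_mul_norm hB ha)
    (aestronglyMeasurable_comp (ha.aestronglyMeasurable measurableSet_Icc) hB.1) ?_
  exact Filter.Eventually.of_forall fun s => by rw [mul_comm]; exact norm_comp_le _ _

open Filter Topology in
theorem tendsto_integral_comp_avgL {C D : ℝ → L2} {t : ℝ} (ht : t ∈ Icc 0 T)
    (hC : AEStronglyMeasurable C (volume.restrict (Icc 0 T)))
    (hD : AEStronglyMeasurable D (volume.restrict (Icc 0 T)))
    (hCD : IntegrableOn (fun s => ‖C s‖ * ‖D s‖) (Icc 0 T)) :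
    Tendsto (fun n => ∫ s in (0 : ℝ)..t, comp (C s) (avgL (moll n) (avgL (moll n) (D s)))) atTop
      (𝓝 (∫ s in (0 : ℝ)..t, comp (C s) (D s))) := by
  have hsub : uIoc 0 t ⊆ Icc 0 T := by
    rw [uIoc_of_le ht.1]
    exact fun s hs => ⟨hs.1.le, hs.2.trans ht.2⟩
  refine intervalIntegral.tendsto_integral_filter_of_dominated_convergence
    (fun s => ‖C s‖ * ‖D s‖) ?_ ?_ ?_ ?_
  · refine Eventually.of_forall fun n => AEStronglyMeasurable.mono_set hsub ?_
    exact aestronglyMeasurable_comp hC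
      (((avgL (moll n)).comp (avgL (moll n))).continuous.comp_aestronglyMeasurable hD)
  · refine Eventually.of_forall fun n => Eventually.of_forall fun s _ => ?_
    refine (norm_comp_le _ _).trans ?_
    gcongr
    exact norm_avgL_avgL_le n _
  · exact intervalIntegrable_of_integrableOn_Icc hCD ht
  · refine Eventually.of_forall fun s _ => ?_
    exact ((compLeft (C s)).continuous.tendsto _).comp (tendsto_avgL_avgL (D s))

open Filter Topology in
-- The product rule is applied to kernels mollified by `moll n` in the integrated variable. After
-- the inner Laplacians have cancelled, nothing singular in `n` remains, and dominated convergence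
-- gives `n → ∞` with `f`, `g` fixed.
theorem IsSchrodinger.comp (ha : IsSchrodinger T α β a A) (hb : IsSchrodinger T (-β) γ b B) :
    IsSchrodinger T α γ (fun s => comp (a s) (b s))
      (fun s => comp (A s) (b s) + comp (a s) (B s)) where
  cont := compL_isBoundedBilinearMap.continuous.comp_continuousOn (ha.cont.prodMk hb.cont)
  int := (integrableOn_comp_left ha.int hb.cont).add (integrableOn_comp_right ha.cont hb.int)
  eqn f g t ht := by
    have hT : ∀ s ∈ Icc 0 t, s ∈ Icc 0 T := fun s hs => ⟨hs.1, hs.2.trans ht.2⟩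
    have ham := ha.cont.aestronglyMeasurable (μ := volume) measurableSet_Icc
    have hbm := hb.cont.aestronglyMeasurable (μ := volume) measurableSet_Icc
    -- `Q n` is the double inner smoothing left over, one mollifier from each factor.
    let Q : ℕ → L2 →L[ℂ] L2 := fun n => (avgL (moll n)).comp (avgL (moll n))
    have hQ : ∀ n c, Q n c = avgL (moll n) (avgL (moll n) c) := fun _ _ => rfl
    have hQcont : ∀ n, ContinuousOn (fun s => Q n (b s)) (Icc 0 T) := fun n =>
      (Q n).continuous.comp_continuousOn hb.cont
    have key : ∀ n, Complex.I • mollify f g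
          (PairExcitation.comp (a t) (Q n (b t)) - PairExcitation.comp (a 0) (Q n (b 0)))
        = mollLap α γ f g (∫ s in (0 : ℝ)..t, PairExcitation.comp (a s) (Q n (b s)))
          + mollify f g ((∫ s in (0 : ℝ)..t, PairExcitation.comp (A s) (Q n (b s)))
            + ∫ s in (0 : ℝ)..t, PairExcitation.comp (a s) (Q n (B s))) := by
      intro n
      have hprod := bilinear_integral_product_rule compL_isBoundedBilinearMap.toContinuousLinearMap
        ht.1 ((ha.integrableOn_deriv f (moll n)).mono_set hT)
        ((hb.integrableOn_deriv (moll n) g).mono_set hT)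
        (fun s hs => ha.mollify_eq f (moll n) (hT s hs))
        (fun s hs => hb.mollify_eq (moll n) g (hT s hs))
      simp only [IsBoundedBilinearMap.toContinuousLinearMap_apply, comp_mollify] at hprod
      simp only [comp_deriv_mollify, ← hQ] at hprod
      have i1 := intervalIntegrable_of_integrableOn_Icc
        (integrableOn_comp_left ha.integrableOn (hQcont n)) ht
      have i2 := intervalIntegrable_of_integrableOn_Icc
        (integrableOn_comp_left ha.int (hQcont n)) ht
      have i3 := intervalIntegrable_of_integrableOn_Icc
        (integrableOn_comp_right ha.cont ((Q n).integrable_comp hb.int)) ht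
      have i23 := i2.add i3
      rw [intervalIntegral.integral_smul, intervalIntegral.integral_add
          ⟨(mollLap α γ f g).integrable_comp i1.1, (mollLap α γ f g).integrable_comp i1.2⟩
          ⟨(mollify f g).integrable_comp i23.1, (mollify f g).integrable_comp i23.2⟩,
        (mollLap α γ f g).intervalIntegral_comp_comm i1,
        (mollify f g).intervalIntegral_comp_comm i23, intervalIntegral.integral_add i2 i3] at hprod
      rw [map_sub (mollify f g) (PairExcitation.comp (a t) (Q n (b t)))
        (PairExcitation.comp (a 0) (Q n (b 0))), hprod, smul_smul, mul_neg, Complex.I_mul_I, neg_neg,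
        one_smul]
    have hl : Tendsto (fun n => Complex.I • mollify f g
          (PairExcitation.comp (a t) (Q n (b t)) - PairExcitation.comp (a 0) (Q n (b 0)))) atTop
        (𝓝 (Complex.I • mollify f g
          (PairExcitation.comp (a t) (b t) - PairExcitation.comp (a 0) (b 0)))) := by
      refine Tendsto.const_smul (((mollify f g).continuous.tendsto _).comp (Tendsto.sub ?_ ?_)) _
      · exact ((compLeft (a t)).continuous.tendsto _).comp (tendsto_avgL_avgL (b t))
      · exact ((compLeft (a 0)).continuous.tendsto _).comp (tendsto_avgL_avgL (b 0))
    have hr := (((mollLap α γ f g).continuous.tendsto _).comp (tendsto_integral_comp_avgL ht ham hbm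
        (integrableOn_norm_mul_norm ha.integrableOn hb.cont))).add
      (((mollify f g).continuous.tendsto _).comp
        ((tendsto_integral_comp_avgL ht ha.int.1 hbm
          (integrableOn_norm_mul_norm ha.int hb.cont)).add
        (tendsto_integral_comp_avgL ht ham hb.int.1
          (by simpa only [mul_comm] using integrableOn_norm_mul_norm hb.int ha.cont))))
    have := tendsto_nhds_unique (hl.congr key) hr
    rw [this, ← intervalIntegral.integral_add]
    · exact intervalIntegrable_of_integrableOn_Icc (integrableOn_comp_left ha.int hb.cont) ht
    · exact intervalIntegrable_of_integrableOn_Icc (integrableOn_comp_right ha.cont hb.int) ht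

/-! ### Uniqueness of the source and the energy identity. -/

theorem ae_eq_of_integral_eq {F G : ℝ → L2} (hF : IntegrableOn F (Icc 0 T))
    (hG : IntegrableOn G (Icc 0 T))
    (h : ∀ t ∈ Icc 0 T, ∫ s in (0 : ℝ)..t, F s = ∫ s in (0 : ℝ)..t, G s) :
    F =ᵐ[volume.restrict (Icc 0 T)] G := by
  rcases lt_or_ge T 0 with hT | hT
  · rw [Icc_eq_empty (not_le.2 hT), Measure.restrict_empty, ae_zero]
    exact Filter.eventually_bot
  have hI : ∀ {f : ℝ → L2}, IntegrableOn f (Icc 0 T) → IntervalIntegrable f volume 0 T :=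
    fun hf => intervalIntegrable_of_integrableOn_Icc hf ⟨hT, le_rfl⟩
  rw [← restrict_Ioo_eq_restrict_Icc, Filter.EventuallyEq, ae_restrict_iff' measurableSet_Ioo]
  filter_upwards [(hI hF).ae_hasDerivAt_integral, (hI hG).ae_hasDerivAt_integral] with s h1 h2 hs
  have hs' : s ∈ uIcc 0 T := by rw [uIcc_of_le hT]; exact Ioo_subset_Icc_self hs
  have h1' := h1 hs' 0 left_mem_uIcc
  have h2' := h2 hs' 0 left_mem_uIcc
  refine h1'.unique (h2'.congr_of_eventuallyEq ?_)
  filter_upwards [Ioo_mem_nhds hs.1 hs.2] with r hr using h r (Ioo_subset_Icc_self hr)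

/-- The two equations differ only in the mollified time integrals of their sources. Letting the
mollifiers tend to the Dirac mass equates these integrals, and Lebesgue differentiation equates the
sources. -/
theorem IsSchrodinger.ae_eq (hA : IsSchrodinger T α β a A) (hB : IsSchrodinger T α β b B)
    (hab : ∀ t ∈ Icc 0 T, a t = b t) : A =ᵐ[volume.restrict (Icc 0 T)] B := by
  refine ae_eq_of_integral_eq hA.int hB.int fun t ht => ?_
  have h : ∀ n, mollify (moll n) (moll n) (∫ s in (0 : ℝ)..t, A s)
      = mollify (moll n) (moll n) (∫ s in (0 : ℝ)..t, B s) := fun n => by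
    have h1 := hA.eqn (moll n) (moll n) t ht
    have h2 := hB.eqn (moll n) (moll n) t ht
    have h3 : ∫ s in (0 : ℝ)..t, a s = ∫ s in (0 : ℝ)..t, b s :=
      intervalIntegral.integral_congr fun s hs => by
        rw [uIcc_of_le ht.1] at hs
        exact hab s ⟨hs.1, hs.2.trans ht.2⟩
    rw [hab t ht, hab 0 ⟨le_rfl, ht.1.trans ht.2⟩, h2, h3] at h1
    exact (add_left_cancel h1).symm
  exact tendsto_nhds_unique ((tendsto_mollify _).congr h) (tendsto_mollify _)

theorem re_inner_isBoundedBilinearMap :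
    IsBoundedBilinearMap ℝ (fun x : L2 × L2 => (inner ℂ x.1 x.2).re) where
  add_left a b c := by rw [inner_add_left, Complex.add_re]
  smul_left r a b := by
    rw [real_smul_L2, inner_smul_left, Complex.conj_ofReal, Complex.re_ofReal_mul, smul_eq_mul]
  add_right a b c := by rw [inner_add_right, Complex.add_re]
  smul_right r a b := by
    rw [real_smul_L2, inner_smul_right, Complex.re_ofReal_mul, smul_eq_mul]
  bound := ⟨1, one_pos, fun a b => by
    rw [one_mul]
    exact (Complex.abs_re_le_norm _).trans (norm_inner_le_norm _ _)⟩

/-- Mollifications are symmetric and commute, and `α`, `β` are real: the mollified counterpart of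
the symmetry of `α Δ_x + β Δ_y`. -/
theorem im_inner_mollify_mollLap (α β : ℝ) (f g : Moll) (c : L2) :
    (inner ℂ (mollify f g c) (mollLap α β f g c)).im = 0 := by
  have h : ∀ f' g' : Moll, (inner ℂ (mollify f g c) (mollify f' g' c)).im = 0 := fun f' g' => by
    rw [← Complex.conj_eq_iff_im, inner_conj_symm, inner_mollify_left, mollify_comm,
      ← inner_mollify_left]
  rw [mollLap_apply, inner_add_right, inner_smul_right, inner_smul_right, Complex.add_im,
    Complex.im_ofReal_mul, Complex.im_ofReal_mul, h, h]
  simp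

open Filter Topology in
-- The mollified kernel is absolutely continuous in time, so its squared norm can be differentiated.
-- The Laplacian contributes a real inner product, which the factor `-i` removes, and the mollifiers
-- contract norms, which dominates the limit.
theorem IsSchrodinger.energy (ha : IsSchrodinger T α β a A) {t : ℝ} (ht : t ∈ Icc 0 T) :
    ‖a t‖ ^ 2 - ‖a 0‖ ^ 2 = ∫ s in (0 : ℝ)..t, 2 * (inner ℂ (a s) (A s)).im := by
  have hT : ∀ s ∈ Icc 0 t, s ∈ Icc 0 T := fun s hs => ⟨hs.1, hs.2.trans ht.2⟩
  have ham := ha.cont.aestronglyMeasurable (μ := volume) measurableSet_Icc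
  have hsub : uIoc 0 t ⊆ Icc 0 T := by
    rw [uIoc_of_le ht.1]
    exact fun s hs => ⟨hs.1.le, hs.2.trans ht.2⟩
  let J : ℕ → L2 →L[ℂ] L2 := fun n => mollify (moll n) (moll n)
  have hJ : ∀ c, Tendsto (fun n => J n c) atTop (𝓝 c) := tendsto_mollify
  have hJn : ∀ n c, ‖J n c‖ ≤ ‖c‖ := norm_mollify_le
  have key : ∀ n, ‖J n (a t)‖ ^ 2 - ‖J n (a 0)‖ ^ 2
      = ∫ s in (0 : ℝ)..t, 2 * (inner ℂ (J n (a s)) (J n (A s))).im := by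
    intro n
    let L : L2 →L[ℝ] L2 →L[ℝ] ℝ := re_inner_isBoundedBilinearMap.toContinuousLinearMap
    have hL : ∀ x y, L x y = (inner ℂ x y).re := fun _ _ => rfl
    have hprod := bilinear_integral_product_rule L
        ht.1 ((ha.integrableOn_deriv (moll n) (moll n)).mono_set hT)
        ((ha.integrableOn_deriv (moll n) (moll n)).mono_set hT)
        (fun s hs => ha.mollify_eq (moll n) (moll n) (hT s hs))
        (fun s hs => ha.mollify_eq (moll n) (moll n) (hT s hs))
    simp only [hL] at hprod
    have hn : ∀ c : L2, (inner ℂ c c).re = ‖c‖ ^ 2 := fun c => by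
      rw [inner_self_eq_norm_sq_to_K]; norm_cast
    rw [hn, hn] at hprod
    rw [hprod]
    refine intervalIntegral.integral_congr fun s _ => ?_
    have h1 : ∀ x y : L2, (inner ℂ x y).re = (inner ℂ y x).re := fun x y => by
      rw [← inner_conj_symm, Complex.conj_re]
    rw [h1, ← two_mul, inner_smul_right, inner_add_right]
    have := im_inner_mollify_mollLap α β (moll n) (moll n) (a s)
    simp [this, J]
  have hl : Tendsto (fun n => ‖J n (a t)‖ ^ 2 - ‖J n (a 0)‖ ^ 2) atTop
      (𝓝 (‖a t‖ ^ 2 - ‖a 0‖ ^ 2)) :=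
    ((hJ _).norm.pow 2).sub ((hJ _).norm.pow 2)
  refine tendsto_nhds_unique (hl.congr key) ?_
  refine intervalIntegral.tendsto_integral_filter_of_dominated_convergence
    (fun s => 2 * (‖A s‖ * ‖a s‖)) ?_ ?_ ?_ ?_
  · refine Eventually.of_forall fun n => AEStronglyMeasurable.mono_set hsub ?_
    refine AEStronglyMeasurable.const_mul (Complex.continuous_im.comp_aestronglyMeasurable ?_) 2
    exact ((J n).continuous.comp_aestronglyMeasurable ham).inner
      ((J n).continuous.comp_aestronglyMeasurable ha.int.1)
  · refine Eventually.of_forall fun n => Eventually.of_forall fun s _ => ?_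
    rw [Real.norm_eq_abs, abs_mul, abs_two]
    gcongr
    refine (Complex.abs_im_le_norm _).trans ((norm_inner_le_norm _ _).trans ?_)
    rw [mul_comm]
    gcongr <;> exact hJn _ _
  · exact (intervalIntegrable_of_integrableOn_Icc
      (integrableOn_norm_mul_norm ha.int ha.cont) ht).const_mul 2
  · refine Eventually.of_forall fun s _ => ?_
    exact ((Complex.continuous_im.tendsto _).comp ((hJ _).inner (hJ _))).const_mul 2

end PairExcitation

end

noncomputable section

namespace PairExcitation

/-! ### Measurability of `L²`-valued functions -/

instance : SecondCountableTopology L2 := by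
  have : IsSeparable (volume : Measure (E × E)) :=
    @instIsSeparableOfCountablyGeneratedOfSFinite _ _ _ inferInstance inferInstance
  have : Fact ((2 : ℝ≥0∞) ≠ ⊤) := ⟨by norm_num⟩
  exact Lp.SecondCountableTopology (μ := (volume : Measure (E × E)))

theorem toL2_of_memLp {f : E × E → ℂ} (h : MemLp f 2 volume) : toL2 f = h.toLp := by
  rw [toL2, dif_pos h]

theorem toL2_of_not_memLp {f : E × E → ℂ} (h : ¬ MemLp f 2 volume) : toL2 f = 0 := by
  rw [toL2, dif_neg h]

theorem coeFn_toL2 {f : E × E → ℂ} (h : MemLp f 2 volume) : toL2 f =ᵐ[volume] f := by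
  rw [toL2_of_memLp h]
  exact h.coeFn_toLp

theorem memLp_two_iff_lintegral {f : E × E → ℂ} (hf : Measurable f) :
    MemLp f 2 volume ↔ ∫⁻ q, ‖f q‖ₑ ^ 2 < ⊤ := by
  have h := eLpNorm_nnreal_pow_eq_lintegral (f := f) (p := 2)
    (μ := (volume : Measure (E × E))) (by norm_num)
  have h2 : eLpNorm f 2 volume ^ 2 = ∫⁻ q, ‖f q‖ₑ ^ 2 := by simpa using h
  rw [← h2, MemLp, and_iff_right hf.aestronglyMeasurable, ENNReal.pow_lt_top_iff]
  simp

theorem measurable_enorm_toL2_sub {f : ℝ → E × E → ℂ} (hf : Measurable (Function.uncurry f))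
    (a : L2) : Measurable fun s => ‖toL2 (f s) - a‖ₑ ^ 2 := by
  have ha := (Lp.stronglyMeasurable a).measurable
  have hfs : ∀ s, Measurable (f s) := fun s => hf.comp measurable_prodMk_left
  have hI : Measurable fun s => ∫⁻ q, ‖f s q‖ₑ ^ 2 :=
    Measurable.lintegral_prod_right' (f := fun p : ℝ × (E × E) => ‖f p.1 p.2‖ₑ ^ 2)
      (hf.enorm.pow_const 2)
  have hJ : Measurable fun s => ∫⁻ q, ‖f s q - a q‖ₑ ^ 2 := by
    refine Measurable.lintegral_prod_right'
      (f := fun p : ℝ × (E × E) => ‖f p.1 p.2 - a p.2‖ₑ ^ 2) ?_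
    exact (hf.sub (ha.comp measurable_snd)).enorm.pow_const 2
  have hS : MeasurableSet {s | ∫⁻ q, ‖f s q‖ₑ ^ 2 < ⊤} := measurableSet_lt hI measurable_const
  have : (fun s => ‖toL2 (f s) - a‖ₑ ^ 2) = {s | ∫⁻ q, ‖f s q‖ₑ ^ 2 < ⊤}.piecewise
      (fun s => ∫⁻ q, ‖f s q - a q‖ₑ ^ 2) (fun _ => ‖a‖ₑ ^ 2) := by
    classical
    ext s
    by_cases hs : ∫⁻ q, ‖f s q‖ₑ ^ 2 < ⊤
    · rw [piecewise_eq_of_mem _ _ _ (by exact hs), enorm_pow_two]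
      have hm := (memLp_two_iff_lintegral (hfs s)).2 hs
      refine lintegral_congr_ae ?_
      filter_upwards [coeFn_toL2 hm, Lp.coeFn_sub (toL2 (f s)) a] with q h1 h2
      rw [h2, Pi.sub_apply, h1]
    · rw [piecewise_eq_of_notMem _ _ _ (by exact hs),
        toL2_of_not_memLp (fun h => hs ((memLp_two_iff_lintegral (hfs s)).1 h)), zero_sub, enorm_neg]
  rw [this]
  exact Measurable.piecewise hS hJ measurable_const

/-- By separability it suffices to pull back balls, and the distance to a fixed kernel is measurable
in time by Tonelli. -/
theorem stronglyMeasurable_toL2 {f : ℝ → E × E → ℂ} (hf : Measurable (Function.uncurry f)) :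
    StronglyMeasurable fun s => toL2 (f s) := by
  borelize (↥L2)
  refine Measurable.stronglyMeasurable ?_
  have hbasis : TopologicalSpace.IsTopologicalBasis
      {s : Set L2 | ∃ (a : L2) (r : ℝ), s = Metric.ball a r} := by
    refine TopologicalSpace.isTopologicalBasis_of_isOpen_of_nhds ?_ ?_
    · rintro _ ⟨a, r, rfl⟩
      exact Metric.isOpen_ball
    · intro a u ha hu
      obtain ⟨r, hr, h⟩ := Metric.isOpen_iff.1 hu a ha
      exact ⟨_, ⟨a, r, rfl⟩, Metric.mem_ball_self hr, h⟩
  have hb : borel L2 = MeasurableSpace.generateFrom _ := hbasis.borel_eq_generateFrom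
  suffices h : @Measurable _ _ _ (MeasurableSpace.generateFrom
      {s : Set L2 | ∃ (a : L2) (r : ℝ), s = Metric.ball a r}) fun s => toL2 (f s) by
    rw [← hb] at h
    exact h
  refine measurable_generateFrom ?_
  rintro _ ⟨a, r, rfl⟩
  have : (fun s => toL2 (f s)) ⁻¹' Metric.ball a r
      = {s | ‖toL2 (f s) - a‖ₑ ^ 2 < ENNReal.ofReal r ^ 2} := by
    ext s
    rw [mem_preimage, Metric.mem_ball, dist_eq_norm, mem_ofPred_eq,
      ENNReal.pow_lt_pow_left_iff two_ne_zero, ← ofReal_norm]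
    rcases le_or_gt r 0 with hr | hr
    · rw [ENNReal.ofReal_of_nonpos hr]
      simp [hr.trans (norm_nonneg _)]
    · rw [ENNReal.ofReal_lt_ofReal_iff hr]
  rw [this]
  exact measurableSet_lt (measurable_enorm_toL2_sub hf a) measurable_const

/-! ### Multiplication operators -/

/-- The kernel `V(x) a(x, y)`. -/
def mulL (V : E → ℝ) (a : L2) : L2 := toL2 fun q => (V q.1 : ℂ) * a q

/-- The kernel `V(y) a(x, y)`. -/
def mulR (V : E → ℝ) (a : L2) : L2 := toL2 fun q => (V q.2 : ℂ) * a q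

variable {V : E → ℝ} {C : ℝ}

theorem memLp_mul {W : E × E → ℝ} (hW : Measurable W) (hC : ∀ q, |W q| ≤ C) (a : L2) :
    MemLp (fun q => (W q : ℂ) * a q) 2 volume := by
  have ha := (Lp.stronglyMeasurable a).measurable
  refine (Lp.memLp a).of_le_mul (c := C) (Measurable.aestronglyMeasurable (by fun_prop)) ?_
  refine Filter.Eventually.of_forall fun q => ?_
  rw [norm_mul, Complex.norm_real]
  gcongr
  exact hC q

theorem coeFn_mulL (hV : Measurable V) (hC : ∀ x, |V x| ≤ C) (a : L2) :
    mulL V a =ᵐ[volume] fun q => (V q.1 : ℂ) * a q :=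
  coeFn_toL2 (memLp_mul (hV.comp measurable_fst) (fun q => hC q.1) a)

theorem coeFn_mulR (hV : Measurable V) (hC : ∀ x, |V x| ≤ C) (a : L2) :
    mulR V a =ᵐ[volume] fun q => (V q.2 : ℂ) * a q :=
  coeFn_toL2 (memLp_mul (hV.comp measurable_snd) (fun q => hC q.2) a)

theorem norm_mulL_le (hV : Measurable V) (hC : ∀ x, |V x| ≤ C) (a : L2) :
    ‖mulL V a‖ ≤ C * ‖a‖ := by
  refine Lp.norm_le_mul_norm_of_ae_le_mul ?_
  filter_upwards [coeFn_mulL hV hC a] with q hq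
  rw [hq, norm_mul, Complex.norm_real]
  gcongr
  exact hC q.1

theorem adj_mulL (hV : Measurable V) (hC : ∀ x, |V x| ≤ C) (a : L2) :
    adj (mulL V a) = mulR V (adj a) := by
  apply Lp.ext
  filter_upwards [coeFn_adj (mulL V a), ae_swap (coeFn_mulL hV hC a), coeFn_mulR hV hC (adj a),
    coeFn_adj a] with q h1 h2 h3 h4
  rw [h1, h2, h3, h4]
  simp

theorem adj_mulR (hV : Measurable V) (hC : ∀ x, |V x| ≤ C) (a : L2) :
    adj (mulR V a) = mulL V (adj a) := by
  rw [← adj_adj (mulL V (adj a)), adj_mulL hV hC, adj_adj]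

theorem comp_mulL_left (hV : Measurable V) (hC : ∀ x, |V x| ≤ C) (a b : L2) :
    comp (mulL V a) b = mulL V (comp a b) := by
  apply Lp.ext
  filter_upwards [comp_ae_eq (coeFn_mulL hV hC a) (Filter.EventuallyEq.refl _ b),
    coeFn_mulL hV hC (comp a b), coeFn_comp a b] with q h1 h2 h3
  rw [h1, h2, h3]
  simp only [compFun]
  rw [← integral_const_mul]
  simp only [mul_assoc]

theorem comp_mulR_left (hV : Measurable V) (hC : ∀ x, |V x| ≤ C) (a b : L2) :
    comp (mulR V a) b = comp a (mulL V b) := by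
  apply Lp.ext
  filter_upwards [comp_ae_eq (coeFn_mulR hV hC a) (Filter.EventuallyEq.refl _ b),
    comp_ae_eq (Filter.EventuallyEq.refl _ a) (coeFn_mulL hV hC b)] with q h1 h2
  rw [h1, h2]
  simp only [compFun]
  refine integral_congr_ae (Filter.Eventually.of_forall fun z => ?_)
  simp only
  ring

theorem inner_mulL_left (hV : Measurable V) (hC : ∀ x, |V x| ≤ C) (a b : L2) :
    inner ℂ (mulL V a) b = inner ℂ a (mulL V b) := by
  rw [inner_L2, inner_L2]
  refine integral_congr_ae ?_
  filter_upwards [coeFn_mulL hV hC a, coeFn_mulL hV hC b] with q h1 h2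
  rw [h1, h2, star_mul', Complex.star_def, Complex.conj_ofReal]
  ring

theorem inner_mulR_left (hV : Measurable V) (hC : ∀ x, |V x| ≤ C) (a b : L2) :
    inner ℂ (mulR V a) b = inner ℂ a (mulR V b) := by
  rw [← inner_adj_adj b, adj_mulR hV hC, ← inner_adj_adj (mulR V b), adj_mulR hV hC,
    ← inner_conj_symm, inner_mulL_left hV hC, inner_conj_symm]

theorem mulL_add (hV : Measurable V) (hC : ∀ x, |V x| ≤ C) (a b : L2) :
    mulL V (a + b) = mulL V a + mulL V b := by
  apply Lp.ext
  filter_upwards [coeFn_mulL hV hC (a + b), coeFn_mulL hV hC a, coeFn_mulL hV hC b,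
    Lp.coeFn_add a b, Lp.coeFn_add (mulL V a) (mulL V b)] with q h1 h2 h3 h4 h5
  rw [h1, h5, Pi.add_apply, h2, h3, h4, Pi.add_apply, mul_add]

theorem continuous_mulL (hV : Measurable V) (hC : ∀ x, |V x| ≤ C) : Continuous (mulL V) :=
  AddMonoidHomClass.continuous_of_bound (AddMonoidHom.mk' (mulL V) (mulL_add hV hC)) C
    (norm_mulL_le hV hC)

/-- A Carathéodory argument: `mulL (V s) b` is continuous in `b` and measurable in `s`, hence
jointly measurable. -/
theorem aestronglyMeasurable_mulL {V : ℝ → E → ℝ} (hV : Measurable (Function.uncurry V))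
    {B : ℝ → ℝ} (hB : ∀ s x, |V s x| ≤ B s) {a : ℝ → L2} {μ : Measure ℝ}
    (ha : AEStronglyMeasurable a μ) : AEStronglyMeasurable (fun s => mulL (V s) (a s)) μ := by
  borelize (↥L2)
  have hVs : ∀ s, Measurable (V s) := fun s => hV.comp measurable_prodMk_left
  have h : StronglyMeasurable (Function.uncurry fun (b : L2) (s : ℝ) => mulL (V s) b) := by
    refine stronglyMeasurable_uncurry_of_continuous_of_stronglyMeasurable
      (fun s => continuous_mulL (hVs s) (hB s)) fun b => ?_
    have hb := (Lp.stronglyMeasurable b).measurable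
    refine stronglyMeasurable_toL2 (f := fun s q => (V s q.1 : ℂ) * b q) ?_
    have h1 : Measurable fun p : ℝ × (E × E) => V p.1 p.2.1 :=
      hV.comp (by fun_prop : Measurable fun p : ℝ × (E × E) => (p.1, p.2.1))
    exact (Complex.measurable_ofReal.comp h1).mul (hb.comp measurable_snd)
  exact (h.comp_measurable (ha.stronglyMeasurable_mk.measurable.prodMk measurable_id)).aestronglyMeasurable.congr
    (ha.ae_eq_mk.mono fun s hs => by simp [Function.uncurry, ← hs])

theorem integrableOn_mulL {V : ℝ → E → ℝ} (hV : Measurable (Function.uncurry V))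
    {B : ℝ → ℝ} (hB : ∀ s x, |V s x| ≤ B s) {a : ℝ → L2} {T : ℝ} (hBi : IntegrableOn B (Icc 0 T))
    (ha : ContinuousOn a (Icc 0 T)) : IntegrableOn (fun s => mulL (V s) (a s)) (Icc 0 T) := by
  have hVs : ∀ s, Measurable (V s) := fun s => hV.comp measurable_prodMk_left
  refine Integrable.mono' (IntegrableOn.mul_continuousOn hBi ha.norm isCompact_Icc)
    (aestronglyMeasurable_mulL hV hB (ha.aestronglyMeasurable measurableSet_Icc)) ?_
  exact Filter.Eventually.of_forall fun s => norm_mulL_le (hVs s) (hB s) _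

theorem integrableOn_mulR {V : ℝ → E → ℝ} (hV : Measurable (Function.uncurry V))
    {B : ℝ → ℝ} (hB : ∀ s x, |V s x| ≤ B s) {a : ℝ → L2} {T : ℝ} (hBi : IntegrableOn B (Icc 0 T))
    (ha : ContinuousOn a (Icc 0 T)) : IntegrableOn (fun s => mulR (V s) (a s)) (Icc 0 T) := by
  have hVs : ∀ s, Measurable (V s) := fun s => hV.comp measurable_prodMk_left
  have h := integrableOn_mulL hV hB hBi (continuous_adj.comp_continuousOn ha)
  refine (adjₗᵢ.toContinuousLinearMap.integrable_comp h).congr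
    (Filter.Eventually.of_forall fun s => ?_)
  refine (adj_mulL (hVs s) (hB s) _).trans ?_
  rw [Function.comp_apply, adj_adj]

/-! ### The kernels `m` and `w` -/

section Coefficients

variable {v : E → ℝ} {φ : ℝ → E → ℂ}

theorem measurable_wFun (hv : Measurable v) (hφ : Measurable (Function.uncurry φ)) :
    Measurable (Function.uncurry (wFun v φ)) := by
  have h1 : Measurable fun p : ℝ × (E × E) => φ p.1 p.2.1 :=
    hφ.comp (by fun_prop : Measurable fun p : ℝ × (E × E) => (p.1, p.2.1))
  have h2 : Measurable fun p : ℝ × (E × E) => φ p.1 p.2.2 :=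
    hφ.comp (by fun_prop : Measurable fun p : ℝ × (E × E) => (p.1, p.2.2))
  have h3 : Measurable fun p : ℝ × (E × E) => v (p.2.1 - p.2.2) := hv.comp (by fun_prop)
  exact ((Complex.measurable_ofReal.comp h3).mul h1).mul (continuous_star.measurable.comp h2)

theorem norm_wFun (v : E → ℝ) (φ : ℝ → E → ℂ) (t : ℝ) (q : E × E) :
    ‖wFun v φ t q‖ = ‖mFun v φ t q‖ := by
  simp [wFun, mFun]

theorem transpose_toL2 {f : E × E → ℂ} (h : ∀ q, f q.swap = f q) :
    transpose (toL2 f) = toL2 f := by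
  by_cases hf : MemLp f 2 volume
  · apply Lp.ext
    filter_upwards [coeFn_transpose (toL2 f), coeFn_toL2 hf, ae_swap (coeFn_toL2 hf)] with q h1 h2 h3
    rw [h1, h3, h2, h]
  · rw [toL2_of_not_memLp hf]
    exact transposeₗᵢ.map_zero

theorem adj_toL2 {f : E × E → ℂ} (h : ∀ q, star (f q.swap) = f q) :
    adj (toL2 f) = toL2 f := by
  by_cases hf : MemLp f 2 volume
  · apply Lp.ext
    filter_upwards [coeFn_adj (toL2 f), coeFn_toL2 hf, ae_swap (coeFn_toL2 hf)] with q h1 h2 h3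
    rw [h1, h3, h2, h]
  · rw [toL2_of_not_memLp hf]
    exact adjₗᵢ.map_zero

theorem adj_mKer (hv_even : ∀ x, v (-x) = v x) (t : ℝ) :
    adj (mKer v φ t) = star (mKer v φ t) := by
  rw [adj, mKer, transpose_toL2]
  intro q
  simp only [mFun, Prod.fst_swap, Prod.snd_swap]
  rw [← hv_even, neg_sub]
  ring

theorem adj_wKer (hv_even : ∀ x, v (-x) = v x) (t : ℝ) : adj (wKer v φ t) = wKer v φ t := by
  rw [wKer, adj_toL2]
  intro q
  simp only [wFun, Prod.fst_swap, Prod.snd_swap, star_mul', Complex.star_def,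
    Complex.conj_ofReal, Complex.conj_conj]
  rw [← hv_even, neg_sub]
  ring

/-- `w` and `m` have the same modulus, so only measurability in time has to be supplied. -/
theorem integrableOn_wKer (hv : Measurable v) (hφ : Measurable (Function.uncurry φ)) {T : ℝ}
    (hm : ∀ᵐ t ∂(volume.restrict (Icc 0 T)), MemLp (mFun v φ t) 2 volume)
    (hm_int : IntegrableOn (mKer v φ) (Icc 0 T)) : IntegrableOn (wKer v φ) (Icc 0 T) := by
  have hw := measurable_wFun hv hφ
  refine Integrable.mono hm_int (stronglyMeasurable_toL2 hw).aestronglyMeasurable ?_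
  filter_upwards [hm] with t ht
  have hwt : MemLp (wFun v φ t) 2 volume :=
    ht.of_le (hw.comp measurable_prodMk_left).aestronglyMeasurable
      (Filter.Eventually.of_forall fun q => (norm_wFun v φ t q).le)
  refine Lp.norm_le_norm_of_ae_le ?_
  filter_upwards [coeFn_toL2 ht, coeFn_toL2 hwt] with q h1 h2
  rw [wKer, mKer, h1, h2, norm_wFun]

theorem measurable_meanField (hv : Measurable v) (hφ : Measurable (Function.uncurry φ)) :
    Measurable (Function.uncurry (meanField v φ)) := by
  have h : StronglyMeasurable fun p : (ℝ × E) × E => v (p.1.2 - p.2) * ‖φ p.1.1 p.2‖ ^ 2 := by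
    have h1 : Measurable fun p : (ℝ × E) × E => φ p.1.1 p.2 :=
      hφ.comp (by fun_prop : Measurable fun p : (ℝ × E) × E => (p.1.1, p.2))
    have h2 : Measurable fun p : (ℝ × E) × E => v (p.1.2 - p.2) := hv.comp (by fun_prop)
    exact (h2.mul (h1.norm.pow_const 2)).stronglyMeasurable
  exact h.integral_prod_right'.measurable

/-- The mean field is set to zero where it exceeds a measurable version of `β`. Multiplication by
the new potential is bounded at every time, and almost nothing has changed. -/
theorem exists_bounded_potential (hv : Measurable v) (hφ : Measurable (Function.uncurry φ)) {T : ℝ}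
    (hV_bdd : ∃ β : ℝ → ℝ, IntegrableOn β (Icc 0 T) ∧
      ∀ᵐ t ∂(volume.restrict (Icc 0 T)), ∀ᵐ x : E, |meanField v φ t x| ≤ β t) :
    ∃ (V : ℝ → E → ℝ) (B : ℝ → ℝ), Measurable (Function.uncurry V) ∧ IntegrableOn B (Icc 0 T) ∧
      (∀ s x, |V s x| ≤ B s) ∧
      ∀ᵐ t ∂(volume.restrict (Icc 0 T)), ∀ᵐ x : E, meanField v φ t x = V t x := by
  obtain ⟨β, hβ, hle⟩ := hV_bdd
  have hmk := hβ.1.stronglyMeasurable_mk.measurable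
  have hmf := measurable_meanField hv hφ
  classical
  refine ⟨fun s x => if |meanField v φ s x| ≤ hβ.1.mk β s then meanField v φ s x else 0,
    fun s => |hβ.1.mk β s|, ?_, ?_, ?_, ?_⟩
  · refine Measurable.ite ?_ hmf measurable_const
    exact measurableSet_le (hmf.norm) (hmk.comp measurable_fst)
  · exact (hβ.congr hβ.1.ae_eq_mk).abs
  · intro s x
    simp only
    split_ifs with h
    · exact h.trans (le_abs_self _)
    · simp
  · filter_upwards [hle, hβ.1.ae_eq_mk] with t h1 h2
    filter_upwards [h1] with x hx
    rw [if_pos (hx.trans_eq h2)]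

end Coefficients

/-! ### Continuity of `ch(k)` -/

/-- The operator square root is handled by monotonicity. With `X = p - r`, the difference of the
squares is `2X + pX + Xr`; pairing with `X` and using `p, r ≥ 0` bounds `2‖X‖²` by `‖X‖` times the
right side. -/
theorem norm_chSubOne_sub_le {k l : L2} (hk : transpose k = k) (hl : transpose l = l) :
    ‖chSubOne k - chSubOne l‖
      ≤ ‖comp (sh k) (adj (sh k)) - comp (sh l) (adj (sh l))‖ := by
  have hp := adj_chSubOne hl
  have hpos := re_inner_chSubOne_nonneg hk
  have hpos' := re_inner_chSubOne_nonneg hl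
  rw [← two_chSubOne_add hk, ← two_chSubOne_add hl]
  generalize chSubOne k = p at *
  generalize chSubOne l = r at *
  have hD : (2 : ℂ) • p + comp p p - ((2 : ℂ) • r + comp r r)
      = (2 : ℂ) • (p - r) + comp p (p - r) + comp (p - r) r := by
    have h1 : comp p (p - r) = comp p p - comp p r := (compLeft p).map_sub p r
    have h2 : comp (p - r) r = comp p r - comp r r := by
      have := congrArg (fun A : L2 →L[ℂ] L2 => A r) (compL.map_sub p r)
      exact this
    rw [h1, h2, smul_sub]
    abel
  rw [hD]
  generalize p - r = X
  have h1 : 0 ≤ (inner ℂ X (comp X r)).re := by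
    rw [← inner_adj_adj, adj_comp, hp, ← inner_conj_symm, Complex.conj_re]
    exact hpos' _
  have h2 : ‖X‖ ^ 2 * 2 ≤ (inner ℂ X ((2 : ℂ) • X + comp p X + comp X r)).re := by
    rw [inner_add_right, inner_add_right, Complex.add_re, Complex.add_re, inner_smul_right,
      inner_self_eq_norm_sq_to_K]
    have : ((2 : ℂ) * ((‖X‖ : ℂ)) ^ 2).re = ‖X‖ ^ 2 * 2 := by
      norm_cast
      ring
    have h3 := hpos X
    refine le_trans this.ge ?_
    exact (le_add_of_nonneg_right h3).trans (le_add_of_nonneg_right h1)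
  have h3 := h2.trans ((Complex.re_le_norm _).trans (norm_inner_le_norm _ _))
  have hd : 0 ≤ ‖(2 : ℂ) • X + comp p X + comp X r‖ := norm_nonneg _
  generalize ‖(2 : ℂ) • X + comp p X + comp X r‖ = d at *
  rcases (norm_nonneg X).eq_or_lt with h0 | h0
  · rwa [← h0]
  · nlinarith

open Filter Topology in
theorem continuousOn_chSubOne {k : ℝ → L2} {S : Set ℝ} (hk : ∀ t ∈ S, transpose (k t) = k t)
    (hc : ContinuousOn (fun t => sh (k t)) S) : ContinuousOn (fun t => chSubOne (k t)) S := by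
  have hN : ContinuousOn (fun t => comp (sh (k t)) (adj (sh (k t)))) S :=
    compL_isBoundedBilinearMap.continuous.comp_continuousOn
      (hc.prodMk (continuous_adj.comp_continuousOn hc))
  intro t ht
  have h := hN t ht
  rw [ContinuousWithinAt, tendsto_iff_norm_sub_tendsto_zero] at h ⊢
  refine squeeze_zero' (Eventually.of_forall fun _ => norm_nonneg _) ?_ h
  filter_upwards [self_mem_nhdsWithin] with s hs
  exact norm_chSubOne_sub_le (hk s hs) (hk t ht)

end PairExcitation

end

noncomputable section

namespace PairExcitation

/-! ### From the weak formulation to the mollified equations -/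

/-- The pairing with a square-integrable function, as a continuous linear functional. -/
def pairL (ψ : E × E → ℂ) : L2 →L[ℂ] ℂ := innerSL ℂ (toL2 (star ψ))

theorem pairL_apply {ψ : E × E → ℂ} (h : MemLp ψ 2 volume) (a : L2) : pairL ψ a = pair a ψ := by
  rw [pairL, innerSL_apply_apply, inner_L2, pair]
  refine integral_congr_ae ?_
  filter_upwards [coeFn_toL2 h.star] with q hq
  rw [hq, Pi.star_apply, star_star]

attribute [local irreducible] pairL mollify mollLap comp

section

variable {T : ℝ} {a K G A : ℝ → L2}

set_option maxHeartbeats 1000000 in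
-- Pairings are continuous functionals, so they commute with the time integrals; the scalar
-- identities then form one weak equation for the integrated kernels.
theorem isSchrodinger_of_pair {σ : ℝ} (ha : ContinuousOn a (Icc 0 T)) (hA : IntegrableOn A (Icc 0 T))
    (h : ∀ f g q, ∀ t ∈ Icc 0 T,
      Complex.I * (pair (a t) (tensorTest f g q) - pair (a 0) (tensorTest f g q))
        = ∫ s in (0 : ℝ)..t, (pair (a s) (tensorTest f.lap g q)
          + σ * pair (a s) (tensorTest f g.lap q) + pair (A s) (tensorTest f g q))) :
    IsSchrodinger T 1 σ a A where
  cont := ha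
  int := hA
  eqn f g t ht := by
    have ha' := intervalIntegrable_of_integrableOn_Icc ha.integrableOn_Icc ht
    have hA' := intervalIntegrable_of_integrableOn_Icc hA ht
    have key : ∀ q, pair (Complex.I • (a t - a 0) - ∫ s in (0 : ℝ)..t, A s) (tensorTest f g q)
        = ((1 : ℝ) : ℂ) * pair (∫ s in (0 : ℝ)..t, a s) (tensorTest f.lap g q)
          + (σ : ℂ) * pair (∫ s in (0 : ℝ)..t, a s) (tensorTest f g.lap q) := fun q => by
      have h0 := (isTest_tensorTest f g q).memLp
      have h1 := (isTest_tensorTest f.lap g q).memLp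
      have h2 := (isTest_tensorTest f g.lap q).memLp
      have hi : ∀ (ψ : E × E → ℂ) {b : ℝ → L2}, IntervalIntegrable b volume 0 t →
          IntervalIntegrable (fun s => pairL ψ (b s)) volume 0 t := fun ψ b hb =>
        ⟨(pairL ψ).integrable_comp hb.1, (pairL ψ).integrable_comp hb.2⟩
      have h' := h f g q t ht
      simp only [← pairL_apply h0, ← pairL_apply h1, ← pairL_apply h2] at h' ⊢
      rw [intervalIntegral.integral_add ((hi _ ha').add ((hi _ ha').const_mul _)) (hi _ hA'),
        intervalIntegral.integral_add (hi _ ha') ((hi _ ha').const_mul _),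
        intervalIntegral.integral_const_mul, (pairL _).intervalIntegral_comp_comm ha',
        (pairL _).intervalIntegral_comp_comm ha', (pairL _).intervalIntegral_comp_comm hA'] at h'
      rw [map_sub, map_smul, map_sub, smul_eq_mul, h', Complex.ofReal_one, one_mul]
      ring
    have := mollify_eq_of_weak key
    rw [map_sub (mollify f g), map_smul (mollify f g), sub_eq_iff_eq_add] at this
    rw [this, mollLap_apply]
    rfl

theorem pair_add_mul (a : L2) {V : E → ℝ} {C : ℝ} (hV : Measurable V) (hC : ∀ x, |V x| ≤ C)
    {mf : E → ℝ} (hmf : ∀ᵐ x, mf x = V x) (σ : ℝ) {ψ : E × E → ℂ} (hψ : MemLp ψ 2 volume) :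
    pair a (fun q => ((mf q.1 + σ * mf q.2 : ℝ) : ℂ) * ψ q)
      = pair (mulL V a) ψ + σ * pair (mulR V a) ψ := by
  have h1 : ∀ᵐ q : E × E, mf q.1 = V q.1 :=
    (Measure.quasiMeasurePreserving_fst (μ := (volume : Measure E))
      (ν := (volume : Measure E))).ae hmf
  have h2 : ∀ᵐ q : E × E, mf q.2 = V q.2 :=
    (Measure.quasiMeasurePreserving_snd (μ := (volume : Measure E))
      (ν := (volume : Measure E))).ae hmf
  rw [pair, pair, pair, ← integral_const_mul, ← integral_add (integrable_mul_of_memLp _ hψ)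
    ((integrable_mul_of_memLp _ hψ).const_mul _)]
  refine integral_congr_ae ?_
  filter_upwards [h1, h2, coeFn_mulL hV hC a, coeFn_mulR hV hC a] with q h1 h2 h3 h4
  rw [h1, h2, h3, h4]
  push_cast
  ring

theorem pair_sub_lap (a : L2) (f g : Moll) (q : E × E) (σ : ℝ) :
    pair a (fun z => -lapX (tensorTest f g q) z - σ * lapY (tensorTest f g q) z)
      = -pair a (tensorTest f.lap g q) - σ * pair a (tensorTest f g.lap q) := by
  have h1 := integrable_mul_of_memLp a (isTest_tensorTest f.lap g q).memLp
  have h2 := integrable_mul_of_memLp a (isTest_tensorTest f g.lap q).memLp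
  have h1' : Integrable fun z => -(a z * tensorTest f.lap g q z) := h1.neg
  rw [lapX_tensorTest, lapY_tensorTest, pair, pair, pair, ← integral_const_mul, ← integral_neg,
    ← integral_sub h1' (h2.const_mul _)]
  refine integral_congr_ae (Filter.Eventually.of_forall fun z => ?_)
  simp only
  ring

/-- The cases `σ = 1` and `σ = -1` are `S` and `W`. Only the Laplacians stay on the left;
compositions with `w` and multiplication by the potential are integrable in time and join the
source. -/
theorem isSchrodinger_of_weak {σ : ℝ} {V mf : ℝ → E → ℝ} {B : ℝ → ℝ}
    (hV : Measurable (Function.uncurry V)) (hB : ∀ s x, |V s x| ≤ B s)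
    (hBi : IntegrableOn B (Icc 0 T))
    (hmf : ∀ᵐ t ∂(volume.restrict (Icc 0 T)), ∀ᵐ x : E, mf t x = V t x)
    (ha : ContinuousOn a (Icc 0 T)) (hK : IntegrableOn K (Icc 0 T)) (hG : IntegrableOn G (Icc 0 T))
    (h : ∀ ψ : E × E → ℂ, IsTest ψ → ∀ t ∈ Icc 0 T,
      Complex.I * (pair (a t) ψ - pair (a 0) ψ)
        + ∫ s in (0 : ℝ)..t, (pair (a s) (fun q => -lapX ψ q - σ * lapY ψ q) + pair (K s) ψ
            + pair (a s) (fun q => ((mf s q.1 + σ * mf s q.2 : ℝ) : ℂ) * ψ q))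
        = ∫ s in (0 : ℝ)..t, pair (G s) ψ) :
    IsSchrodinger T 1 σ a
      (fun s => G s - K s - mulL (V s) (a s) - (σ : ℂ) • mulR (V s) (a s)) := by
  have hVs : ∀ s, Measurable (V s) := fun s => hV.comp measurable_prodMk_left
  have hL := integrableOn_mulL hV hB hBi ha
  have hR := integrableOn_mulR hV hB hBi ha
  refine isSchrodinger_of_pair ha (((hG.sub hK).sub hL).sub (hR.smul (σ : ℂ))) fun f g q t ht => ?_
  have h0 := (isTest_tensorTest f g q).memLp
  have h1 := (isTest_tensorTest f.lap g q).memLp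
  have h2 := (isTest_tensorTest f g.lap q).memLp
  have hi : ∀ (ψ : E × E → ℂ) {b : ℝ → L2}, IntegrableOn b (Icc 0 T) →
      IntervalIntegrable (fun s => pairL ψ (b s)) volume 0 t := fun ψ b hb =>
    intervalIntegrable_of_integrableOn_Icc ((pairL ψ).integrable_comp hb) ht
  have h' := h _ (isTest_tensorTest f g q) t ht
  have hcongr : ∫ s in (0 : ℝ)..t, (pair (a s)
        (fun z => -lapX (tensorTest f g q) z - σ * lapY (tensorTest f g q) z)
        + pair (K s) (tensorTest f g q)
        + pair (a s) (fun z => ((mf s z.1 + σ * mf s z.2 : ℝ) : ℂ) * tensorTest f g q z))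
      = ∫ s in (0 : ℝ)..t, (-pairL (tensorTest f.lap g q) (a s)
          - σ * pairL (tensorTest f g.lap q) (a s) + pairL (tensorTest f g q) (K s)
        + (pairL (tensorTest f g q) (mulL (V s) (a s))
          + σ * pairL (tensorTest f g q) (mulR (V s) (a s)))) := by
    refine intervalIntegral.integral_congr_ae_restrict ?_
    rw [uIoc_of_le ht.1]
    have hsub : Ioc 0 t ⊆ Icc 0 T := fun s hs => ⟨hs.1.le, hs.2.trans ht.2⟩
    filter_upwards [ae_restrict_of_ae_restrict_of_subset hsub hmf] with s hs
    rw [pair_sub_lap, pair_add_mul (a s) (hVs s) (hB s) hs σ h0, pairL_apply h0, pairL_apply h0,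
      pairL_apply h0, pairL_apply h1, pairL_apply h2]
  rw [hcongr] at h'
  have ha' := ha.integrableOn_Icc (μ := volume)
  simp only [← pairL_apply h0, ← pairL_apply h1, ← pairL_apply h2] at h' ⊢
  rw [← eq_sub_iff_add_eq] at h'
  have hn : IntervalIntegrable (fun s => -pairL (tensorTest f.lap g q) (a s)) volume 0 t :=
    (hi _ ha').neg
  rw [h', ← intervalIntegral.integral_sub (hi _ hG)
    (((hn.sub ((hi _ ha').const_mul _)).add (hi _ hK)).add
      ((hi _ hL).add ((hi _ hR).const_mul _)))]
  refine intervalIntegral.integral_congr fun s _ => ?_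
  simp only [map_sub, map_smul, smul_eq_mul]
  ring

end

section

variable {v : E → ℝ} {φ : ℝ → E → ℂ} {T : ℝ} {a G : ℝ → L2} {V : ℝ → E → ℝ} {B : ℝ → ℝ}

theorem IsS.isSchrodinger (h : IsS v φ T a G) (hV : Measurable (Function.uncurry V))
    (hB : ∀ s x, |V s x| ≤ B s) (hBi : IntegrableOn B (Icc 0 T))
    (hmf : ∀ᵐ t ∂(volume.restrict (Icc 0 T)), ∀ᵐ x : E, meanField v φ t x = V t x)
    (ha : ContinuousOn a (Icc 0 T)) (hw : IntegrableOn (wKer v φ) (Icc 0 T))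
    (hG : IntegrableOn G (Icc 0 T)) :
    IsSchrodinger T 1 1 a (fun s => G s
      - (comp (wKer v φ s) (a s) + comp (a s) (transpose (wKer v φ s)))
      - mulL (V s) (a s) - ((1 : ℝ) : ℂ) • mulR (V s) (a s)) := by
  refine isSchrodinger_of_weak hV hB hBi hmf ha ((integrableOn_comp_left hw ha).add
    (integrableOn_comp_right ha (transposeₗᵢ.toContinuousLinearMap.integrable_comp hw))) hG ?_
  intro ψ hψ t ht
  simp only [Complex.ofReal_one, one_mul]
  exact h ψ hψ t ht

theorem IsW.isSchrodinger (h : IsW v φ T a G) (hV : Measurable (Function.uncurry V))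
    (hB : ∀ s x, |V s x| ≤ B s) (hBi : IntegrableOn B (Icc 0 T))
    (hmf : ∀ᵐ t ∂(volume.restrict (Icc 0 T)), ∀ᵐ x : E, meanField v φ t x = V t x)
    (ha : ContinuousOn a (Icc 0 T)) (hw : IntegrableOn (wKer v φ) (Icc 0 T))
    (hG : IntegrableOn G (Icc 0 T)) :
    IsSchrodinger T 1 (-1) a (fun s => G s
      - (comp (wKer v φ s) (a s) - comp (a s) (wKer v φ s))
      - mulL (V s) (a s) - ((-1 : ℝ) : ℂ) • mulR (V s) (a s)) := by
  refine isSchrodinger_of_weak hV hB hBi hmf ha ((integrableOn_comp_left hw ha).sub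
    (integrableOn_comp_right ha hw)) hG ?_
  intro ψ hψ t ht
  simp only [Complex.ofReal_neg, Complex.ofReal_one, neg_mul, one_mul, sub_neg_eq_add,
    ← sub_eq_add_neg]
  exact h ψ hψ t ht

end

end PairExcitation

end

noncomputable section

namespace PairExcitation

/-! ### A nonlinear Gronwall inequality -/

section Gronwall

variable {z M : ℝ → ℝ} {T c : ℝ}

open Filter Topology in
-- No derivative of `M` is available, so increments are compared. Dividing by `z t + z s` leaves a
-- factor that tends to `1 + z s` as `t ↓ s`; any `c > 1` leaves room for the error. The set of good
-- times is closed and extends to the right, hence is all of `[0, T]`.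
theorem log_one_add_le_of_sq_sub_le (hc : 1 < c) (hz : ContinuousOn z (Icc 0 T))
    (hz0 : ∀ t ∈ Icc 0 T, 0 < z t) (hM : ContinuousOn M (Icc 0 T))
    (h : ∀ s ∈ Icc 0 T, ∀ t ∈ Icc 0 T, s ≤ t →
      M s ≤ M t ∧ z t ^ 2 - z s ^ 2 ≤ 2 * (z t * (1 + z t)) * (M t - M s)) :
    ∀ t ∈ Icc 0 T, Real.log (1 + z t) - c * M t ≤ Real.log (1 + z 0) - c * M 0 := by
  have hlog : ContinuousOn (fun t => Real.log (1 + z t) - c * M t) (Icc 0 T) :=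
    ((continuousOn_const.add hz).log fun t ht => (add_pos one_pos (hz0 t ht)).ne').sub
      (continuousOn_const.mul hM)
  have hclosed : IsClosed ({t | Real.log (1 + z t) - c * M t ≤ Real.log (1 + z 0) - c * M 0}
      ∩ Icc 0 T) := by
    have := hlog.preimage_isClosed_of_isClosed isClosed_Icc
      (isClosed_Iic (a := Real.log (1 + z 0) - c * M 0))
    rwa [inter_comm] at this
  have h0 : (0 : ℝ) ∈ {t | Real.log (1 + z t) - c * M t ≤ Real.log (1 + z 0) - c * M 0} :=
    le_refl (Real.log (1 + z 0) - c * M 0)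
  refine fun t ht => hclosed.Icc_subset_of_forall_exists_gt h0 ?_ ht
  rintro s ⟨hs, hs'⟩ r hr
  have hsI : s ∈ Icc 0 T := Ico_subset_Icc_self hs'
  have hle : 𝓝[>] s ≤ 𝓝[Icc 0 T] s := nhdsWithin_le_of_mem (Icc_mem_nhdsGT_of_mem hs')
  have hzs := hz0 s hsI
  have hlim : Tendsto (fun t => 2 * (z t * (1 + z t)) / (z t + z s)) (𝓝[>] s)
      (𝓝 (2 * (z s * (1 + z s)) / (z s + z s))) := by
    have hzt : Tendsto z (𝓝[>] s) (𝓝 (z s)) := (hz s hsI).mono_left hle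
    exact ((hzt.mul (hzt.const_add 1)).const_mul 2).div (hzt.add_const _) (by positivity)
  have hlt : 2 * (z s * (1 + z s)) / (z s + z s) < c * (1 + z s) := by
    have : 2 * (z s * (1 + z s)) / (z s + z s) = 1 + z s := by field_simp; ring
    rw [this]
    nlinarith
  have hmem1 : ∀ᶠ t in 𝓝[>] s, t ∈ Ioc s r := Ioc_mem_nhdsGT (mem_Ioi.1 hr)
  have hmem2 : ∀ᶠ t in 𝓝[>] s, t ∈ Icc 0 T := Icc_mem_nhdsGT_of_mem hs'
  obtain ⟨t, ht1, ht2, ht3⟩ := ((hlim.eventually_lt_const hlt).and (hmem1.and hmem2)).exists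
  refine ⟨t, ?_, ht2⟩
  have hzt := hz0 t ht3
  obtain ⟨hMle, hsq⟩ := h s hsI t ht3 ht2.1.le
  have h1 : z t - z s ≤ c * (1 + z s) * (M t - M s) := by
    have h2 : (z t - z s) * (z t + z s)
        ≤ 2 * (z t * (1 + z t)) / (z t + z s) * (M t - M s) * (z t + z s) := by
      have : 2 * (z t * (1 + z t)) / (z t + z s) * (M t - M s) * (z t + z s)
          = 2 * (z t * (1 + z t)) * (M t - M s) := by field_simp
      rw [this]
      linarith
    refine (le_of_mul_le_mul_right h2 (by positivity)).trans ?_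
    exact mul_le_mul_of_nonneg_right ht1.le (sub_nonneg.2 hMle)
  have h2 : Real.log (1 + z t) - Real.log (1 + z s) ≤ c * (M t - M s) := by
    rw [← Real.log_div (by positivity) (by positivity)]
    refine (Real.log_le_sub_one_of_pos (by positivity)).trans ?_
    rw [div_sub_one (by positivity), div_le_iff₀ (by positivity)]
    linarith
  have hs2 : Real.log (1 + z s) - c * M s ≤ Real.log (1 + z 0) - c * M 0 := hs
  show Real.log (1 + z t) - c * M t ≤ Real.log (1 + z 0) - c * M 0
  linarith

variable {y μ : ℝ → ℝ}

/-- `y` is replaced by the square root `z` of the right-hand side, which is nondecreasing and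
dominates `y`; hence `y (1 + y)` on `[s, t]` is at most its value with `z t`. -/
theorem one_add_le_mul_exp_of_sq_le (hT : 0 ≤ T) (hy : ContinuousOn y (Icc 0 T))
    (hy0 : ∀ t, 0 ≤ y t) (hμ0 : ∀ t, 0 ≤ μ t) (hμ : IntegrableOn μ (Icc 0 T))
    (h : ∀ t ∈ Icc 0 T, y t ^ 2 - y 0 ^ 2 ≤ ∫ s in (0 : ℝ)..t, 2 * (y s * (1 + y s)) * μ s) :
    1 + y T ≤ (1 + y 0) * Real.exp (∫ s in (0 : ℝ)..T, μ s) := by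
  have hr : IntegrableOn (fun s => 2 * (y s * (1 + y s)) * μ s) (Icc 0 T) :=
    IntegrableOn.continuousOn_mul (continuousOn_const.mul (hy.mul (continuousOn_const.add hy))) hμ
      isCompact_Icc
  have hTT : T ∈ Icc 0 T := ⟨hT, le_rfl⟩
  have h00 : (0 : ℝ) ∈ Icc 0 T := ⟨le_rfl, hT⟩
  have hsplit : ∀ {r : ℝ → ℝ}, IntegrableOn r (Icc 0 T) → ∀ s ∈ Icc 0 T, ∀ t ∈ Icc 0 T,
      IntervalIntegrable r volume s t ∧
      (∫ x in (0 : ℝ)..t, r x) - ∫ x in (0 : ℝ)..s, r x = ∫ x in s..t, r x := by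
    intro r hr s hs t ht
    have h1 := intervalIntegrable_of_integrableOn_Icc hr hs
    have h2 := intervalIntegrable_of_integrableOn_Icc hr ht
    exact ⟨h1.symm.trans h2, intervalIntegral.integral_interval_sub_left h2 h1⟩
  have hcont : ∀ {r : ℝ → ℝ}, IntegrableOn r (Icc 0 T) →
      ContinuousOn (fun t => ∫ x in (0 : ℝ)..t, r x) (Icc 0 T) := fun hr => by
    have := intervalIntegral.continuousOn_primitive_interval (μ := volume) (a := 0) (b := T)
      (by rwa [uIcc_of_le hT])
    rwa [uIcc_of_le hT] at this
  have main : ∀ ε > 0, 1 + y T ≤ (1 + (y 0 + ε)) * Real.exp ((1 + ε) * ∫ s in (0 : ℝ)..T, μ s) := by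
    intro ε hε
    let R : ℝ → ℝ := fun t => ∫ s in (0 : ℝ)..t, 2 * (y s * (1 + y s)) * μ s
    -- The term `ε²` keeps `z` positive even if `y 0 = 0`. The same `ε` supplies the constant `c = 1
    -- + ε`, and tends to `0` at the end.
    let z : ℝ → ℝ := fun t => Real.sqrt ((y 0 ^ 2 + ε ^ 2) + R t)
    have hRmono : ∀ s ∈ Icc 0 T, ∀ t ∈ Icc 0 T, s ≤ t → R s ≤ R t := fun s hs t ht hst => by
      rw [← sub_nonneg]
      refine ((hsplit hr s hs t ht).2).symm ▸ intervalIntegral.integral_nonneg hst fun x _ => ?_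
      have := hy0 x
      have := hμ0 x
      positivity
    have hR0 : R 0 = 0 := intervalIntegral.integral_same
    have hRnn : ∀ t ∈ Icc 0 T, 0 ≤ R t := fun t ht => hR0 ▸ hRmono 0 h00 t ht ht.1
    have hzsq : ∀ t ∈ Icc 0 T, z t ^ 2 = (y 0 ^ 2 + ε ^ 2) + R t := fun t ht =>
      Real.sq_sqrt (by have := hRnn t ht; positivity)
    have hzpos : ∀ t ∈ Icc 0 T, 0 < z t := fun t ht =>
      Real.sqrt_pos.2 (by have := hRnn t ht; positivity)
    have hzc : ContinuousOn z (Icc 0 T) := (continuousOn_const.add (hcont hr)).sqrt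
    have hyz : ∀ t ∈ Icc 0 T, y t ≤ z t := fun t ht => by
      refine Real.le_sqrt_of_sq_le ?_
      have := h t ht
      have : 0 ≤ ε ^ 2 := by positivity
      show y t ^ 2 ≤ (y 0 ^ 2 + ε ^ 2) + ∫ s in (0 : ℝ)..t, 2 * (y s * (1 + y s)) * μ s
      linarith
    have hzmono : ∀ s ∈ Icc 0 T, ∀ t ∈ Icc 0 T, s ≤ t → z s ≤ z t := fun s hs t ht hst =>
      Real.sqrt_le_sqrt (by have := hRmono s hs t ht hst; linarith)
    have key := log_one_add_le_of_sq_sub_le (c := 1 + ε) (by linarith) hzc hzpos (hcont hμ) (by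
      intro s hs t ht hst
      have hμs := hsplit hμ s hs t ht
      have hrs := hsplit hr s hs t ht
      refine ⟨?_, ?_⟩
      · rw [← sub_nonneg, hμs.2]
        exact intervalIntegral.integral_nonneg hst fun x _ => hμ0 x
      · have hd : z t ^ 2 - z s ^ 2 = ∫ x in s..t, 2 * (y x * (1 + y x)) * μ x := by
          rw [hzsq t ht, hzsq s hs, ← hrs.2]
          ring
        rw [hd, hμs.2, ← intervalIntegral.integral_const_mul]
        refine intervalIntegral.integral_mono_on hst hrs.1 (hμs.1.const_mul _) fun x hx => ?_
        have hxI : x ∈ Icc 0 T := ⟨hs.1.trans hx.1, hx.2.trans ht.2⟩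
        have h1 := (hyz x hxI).trans (hzmono x hxI t ht hx.2)
        have h2 := hy0 x
        have h3 := hμ0 x
        gcongr) T hTT
    have hz0 : z 0 ≤ y 0 + ε := by
      refine Real.sqrt_le_iff.2 ⟨by have := hy0 0; positivity, ?_⟩
      rw [hR0]
      nlinarith [hy0 0]
    rw [intervalIntegral.integral_same, mul_zero, sub_zero, sub_le_iff_le_add] at key
    have hzT := hzpos T hTT
    have hz00 := hzpos 0 h00
    calc 1 + y T ≤ 1 + z T := by linarith [hyz T hTT]
      _ = Real.exp (Real.log (1 + z T)) := (Real.exp_log (by positivity)).symm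
      _ ≤ Real.exp (Real.log (1 + z 0) + (1 + ε) * ∫ s in (0 : ℝ)..T, μ s) := Real.exp_le_exp.2 key
      _ = (1 + z 0) * Real.exp ((1 + ε) * ∫ s in (0 : ℝ)..T, μ s) := by
        rw [Real.exp_add, Real.exp_log (by positivity)]
      _ ≤ (1 + (y 0 + ε)) * Real.exp ((1 + ε) * ∫ s in (0 : ℝ)..T, μ s) := by gcongr
  have hlim : Filter.Tendsto
      (fun ε : ℝ => (1 + (y 0 + ε)) * Real.exp ((1 + ε) * ∫ s in (0 : ℝ)..T, μ s))
      (nhdsWithin 0 (Ioi 0)) (nhds ((1 + (y 0 + 0)) * Real.exp ((1 + 0) * ∫ s in (0 : ℝ)..T, μ s))) :=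
    (Continuous.tendsto (by fun_prop) 0).mono_left nhdsWithin_le_nhds
  have := ge_of_tendsto hlim (eventually_mem_nhdsWithin.mono fun ε hε => main ε hε)
  simpa using this

end Gronwall

end PairExcitation

end

noncomputable section

namespace PairExcitation

/-! ### The algebra of the coefficients -/

section Ring

variable {R : Type*} [Ring R]

/-- The terms in `w` and `M` act as commutators on `2p + p p` and on `u u'`: the middle terms `u w'
u'` and `u M u'` cancel. By `hN` the two sets of commutators agree, so they disappear from the
identity. -/
theorem commutator_identity_of_square {F G G' p u u' w w' M P Q Q' : R} (hN : p + p + p * p = u * u')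
    (hP : P = F - (w * p - p * w) - M * p + p * M)
    (hQ : Q = G - (w * u + u * w') - M * u - u * M)
    (hQ' : Q' = G' - (u' * w + w' * u') - u' * M - M * u')
    (h : P + P + (P * p + p * P) = Q * u' + u * -Q') :
    F * (1 + p) + (1 + p) * F = G * u' - u * G' := by
  have h1 : w * (p + p + p * p) = w * (u * u') := by rw [hN]
  have h2 : (p + p + p * p) * w = u * u' * w := by rw [hN]
  have h3 : M * (p + p + p * p) = M * (u * u') := by rw [hN]
  have h4 : (p + p + p * p) * M = u * u' * M := by rw [hN]
  have e1 : P + P + (P * p + p * P) = (F * (1 + p) + (1 + p) * F) - w * (p + p + p * p)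
      + (p + p + p * p) * w - M * (p + p + p * p) + (p + p + p * p) * M := by
    rw [hP]; noncomm_ring
  have e2 : Q * u' + u * -Q' = (G * u' - u * G') - w * (u * u') + u * u' * w - M * (u * u')
      + u * u' * M := by
    rw [hQ, hQ']; noncomm_ring
  rw [e1, e2, h1, h2, h3, h4] at h
  simpa only [add_left_inj, sub_left_inj] using h

variable [StarRing R]

/-- With `A = (F + u m*) d` one has `F = A c - u m*`, and skewness of `F` reads `c A* = -A c + u m*
+ m u*`. Substituting this, `G = c m + A u` and `u u* = c² - 1` into `hFG` leaves exactly `A* - A =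
0`. -/
theorem star_eq_self_of_commutator {F G m u c d : R} (hc : star c = c) (hdc : d * c = 1)
    (hcc : c * c = 1 + u * star u) (hF : star F = -F)
    (hFG : F * c + c * F = G * star u - u * star G)
    (hG : G = c * m + (F + u * star m) * d * u) :
    star ((F + u * star m) * d) = (F + u * star m) * d := by
  have hAc : (F + u * star m) * d * c = F + u * star m := by rw [mul_assoc, hdc, mul_one]
  generalize (F + u * star m) * d = A at *
  have hF1 : F = A * c - u * star m := by rw [hAc, add_sub_cancel_right]
  have huu : u * star u = c * c - 1 := by rw [hcc, add_sub_cancel_left]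
  have hE : c * star A = -(A * c) + u * star m + m * star u := by
    have h := hF
    rw [hF1, star_sub, star_mul, star_mul, star_star, hc] at h
    rw [sub_eq_iff_eq_add] at h
    rw [h]
    abel
  have hGs : star G = star m * c + star u * star A := by
    rw [hG, star_add, star_mul, star_mul, hc]
  have e1 : G * star u - u * star G = c * (m * star u) + A * (c * c - 1) - u * star m * c
      - (c * c - 1) * star A := by
    rw [hGs, hG, ← huu]; noncomm_ring
  have e2 : F * c + c * F = A * (c * c) - u * star m * c + c * (A * c) - c * (u * star m) := by
    rw [hF1]; noncomm_ring
  have e3 : c * (c * star A) = -(c * (A * c)) + c * (u * star m) + c * (m * star u) := by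
    rw [hE]; noncomm_ring
  rw [e1, e2] at hFG
  have e4 : (c * c - 1) * star A = c * (c * star A) - star A := by noncomm_ring
  rw [e4, e3, mul_sub, mul_one] at hFG
  have e5 : star A - A = 0 := by
    have := sub_eq_zero.2 hFG
    rw [← neg_eq_zero, ← this]
    abel
  exact sub_eq_zero.1 e5

end Ring

/-! ### Identities at a fixed time -/

section FixedTime

set_option maxHeartbeats 1000000

variable {V : E → ℝ} {C : ℝ}

theorem compLeft_sub (a b : L2) : compLeft (a - b) = compLeft a - compLeft b := compL.map_sub a b

theorem compLeft_neg (a : L2) : compLeft (-a) = -compLeft a := compL.map_neg a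

theorem star_compLeft (a : L2) : star (compLeft a) = compLeft (adj a) := by
  rw [ContinuousLinearMap.star_eq_adjoint, adjoint_compLeft]

theorem one_add_compLeft_apply (a b : L2) : (1 + compLeft a) b = b + comp a b := rfl

theorem compLeft_mul_apply (a b : L2) (A : L2 →L[ℂ] L2) : (compLeft a * A) b = comp a (A b) := rfl

attribute [local irreducible] comp adj compLeft

theorem adj_transpose_of_adj_eq {w : L2} (hw : adj w = w) : adj (transpose w) = transpose w := by
  have h : transpose w = star w := by
    rw [← star_star (transpose w)]
    exact congrArg star (by rwa [adj] at hw)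
  rw [adj, transpose_transpose, h]

theorem mulL_smul (hV : Measurable V) (hC : ∀ x, |V x| ≤ C) (r : ℂ) (a : L2) :
    mulL V (r • a) = r • mulL V a := by
  apply Lp.ext
  filter_upwards [coeFn_mulL hV hC (r • a), coeFn_mulL hV hC a, Lp.coeFn_smul r a,
    Lp.coeFn_smul r (mulL V a)] with q h1 h2 h3 h4
  rw [h1, h4, Pi.smul_apply, h2, h3, Pi.smul_apply, smul_eq_mul, smul_eq_mul]
  ring

/-- Multiplication by `V(x)` as a bounded operator. -/
def mulLCLM (hV : Measurable V) (hC : ∀ x, |V x| ≤ C) : L2 →L[ℂ] L2 :=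
  LinearMap.mkContinuous
    { toFun := mulL V
      map_add' := mulL_add hV hC
      map_smul' := mulL_smul hV hC }
    C (norm_mulL_le hV hC)

theorem mulLCLM_apply (hV : Measurable V) (hC : ∀ x, |V x| ≤ C) (a : L2) :
    mulLCLM hV hC a = mulL V a := rfl

theorem compLeft_mulL (hV : Measurable V) (hC : ∀ x, |V x| ≤ C) (a : L2) :
    compLeft (mulL V a) = mulLCLM hV hC * compLeft a := by
  ext1 b
  rw [mul_apply_eq_comp, compLeft_apply, compLeft_apply, mulLCLM_apply,
    comp_mulL_left hV hC]

theorem compLeft_mulR (hV : Measurable V) (hC : ∀ x, |V x| ≤ C) (a : L2) :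
    compLeft (mulR V a) = compLeft a * mulLCLM hV hC := by
  ext1 b
  rw [mul_apply_eq_comp, compLeft_apply, compLeft_apply, mulLCLM_apply,
    comp_mulR_left hV hC]

/-- The source term of the mollified equation for `u`. -/
def sourceS (V : E → ℝ) (w u G : L2) : L2 :=
  G - (comp w u + comp u (transpose w)) - mulL V u - ((1 : ℝ) : ℂ) • mulR V u

/-- The source term of the mollified equation for `p`. -/
def sourceW (V : E → ℝ) (w p F : L2) : L2 :=
  F - (comp w p - comp p w) - mulL V p - ((-1 : ℝ) : ℂ) • mulR V p

theorem sourceS_eq (V : E → ℝ) (w u G : L2) :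
    sourceS V w u G = G - (comp w u + comp u (transpose w)) - mulL V u - mulR V u := by
  rw [sourceS, Complex.ofReal_one, one_smul]

theorem sourceW_eq (V : E → ℝ) (w u G : L2) :
    sourceW V w u G = G - (comp w u - comp u w) - mulL V u + mulR V u := by
  rw [sourceW, Complex.ofReal_neg, Complex.ofReal_one, neg_smul, one_smul, sub_neg_eq_add]

theorem adj_sourceS (hV : Measurable V) (hC : ∀ x, |V x| ≤ C) {w : L2} (hw : adj w = w) (u G : L2) :
    adj (sourceS V w u G) = adj G - (comp (adj u) w + comp (transpose w) (adj u))
      - mulR V (adj u) - mulL V (adj u) := by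
  rw [sourceS_eq, adj_sub, adj_sub, adj_sub, adj_add, adj_comp, adj_comp, adj_mulL hV hC,
    adj_mulR hV hC, hw, adj_transpose_of_adj_eq hw]

/-- The `w` and `V` parts of the source are commutators of self-adjoint objects, hence already
skew-adjoint; they cancel and leave the statement for `F`. -/
theorem adj_eq_neg_of_sourceW (hV : Measurable V) (hC : ∀ x, |V x| ≤ C) {w p F : L2}
    (hw : adj w = w) (hp : adj p = p) (h : sourceW V w p F = -adj (sourceW V w p F)) :
    adj F = -F := by
  rw [sourceW_eq, adj_add, adj_sub, adj_sub, adj_sub, adj_comp, adj_comp, adj_mulL hV hC,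
    adj_mulR hV hC, hw, hp] at h
  generalize mulL V p = x₁ at h
  generalize mulR V p = x₂ at h
  generalize comp w p = x₃ at h
  generalize comp p w = x₄ at h
  generalize adj F = F' at h ⊢
  have h' := sub_eq_zero.2 h
  rw [eq_neg_iff_add_eq_zero, ← h']
  abel

theorem compLeft_sourceW (hV : Measurable V) (hC : ∀ x, |V x| ≤ C) (w p F : L2) :
    compLeft (sourceW V w p F) = compLeft F - (compLeft w * compLeft p - compLeft p * compLeft w)
      - mulLCLM hV hC * compLeft p + compLeft p * mulLCLM hV hC := by
  rw [sourceW_eq]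
  exact (compLeft_add _ _).trans (congrArg₂ (· + ·) ((compLeft_sub _ _).trans
    (congrArg₂ (· - ·) ((compLeft_sub _ _).trans (congrArg₂ (· - ·) rfl ((compLeft_sub _ _).trans
      (congrArg₂ (· - ·) (compLeft_comp w p) (compLeft_comp p w)))))
      (compLeft_mulL hV hC p))) (compLeft_mulR hV hC p))

theorem compLeft_sourceS (hV : Measurable V) (hC : ∀ x, |V x| ≤ C) (w u G : L2) :
    compLeft (sourceS V w u G)
      = compLeft G - (compLeft w * compLeft u + compLeft u * compLeft (transpose w))
        - mulLCLM hV hC * compLeft u - compLeft u * mulLCLM hV hC := by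
  rw [sourceS_eq]
  exact (compLeft_sub _ _).trans (congrArg₂ (· - ·) ((compLeft_sub _ _).trans
    (congrArg₂ (· - ·) ((compLeft_sub _ _).trans (congrArg₂ (· - ·) rfl ((compLeft_add _ _).trans
      (congrArg₂ (· + ·) (compLeft_comp w u) (compLeft_comp u _)))))
      (compLeft_mulL hV hC u))) (compLeft_mulR hV hC u))

theorem compLeft_adj_sourceS (hV : Measurable V) (hC : ∀ x, |V x| ≤ C) {w : L2} (hw : adj w = w)
    (u G : L2) : compLeft (adj (sourceS V w u G)) = compLeft (adj G)
      - (compLeft (adj u) * compLeft w + compLeft (transpose w) * compLeft (adj u))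
      - compLeft (adj u) * mulLCLM hV hC - mulLCLM hV hC * compLeft (adj u) := by
  rw [adj_sourceS hV hC hw]
  exact (compLeft_sub _ _).trans (congrArg₂ (· - ·) ((compLeft_sub _ _).trans
    (congrArg₂ (· - ·) ((compLeft_sub _ _).trans (congrArg₂ (· - ·) rfl ((compLeft_add _ _).trans
      (congrArg₂ (· + ·) (compLeft_comp _ w) (compLeft_comp _ _)))))
      (compLeft_mulR hV hC _))) (compLeft_mulL hV hC _))

theorem compLeft_commutator_identity (hV : Measurable V) (hC : ∀ x, |V x| ≤ C) {w p u F G : L2}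
    (hw : adj w = w) (hN : p + p + comp p p = comp u (adj u))
    (h : sourceW V w p F + sourceW V w p F
        + (comp (sourceW V w p F) p + comp p (sourceW V w p F))
      = comp (sourceS V w u G) (adj u) + comp u (-adj (sourceS V w u G))) :
    compLeft F * (1 + compLeft p) + (1 + compLeft p) * compLeft F
      = compLeft G * compLeft (adj u) - compLeft u * compLeft (adj G) := by
  refine commutator_identity_of_square (M := mulLCLM hV hC) (w := compLeft w)
    (w' := compLeft (transpose w)) ?_ (compLeft_sourceW hV hC w p F) (compLeft_sourceS hV hC w u G)
    (compLeft_adj_sourceS hV hC hw u G) ?_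
  · rw [← compLeft_comp u, ← hN, compLeft_add, compLeft_add, compLeft_comp]
  · have h' := congrArg compLeft h
    rw [compLeft_add, compLeft_add, compLeft_add, compLeft_add, compLeft_comp, compLeft_comp,
      compLeft_comp, compLeft_comp, compLeft_neg] at h'
    exact h'

theorem im_inner_eq_zero_of_adjoint {A : L2 →L[ℂ] L2} (hA : star A = A) (u : L2) :
    (inner ℂ u (A u)).im = 0 := by
  rw [ContinuousLinearMap.star_eq_adjoint] at hA
  rw [← Complex.conj_eq_iff_im, inner_conj_symm, ← ContinuousLinearMap.adjoint_inner_right, hA]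

theorem chSubOne_add_self {k : L2} (hk : transpose k = k) :
    chSubOne k + chSubOne k + comp (chSubOne k) (chSubOne k) = comp (sh k) (adj (sh k)) := by
  rw [← two_chSubOne_add hk, two_smul]

theorem one_add_compLeft_sq {k : L2} (hk : transpose k = k) :
    (1 + compLeft (chSubOne k)) * (1 + compLeft (chSubOne k))
      = 1 + compLeft (sh k) * star (compLeft (sh k)) := by
  rw [star_compLeft, ← compLeft_comp, ← chSubOne_add_self hk, compLeft_add, compLeft_add,
    compLeft_comp]
  noncomm_ring

theorem star_one_add_compLeft {k : L2} (hk : transpose k = k) :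
    star (1 + compLeft (chSubOne k)) = 1 + compLeft (chSubOne k) := by
  rw [star_add, star_one, star_compLeft, adj_chSubOne hk]

/-- `b = invOneAdd p u` solves `b + p b = u`. Passing to operators and cancelling the invertible
factor `1 + p` gives the claim. -/
theorem compLeft_invOneAdd {k : L2} (hk : transpose k = k) (u : L2) :
    compLeft (invOneAdd (chSubOne k) u)
      = Ring.inverse (1 + compLeft (chSubOne k)) * compLeft u := by
  have hc := isUnit_one_add_compLeft_chSubOne hk
  have h1 : invOneAdd (chSubOne k) u + comp (chSubOne k) (invOneAdd (chSubOne k) u) = u := by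
    rw [← one_add_compLeft_apply, invOneAdd, ← mul_apply_eq_comp, Ring.mul_inverse_cancel _ hc]
    rfl
  have h2 : (1 + compLeft (chSubOne k)) * compLeft (invOneAdd (chSubOne k) u) = compLeft u := by
    rw [add_mul, one_mul, ← compLeft_comp, ← compLeft_add, h1]
  rw [← h2, ← mul_assoc, Ring.inverse_mul_cancel _ hc, one_mul]

/-- The equation is `G = (1 + p) m + A u` with `A` self-adjoint, so `⟨u, A u⟩` is real. -/
theorem im_inner_sh_eq {k F G m : L2} (hk : transpose k = k) (hm : adj m = star m) (hF : adj F = -F)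
    (hFG : compLeft F * (1 + compLeft (chSubOne k)) + (1 + compLeft (chSubOne k)) * compLeft F
      = compLeft G * compLeft (adj (sh k)) - compLeft (sh k) * compLeft (adj G))
    (hG : G - (m + comp (chSubOne k) m)
      = comp (F + comp (sh k) (star m)) (invOneAdd (chSubOne k) (sh k))) :
    (inner ℂ (sh k) G).im = (inner ℂ (sh k) (m + comp (chSubOne k) m)).im := by
  have hc := isUnit_one_add_compLeft_chSubOne hk
  rw [sub_eq_iff_eq_add'] at hG
  have hX : compLeft (F + comp (sh k) (star m))
      = compLeft F + compLeft (sh k) * star (compLeft m) := by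
    rw [compLeft_add, compLeft_comp, star_compLeft, hm]
  have hA : star ((compLeft F + compLeft (sh k) * star (compLeft m))
        * Ring.inverse (1 + compLeft (chSubOne k)))
      = (compLeft F + compLeft (sh k) * star (compLeft m))
        * Ring.inverse (1 + compLeft (chSubOne k)) := by
    refine star_eq_self_of_commutator (G := compLeft G) (c := 1 + compLeft (chSubOne k))
      (star_one_add_compLeft hk) (Ring.inverse_mul_cancel _ hc) (one_add_compLeft_sq hk) ?_ ?_ ?_
    · rw [star_compLeft, hF, compLeft_neg]
    · rw [hFG, star_compLeft, star_compLeft]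
    · rw [← hX, mul_assoc, ← compLeft_invOneAdd hk, add_mul, one_mul, ← compLeft_comp,
        ← compLeft_comp, ← compLeft_add, ← compLeft_add, ← hG]
  have hu := im_inner_eq_zero_of_adjoint hA (sh k)
  rw [← hX, compLeft_mul_apply] at hu
  have hG' : inner ℂ (sh k) G = inner ℂ (sh k) (m + comp (chSubOne k) m)
      + inner ℂ (sh k) (comp (F + comp (sh k) (star m)) (invOneAdd (chSubOne k) (sh k))) := by
    rw [← inner_add_right, ← hG]
  rw [hG', Complex.add_im]
  exact add_eq_left.2 hu

/-- From `(1 + p)² = 1 + u u*` one gets `‖(1 + p) m‖² = ‖m‖² + ‖u* m‖²`, and `1 + ‖u‖² ≤ (1 +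
‖u‖)²`. -/
theorem norm_add_comp_chSubOne_le {k : L2} (hk : transpose k = k) (m : L2) :
    ‖m + comp (chSubOne k) m‖ ≤ (1 + ‖sh k‖) * ‖m‖ := by
  have h1 : m + comp (chSubOne k) m = (1 + compLeft (chSubOne k)) m :=
    (one_add_compLeft_apply _ _).symm
  have h2 : inner ℂ (m + comp (chSubOne k) m) (m + comp (chSubOne k) m)
      = inner ℂ m m + inner ℂ (comp (adj (sh k)) m) (comp (adj (sh k)) m) := by
    rw [h1, ← ContinuousLinearMap.adjoint_inner_right, ← ContinuousLinearMap.star_eq_adjoint,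
      star_one_add_compLeft hk, ← mul_apply_eq_comp, one_add_compLeft_sq hk,
      star_compLeft, ← compLeft_comp, inner_comp_left, adj_adj, ← comp_assoc, ← inner_add_right,
      one_add_compLeft_apply]
  have h3 : ‖m + comp (chSubOne k) m‖ ^ 2 = ‖m‖ ^ 2 + ‖comp (adj (sh k)) m‖ ^ 2 := by
    rw [inner_self_eq_norm_sq_to_K, inner_self_eq_norm_sq_to_K, inner_self_eq_norm_sq_to_K] at h2
    exact_mod_cast h2
  have h4 : ‖comp (adj (sh k)) m‖ ≤ ‖sh k‖ * ‖m‖ := by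
    rw [← norm_adj (sh k)]
    exact norm_comp_le _ _
  have h5 := norm_nonneg (sh k)
  have h6 := norm_nonneg m
  refine abs_le_of_sq_le_sq' ?_ (by positivity) |>.2
  rw [h3]
  nlinarith [norm_nonneg (comp (adj (sh k)) m), pow_le_pow_left₀ (norm_nonneg _) h4 2,
    mul_nonneg h5 (mul_nonneg h6 h6)]

theorem im_inner_sourceS (hV : Measurable V) (hC : ∀ x, |V x| ≤ C) {w : L2} (hw : adj w = w)
    (u G : L2) : (inner ℂ u (sourceS V w u G)).im = (inner ℂ u G).im := by
  have h1 : (inner ℂ u (comp w u)).im = 0 := by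
    rw [← Complex.conj_eq_iff_im, inner_conj_symm, inner_comp_left, hw]
  have h2 : (inner ℂ u (comp u (transpose w))).im = 0 := by
    rw [← Complex.conj_eq_iff_im, inner_conj_symm, inner_comp_right, adj_transpose_of_adj_eq hw]
  have h3 : (inner ℂ u (mulL V u)).im = 0 := by
    rw [← Complex.conj_eq_iff_im, inner_conj_symm, inner_mulL_left hV hC]
  have h4 : (inner ℂ u (mulR V u)).im = 0 := by
    rw [← Complex.conj_eq_iff_im, inner_conj_symm, inner_mulR_left hV hC]
  rw [sourceS_eq, inner_sub_right, inner_sub_right, inner_sub_right, inner_add_right,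
    Complex.sub_im, Complex.sub_im, Complex.sub_im, Complex.add_im, h1, h2, h3, h4]
  ring

theorem im_inner_sourceS_le (hV : Measurable V) (hC : ∀ x, |V x| ≤ C) {k w F G m : L2}
    (hk : transpose k = k) (hm : adj m = star m) (hw : adj w = w)
    (hW : sourceW V w (chSubOne k) F = -adj (sourceW V w (chSubOne k) F))
    (hWS : sourceW V w (chSubOne k) F + sourceW V w (chSubOne k) F
        + (comp (sourceW V w (chSubOne k) F) (chSubOne k)
          + comp (chSubOne k) (sourceW V w (chSubOne k) F))
      = comp (sourceS V w (sh k) G) (adj (sh k)) + comp (sh k) (-adj (sourceS V w (sh k) G)))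
    (hG : G - (m + comp (chSubOne k) m)
      = comp (F + comp (sh k) (star m)) (invOneAdd (chSubOne k) (sh k))) :
    (inner ℂ (sh k) (sourceS V w (sh k) G)).im ≤ ‖sh k‖ * (1 + ‖sh k‖) * ‖m‖ := by
  rw [im_inner_sourceS hV hC hw, im_inner_sh_eq hk hm
    (adj_eq_neg_of_sourceW hV hC hw (adj_chSubOne hk) hW)
    (compLeft_commutator_identity hV hC hw (chSubOne_add_self hk) hWS) hG, mul_assoc]
  refine (Complex.im_le_norm _).trans ((norm_inner_le_norm _ _).trans ?_)
  exact mul_le_mul_of_nonneg_left (norm_add_comp_chSubOne_le hk m) (norm_nonneg _)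

end FixedTime

end PairExcitation

end

noncomputable section

namespace PairExcitation

/-! ### The energy inequality -/

section Energy

set_option maxHeartbeats 1000000

attribute [local irreducible] comp adj sourceS sourceW

variable {v : E → ℝ} {φ : ℝ → E → ℂ} {T : ℝ} {k : ℝ → L2} {V : ℝ → E → ℝ} {F G : ℝ → L2}

theorem ae_im_inner_sourceS_le (hv_even : ∀ x, v (-x) = v x) (hV : ∀ s, Measurable (V s))
    {B : ℝ → ℝ} (hB : ∀ s x, |V s x| ≤ B s) (hk : ∀ t ∈ Icc 0 T, transpose (k t) = k t)
    (hp : IsSchrodinger T 1 (-1) (fun t => chSubOne (k t))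
      fun t => sourceW (V t) (wKer v φ t) (chSubOne (k t)) (F t))
    (hu : IsSchrodinger T 1 1 (fun t => sh (k t))
      fun t => sourceS (V t) (wKer v φ t) (sh (k t)) (G t))
    (heq : ∀ᵐ t ∂(volume.restrict (Icc 0 T)),
      G t - (mKer v φ t + comp (chSubOne (k t)) (mKer v φ t))
        = comp (F t + comp (sh (k t)) (star (mKer v φ t)))
            (invOneAdd (chSubOne (k t)) (sh (k t)))) :
    ∀ᵐ t ∂(volume.restrict (Icc 0 T)),
      (inner ℂ (sh (k t)) (sourceS (V t) (wKer v φ t) (sh (k t)) (G t))).im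
        ≤ ‖sh (k t)‖ * (1 + ‖sh (k t)‖) * ‖mKer v φ t‖ := by
  -- The second factor of a product must carry the opposite of the first factor's inner coefficient,
  -- here `-(-1) = 1`.
  have hp' : IsSchrodinger T (- -1) (-1) (fun t => chSubOne (k t))
      fun t => sourceW (V t) (wKer v φ t) (chSubOne (k t)) (F t) := by
    rwa [neg_neg]
  have hpadj := hp'.adjoint
  rw [neg_neg] at hpadj
  have h1 := hp.ae_eq hpadj fun t ht => (adj_chSubOne (hk t ht)).symm
  -- Both `2p + p p` and `u u*` solve an equation with coefficients `(1, -1)`. They are the same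
  -- kernel, so their sources agree almost everywhere.
  have h2 := ((hp.add hp).add (hp.comp hp')).ae_eq (hu.comp hu.adjoint)
    fun t ht => chSubOne_add_self (hk t ht)
  filter_upwards [h1, h2, heq, ae_restrict_mem measurableSet_Icc] with t h1 h2 h3 ht
  exact im_inner_sourceS_le (hV t) (hB t) (hk t ht) (adj_mKer hv_even t) (adj_wKer hv_even t)
    h1 h2 h3

theorem sq_norm_sub_le (hm : IntegrableOn (mKer v φ) (Icc 0 T))
    (hu : IsSchrodinger T 1 1 (fun t => sh (k t))
      fun t => sourceS (V t) (wKer v φ t) (sh (k t)) (G t))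
    (hle : ∀ᵐ t ∂(volume.restrict (Icc 0 T)),
      (inner ℂ (sh (k t)) (sourceS (V t) (wKer v φ t) (sh (k t)) (G t))).im
        ≤ ‖sh (k t)‖ * (1 + ‖sh (k t)‖) * ‖mKer v φ t‖) {t : ℝ} (ht : t ∈ Icc 0 T) :
    ‖sh (k t)‖ ^ 2 - ‖sh (k 0)‖ ^ 2
      ≤ ∫ s in (0 : ℝ)..t, 2 * (‖sh (k s)‖ * (1 + ‖sh (k s)‖)) * ‖mKer v φ s‖ := by
  rw [hu.energy ht]
  have hum := hu.cont.aestronglyMeasurable (μ := volume) measurableSet_Icc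
  have hi : IntegrableOn (fun s => 2 * (inner ℂ (sh (k s))
      (sourceS (V s) (wKer v φ s) (sh (k s)) (G s))).im) (Icc 0 T) := by
    refine Integrable.const_mul (Integrable.mono' (integrableOn_norm_mul_norm hu.int hu.cont)
      (Complex.continuous_im.comp_aestronglyMeasurable (hum.inner hu.int.1)) ?_) 2
    refine Filter.Eventually.of_forall fun s => ?_
    rw [mul_comm]
    exact (Complex.abs_im_le_norm _).trans (norm_inner_le_norm _ _)
  have hi' : IntegrableOn (fun s => 2 * (‖sh (k s)‖ * (1 + ‖sh (k s)‖)) * ‖mKer v φ s‖)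
      (Icc 0 T) :=
    IntegrableOn.continuousOn_mul (continuousOn_const.mul
      (hu.cont.norm.mul (continuousOn_const.add hu.cont.norm))) hm.norm isCompact_Icc
  have hsub : Icc 0 t ⊆ Icc 0 T := Icc_subset_Icc_right ht.2
  refine intervalIntegral.integral_mono_ae_restrict ht.1
    (intervalIntegrable_of_integrableOn_Icc hi ht) (intervalIntegrable_of_integrableOn_Icc hi' ht) ?_
  filter_upwards [ae_restrict_of_ae_restrict_of_subset hsub hle] with s hs
  rw [mul_assoc]
  exact mul_le_mul_of_nonneg_left hs two_pos.le

end Energy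

/-- `e^M - 1 ≤ M e^M`, because `1 - M ≤ e^{-M}`. -/
theorem le_add_mul_exp_of_one_add_le {x y M : ℝ} (h : 1 + y ≤ (1 + x) * Real.exp M) :
    y ≤ (M + x) * Real.exp M := by
  have h1 : (1 - M) * Real.exp M ≤ 1 := by
    calc (1 - M) * Real.exp M ≤ Real.exp (-M) * Real.exp M := by
          gcongr
          linarith [Real.add_one_le_exp (-M)]
      _ = 1 := by rw [← Real.exp_add, neg_add_cancel, Real.exp_zero]
  linarith

end PairExcitation

end

/-! ### The a priori estimate for `sh(k)`. -/

theorem theorem5 (v : E → ℝ) (hv : Measurable v) (hv_even : ∀ x, v (-x) = v x)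
    (φ : ℝ → E → ℂ) (hφ : Measurable (Function.uncurry φ))
    (T : ℝ) (hT : 0 ≤ T)
    (hm : ∀ᵐ t ∂(volume.restrict (Icc 0 T)), MemLp (mFun v φ t) 2 volume)
    (hm_int : IntegrableOn (mKer v φ) (Icc 0 T))
    (hV : ∀ᵐ t ∂(volume.restrict (Icc 0 T)), ∀ᵐ x : E,
      Integrable fun y => v (x - y) * ‖φ t y‖ ^ 2)
    (hV_bdd : ∃ β : ℝ → ℝ, IntegrableOn β (Icc 0 T) ∧
      ∀ᵐ t ∂(volume.restrict (Icc 0 T)), ∀ᵐ x : E, |meanField v φ t x| ≤ β t)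
    (k : ℝ → L2) (hk : IsSolution v φ T k) :
    ‖sh (k T)‖ ≤ ((∫ t in (0 : ℝ)..T, ‖mKer v φ t‖) + ‖sh (k 0)‖) *
      Real.exp (∫ t in (0 : ℝ)..T, ‖mKer v φ t‖) := by
  obtain ⟨F, G, hF, hG, hW, hS, heq⟩ := hk.eqn
  obtain ⟨V, B, hVm, hBi, hB, hmf⟩ := exists_bounded_potential hv hφ hV_bdd
  have hw := integrableOn_wKer hv hφ hm hm_int
  have hu := hS.isSchrodinger hVm hB hBi hmf hk.cont hw hG
  have hp := hW.isSchrodinger hVm hB hBi hmf (continuousOn_chSubOne hk.symm hk.cont) hw hF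
  have hle := ae_im_inner_sourceS_le hv_even (fun s => hVm.comp measurable_prodMk_left) hB hk.symm
    hp hu heq
  exact le_add_mul_exp_of_one_add_le (one_add_le_mul_exp_of_sq_le hT hk.cont.norm
    (fun _ => norm_nonneg _) (fun _ => norm_nonneg _) hm_int.norm
    fun t ht => sq_norm_sub_le hm_int hu hle ht)
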